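/- A long virtual knot is an equivalence class of long virtual knot diagrams (equivalently, of Gauss diagrams on the oriented line) under the generalized Reidemeister moves. A surface realization $(\Sigma_g,D)$ of such a diagram is a realization of it, without virtual crossings, on a closed connected oriented surface $\Sigma_g$ of genus $g$ as a closed curve with a basepoint corresponding to $\pm\infty$. The $1$-supporting genus $sg_1(K)$ of a long virtual knot $K$ is the minimal $g$ such that some diagram of $K$ has a surface realization on $\Sigma_g$. Let $D$ be a diagram of $K$ with real crossings $c_1,\dots,c_n$ of signs $\varepsilon_1,\dots,\varepsilon_n\in\{\pm1\}$. Starting from the basepoint, $c_i$ is of type $0$ if it is first passed over and then under, and of type $1$ otherwise; $I_a(D)$ is the set of the indices $i$ such that $c_i$ is of type $a$. Smoothing a surface realization of $D$ at $c_i$ gives two cycles: $\alpha_i$, which does not contain the basepoint, and $\beta_i$, which does. With $\cdot$ the intersection number on the surface, put $$\omega_a(D)=\sum_{i\in I_a(D)}\varepsilon_i,\qquad W_a(D;t)=\sum_{i\in I_a(D)}\varepsilon_i\,(t^{\alpha_i\cdot\beta_i}-1),$$ $$G_{ab}(D;t)=\sum_{i\in I_a(D),\,j\in I_b(D)}\varepsilon_i\varepsilon_j\,(t^{\alpha_i\cdot\beta_j}-1)-\omega_b(D)\,W_a(D;t).$$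 The Laurent polynomial $G_{ab}(D;t)$ depends only on $K$ and is denoted by $G_{ab}(K;t)$. **Theorem 7.2.** Let $f(t)\in\mathbb{Z}[t,t^{-1}]$ be a Laurent polynomial. Then the following are equivalent. 1. There exists a long virtual knot $K$ with $G_{00}(K;t)=f(t)$. 2. There exists a long virtual knot $K'$ with $G_{00}(K';t)=f(t)$ and $sg_1(K')\le 1$. 3. $f(1)=f'(1)=0$. The same equivalence holds with $G_{11}$ in place of $G_{00}$. -/

import Mathlib

open LaurentPolynomial

/-! ### Laurent polynomials -/

/-- The value `f(1)` of an integral Laurent polynomial. -/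
noncomputable def laurentEvalOne (f : ℤ[T;T⁻¹]) : ℤ :=
  LaurentPolynomial.eval₂ (RingHom.id ℤ) (1 : ℤˣ) f

/-- The formal derivative `∑ cₙ tⁿ ↦ ∑ n cₙ tⁿ⁻¹` of an integral Laurent polynomial. -/
noncomputable def laurentDeriv (f : ℤ[T;T⁻¹]) : ℤ[T;T⁻¹] :=
  f.coeff.sum fun n c => C (n * c) * T (n - 1)

/-! ### Diagrams of long virtual knots -/

/-- A diagram of a long virtual knot, recorded by its Gauss diagram on the oriented line:
the finite set of real crossings, their signs, and the (pairwise distinct) times at which the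
line runs through each crossing, `(c, true)` being the over-passage and `(c, false)` the
under-passage of the crossing `c`. Only the order of the times matters. -/
structure LongGaussDiagram : Type 1 where
  Crossing : Type
  [fintypeCrossing : Fintype Crossing]
  [decEqCrossing : DecidableEq Crossing]
  sign : Crossing → ℤˣ
  time : Crossing × Bool → ℤ
  time_injective : Function.Injective time

namespace LongGaussDiagram

attribute [instance] LongGaussDiagram.fintypeCrossing LongGaussDiagram.decEqCrossing

/-- The passages through the crossings. -/
abbrev Passage (D : LongGaussDiagram) : Type := D.Crossing × Bool

/-- Two passages are adjacent if no other passage occurs between them. -/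
def Adjacent (D : LongGaussDiagram) (p q : D.Passage) : Prop :=
  ∀ r : D.Passage, r ≠ p → r ≠ q → (D.time r < D.time p ↔ D.time r < D.time q)

/-- `1` if `p` occurs before `q`, and `-1` otherwise. -/
def order (D : LongGaussDiagram) (p q : D.Passage) : ℤˣ :=
  if D.time p < D.time q then 1 else -1

/-- The diagram with the crossings in `S` deleted (made virtual). -/
def delete (D : LongGaussDiagram) (S : Finset D.Crossing) : LongGaussDiagram where
  Crossing := {c : D.Crossing // c ∉ S}
  sign c := D.sign c
  time p := D.time (p.1, p.2)
  time_injective := by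
    rintro ⟨⟨c, hc⟩, o⟩ ⟨⟨c', hc'⟩, o'⟩ h
    have := D.time_injective h
    simp_all

/-- The diagram in which the passages have been permuted by `π`. -/
def permute (D : LongGaussDiagram) (π : Equiv.Perm D.Passage) : LongGaussDiagram where
  Crossing := D.Crossing
  sign := D.sign
  time p := D.time (π p)
  time_injective := D.time_injective.comp π.injective

/-- The permutation of passages in a third Reidemeister move: it exchanges the two consecutive
passages on the top strand, on the middle strand and on the bottom strand of the triangle, where
`a` is the crossing of the top and the middle strand, `b` that of the top and the bottom strand,
and `c` that of the middle and the bottom strand. -/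
def trianglePerm (D : LongGaussDiagram) (a b c : D.Crossing) : Equiv.Perm D.Passage :=
  Equiv.swap (a, true) (b, true) * Equiv.swap (a, false) (c, true) *
    Equiv.swap (b, false) (c, false)

/-- The moves on Gauss diagrams of long virtual knots: relabelling, and the three Reidemeister
moves for all orientations of the strands and all ways of connecting them. (Moves that involve
virtual crossings do not change the Gauss diagram.) -/
inductive Move : LongGaussDiagram → LongGaussDiagram → Prop
  | relabel (D D' : LongGaussDiagram) (e : D.Crossing ≃ D'.Crossing)
      (hsign : ∀ c, D'.sign (e c) = D.sign c)
      (htime : ∀ p q : D.Passage,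
        D'.time (e p.1, p.2) < D'.time (e q.1, q.2) ↔ D.time p < D.time q) :
      Move D D'
  | reidemeister1 (D : LongGaussDiagram) (c : D.Crossing)
      (hadj : D.Adjacent (c, true) (c, false)) :
      Move D (D.delete {c})
  | reidemeister2 (D : LongGaussDiagram) (c d : D.Crossing) (hcd : c ≠ d)
      (hsign : D.sign d = -D.sign c)
      (hover : D.Adjacent (c, true) (d, true))
      (hunder : D.Adjacent (c, false) (d, false)) :
      Move D (D.delete {c, d})
  /-- The last two hypotheses say which signs and orders of the crossings occur on the sides of a
  triangle that is bounded by three oriented lines in the oriented plane. -/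
  | reidemeister3 (D : LongGaussDiagram) (a b c : D.Crossing)
      (hab : a ≠ b) (hac : a ≠ c) (hbc : b ≠ c)
      (htop : D.Adjacent (a, true) (b, true))
      (hmiddle : D.Adjacent (a, false) (c, true))
      (hbottom : D.Adjacent (b, false) (c, false))
      (hsign₁ : D.order (a, true) (b, true) * D.sign b =
        D.order (a, false) (c, true) * D.sign c)
      (hsign₂ : D.order (a, false) (c, true) * D.sign c =
        D.order (b, false) (c, false) * (D.sign a * D.sign b * D.sign c)) :
      Move D (D.permute (D.trianglePerm a b c))

/-! ### Intersection numbers and the polynomials -/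

/-- The type of a crossing: `0` if the over-passage comes first, `1` otherwise. -/
def type (D : LongGaussDiagram) (c : D.Crossing) : Fin 2 :=
  if D.time (c, true) < D.time (c, false) then 0 else 1

/-- The set `I_a` of the crossings of type `a`. -/
def I (D : LongGaussDiagram) (a : Fin 2) : Finset D.Crossing :=
  Finset.univ.filter fun c => D.type c = a

/-- The time of the first passage through `c`. -/
def first (D : LongGaussDiagram) (c : D.Crossing) : ℤ :=
  min (D.time (c, true)) (D.time (c, false))

/-- The time of the second passage through `c`. -/
def last (D : LongGaussDiagram) (c : D.Crossing) : ℤ :=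
  max (D.time (c, true)) (D.time (c, false))

/-- The cycle `γ_D` of the closed curve `D`. A cycle carried by the diagram is recorded by its
total coefficient on the two edges (the incoming and the outgoing one) at every passage. -/
def gamma (D : LongGaussDiagram) : D.Passage → ℤ := fun _ => 1 + 1

/-- The cycle `α_c` that arises by smoothing at `c` and does not contain the basepoint. It runs
from the first to the second passage of `c`; the two summands are its coefficients on the edge
coming into the passage `p` and on the edge going out of it. -/
def alpha (D : LongGaussDiagram) (c : D.Crossing) : D.Passage → ℤ := fun p =>
  (if D.first c < D.time p ∧ D.time p ≤ D.last c then 1 else 0) +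
    (if D.first c ≤ D.time p ∧ D.time p < D.last c then 1 else 0)

/-- The cycle `β_c` that arises by smoothing at `c` and contains the basepoint. -/
def beta (D : LongGaussDiagram) (c : D.Crossing) : D.Passage → ℤ := fun p =>
  D.gamma p - D.alpha c p

/-- Four times the intersection number of two cycles. The two strands at a crossing `k` of sign
`ε` meet transversally with intersection number `over · under = ε`, and a cycle runs along a strand
with the mean (that is, half the total) of its coefficients on the two edges of the strand. (The
contribution of a vertex is the average of the signed numbers of intersection points there after
pushing one of the cycles off to the left and to the right, which is a half-sum over the pairs of
half-edges in cyclic order; for four half-edges it takes this form.) -/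
def inter4 (D : LongGaussDiagram) (x y : D.Passage → ℤ) : ℤ :=
  ∑ k : D.Crossing,
    (D.sign k : ℤ) * (x (k, true) * y (k, false) - x (k, false) * y (k, true))

/-- The intersection number of two cycles on a surface that carries the diagram. The division
is exact for the cycles `α` and `β`. -/
def inter (D : LongGaussDiagram) (x y : D.Passage → ℤ) : ℤ := D.inter4 x y / 4

/-- The `a`-writhe `ω_a(D)`. -/
def omega (D : LongGaussDiagram) (a : Fin 2) : ℤ := ∑ i ∈ D.I a, (D.sign i : ℤ)

/-- The `a`-writhe polynomial `W_a(D; t)`. -/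
noncomputable def W (D : LongGaussDiagram) (a : Fin 2) : ℤ[T;T⁻¹] :=
  ∑ i ∈ D.I a, C (D.sign i : ℤ) * (T (D.inter (D.alpha i) (D.beta i)) - 1)

/-- The intersection polynomial `G_{ab}(D; t)`. -/
noncomputable def G (D : LongGaussDiagram) (a b : Fin 2) : ℤ[T;T⁻¹] :=
  ∑ i ∈ D.I a, ∑ j ∈ D.I b,
      C ((D.sign i : ℤ) * (D.sign j : ℤ)) * (T (D.inter (D.alpha i) (D.beta j)) - 1)
    - C (D.omega b) * D.W a

end LongGaussDiagram

namespace LongGaussDiagram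

/-! ### The division in the intersection number is exact -/

theorem alpha_self (D : LongGaussDiagram) (c : D.Crossing) (o : Bool) : D.alpha c (c, o) = 1 := by
  have h : D.time (c, true) ≠ D.time (c, false) := fun h => by simpa using D.time_injective h
  cases o <;> simp only [alpha, first, last] <;> split_ifs <;> omega

theorem alpha_of_ne (D : LongGaussDiagram) (c : D.Crossing) (p : D.Passage) (hp : p.1 ≠ c) :
    D.alpha c p = if D.first c < D.time p ∧ D.time p < D.last c then 2 else 0 := by
  have h1 : D.time p ≠ D.time (c, true) := fun h => hp (by rw [D.time_injective h])
  have h2 : D.time p ≠ D.time (c, false) := fun h => hp (by rw [D.time_injective h])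
  simp only [alpha, first, last] 
  split_ifs <;> omega

theorem four_dvd_inter4_alpha_alpha (D : LongGaussDiagram) (i j : D.Crossing) :
    4 ∣ D.inter4 (D.alpha i) (D.alpha j) := by
  by_cases hij : i = j
  · subst hij
    have : D.inter4 (D.alpha i) (D.alpha i) = 0 :=
      Finset.sum_eq_zero fun k _ => by ring
    simp [this]
  have hne : ∀ {c k : D.Crossing}, k ≠ c → ∀ o, D.alpha c (k, o) = 0 ∨ D.alpha c (k, o) = 2 := by
    intro c k hk o
    rw [alpha_of_ne D c (k, o) hk]
    split_ifs <;> simp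
  have hs : ∀ k, (D.sign k : ℤ) = 1 ∨ (D.sign k : ℤ) = -1 := fun k => by
    rcases Int.units_eq_one_or (D.sign k) with h | h <;> simp [h]
  have hij' := Ne.symm hij
  unfold inter4
  rw [← Finset.add_sum_erase _ _ (Finset.mem_univ i),
    ← Finset.add_sum_erase _ _ (Finset.mem_erase.2 ⟨hij', Finset.mem_univ j⟩), ← add_assoc]
  refine dvd_add ?_ (Finset.dvd_sum fun k hk => ?_)
  · have t1 : D.time (i, true) ≠ D.time (i, false) := fun h => by simpa using D.time_injective h
    have t2 : D.time (j, true) ≠ D.time (j, false) := fun h => by simpa using D.time_injective h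
    have t3 : ∀ o o', D.time (i, o) ≠ D.time (j, o') := fun o o' h => by
      have := D.time_injective h
      simp_all
    have h1 := t3 true true
    have h2 := t3 true false
    have h3 := t3 false true
    have h4 := t3 false false
    rw [alpha_self, alpha_self, alpha_self, alpha_self, alpha_of_ne D i _ hij',
      alpha_of_ne D i _ hij', alpha_of_ne D j _ hij, alpha_of_ne D j _ hij]
    simp only [first, last]
    rcases hs i with e | e <;> rcases hs j with e' | e' <;> rw [e, e'] <;> split_ifs <;> omega
  · simp only [Finset.mem_erase] at hk
    refine Dvd.dvd.mul_left ?_ _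
    rcases hne hk.2.1 true with e | e <;> rcases hne hk.2.1 false with e' | e' <;>
      rcases hne hk.1 true with e'' | e'' <;> rcases hne hk.1 false with e''' | e''' <;>
      rw [e, e', e'', e'''] <;> norm_num

theorem four_dvd_inter4_alpha_gamma (D : LongGaussDiagram) (i : D.Crossing) :
    4 ∣ D.inter4 (D.alpha i) D.gamma := by
  refine Finset.dvd_sum fun k _ => Dvd.dvd.mul_left ?_ _
  simp only [gamma]
  by_cases hk : k = i
  · subst hk
    simp [alpha_self]
  · rw [alpha_of_ne D i _ hk, alpha_of_ne D i _ hk]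
    split_ifs <;> norm_num

theorem inter4_alpha_beta (D : LongGaussDiagram) (i j : D.Crossing) :
    D.inter4 (D.alpha i) (D.beta j) =
      D.inter4 (D.alpha i) D.gamma - D.inter4 (D.alpha i) (D.alpha j) := by
  simp only [inter4, ← Finset.sum_sub_distrib, beta]
  exact Finset.sum_congr rfl fun k _ => by ring

theorem four_mul_inter_alpha_beta (D : LongGaussDiagram) (i j : D.Crossing) :
    4 * D.inter (D.alpha i) (D.beta j) = D.inter4 (D.alpha i) (D.beta j) := by
  refine Int.mul_ediv_cancel' ?_
  rw [inter4_alpha_beta]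
  exact dvd_sub (D.four_dvd_inter4_alpha_gamma i) (D.four_dvd_inter4_alpha_alpha i j)

/-! ### The intersection polynomials do not change under the moves -/

/-- The sign of a crossing of type `a`, and `0` for the other crossings. -/
noncomputable def weight (D : LongGaussDiagram) (a : Fin 2) (i : D.Crossing) : ℤ[T;T⁻¹] :=
  if D.type i = a then C (D.sign i : ℤ) else 0

theorem G_eq (D : LongGaussDiagram) (a b : Fin 2) :
    D.G a b = ∑ i, ∑ j, D.weight a i * D.weight b j *
      (T (D.inter (D.alpha i) (D.beta j)) - T (D.inter (D.alpha i) (D.beta i))) := by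
  have h1 : ∀ x : D.Crossing → ℤ[T;T⁻¹], ∀ a,
      ∑ i ∈ D.I a, C (D.sign i : ℤ) * x i = ∑ i, D.weight a i * x i := by
    intro x a
    rw [I, Finset.sum_filter]
    refine Finset.sum_congr rfl fun i _ => ?_
    unfold weight
    split_ifs <;> simp
  have h2 : C (D.omega b) = ∑ j, D.weight b j := by
    have := h1 (fun _ => 1) b
    simp only [mul_one] at this
    rw [← this, omega, map_sum]
  have h3 : D.W a = ∑ i, D.weight a i * (T (D.inter (D.alpha i) (D.beta i)) - 1) := h1 _ a
  have h4 : ∑ i ∈ D.I a, ∑ j ∈ D.I b,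
      C ((D.sign i : ℤ) * (D.sign j : ℤ)) * (T (D.inter (D.alpha i) (D.beta j)) - 1) =
      ∑ i, D.weight a i * ∑ j, D.weight b j * (T (D.inter (D.alpha i) (D.beta j)) - 1) := by
    rw [← h1]
    refine Finset.sum_congr rfl fun i _ => ?_
    rw [← h1, Finset.mul_sum]
    refine Finset.sum_congr rfl fun j _ => ?_
    rw [map_mul, mul_assoc]
  rw [G, h4, h2, h3, Finset.mul_sum, ← Finset.sum_sub_distrib]
  refine Finset.sum_congr rfl fun i _ => ?_
  rw [Finset.mul_sum, Finset.sum_mul, ← Finset.sum_sub_distrib]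
  exact Finset.sum_congr rfl fun j _ => by ring

theorem G_congr {D D' : LongGaussDiagram} (e : D.Crossing ≃ D'.Crossing)
    (hsign : ∀ c, D'.sign (e c) = D.sign c) (htype : ∀ c, D'.type (e c) = D.type c)
    (hinter : ∀ i j, D'.inter (D'.alpha (e i)) (D'.beta (e j)) = D.inter (D.alpha i) (D.beta j))
    (a b : Fin 2) : D.G a b = D'.G a b := by
  rw [G_eq, G_eq, ← e.sum_comp]
  refine Finset.sum_congr rfl fun i _ => ?_
  rw [← e.sum_comp]
  refine Finset.sum_congr rfl fun j _ => ?_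
  simp only [weight, hsign, htype, hinter]

theorem sum_delete (D : LongGaussDiagram) (S : Finset D.Crossing) {M : Type*} [AddCommMonoid M]
    (f : D.Crossing → M) :
    ∑ c : D.Crossing, f c = ∑ c ∈ S, f c + ∑ c : (D.delete S).Crossing, f c.1 := by
  rw [← Finset.sum_add_sum_compl S f]
  congr 1
  exact Finset.sum_subtype _ (fun x => by simp) f

theorem alpha_delete (D : LongGaussDiagram) (S : Finset D.Crossing) (c : (D.delete S).Crossing)
    (p : (D.delete S).Passage) : (D.delete S).alpha c p = D.alpha c.1 (p.1.1, p.2) := rfl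

theorem G_delete (D : LongGaussDiagram) (S : Finset D.Crossing)
    (hS : ∀ x y : D.Passage → ℤ, (∃ i ∉ S, x = D.alpha i) →
      ((∃ i ∉ S, y = D.alpha i) ∨ y = D.gamma) → 
      ∑ k ∈ S, (D.sign k : ℤ) * (x (k, true) * y (k, false) - x (k, false) * y (k, true)) = 0)
    (a b : Fin 2)
    (h1 : ∀ j, ∑ i ∈ S, D.weight a i * 
      (T (D.inter (D.alpha i) (D.beta j)) - T (D.inter (D.alpha i) (D.beta i))) = 0)
    (h2 : ∀ i, ∑ j ∈ S, D.weight b j * 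
      (T (D.inter (D.alpha i) (D.beta j)) - T (D.inter (D.alpha i) (D.beta i))) = 0) :
    D.G a b = (D.delete S).G a b := by
  have hq : ∀ i j : (D.delete S).Crossing,
      (D.delete S).inter ((D.delete S).alpha i) ((D.delete S).beta j) =
        D.inter (D.alpha i.1) (D.beta j.1) := by
    intro i j
    unfold inter
    rw [inter4_alpha_beta, inter4_alpha_beta]
    congr 2
    · unfold inter4
      rw [D.sum_delete S, hS _ _ ⟨i.1, i.2, rfl⟩ (Or.inr rfl), zero_add]
      rfl
    · unfold inter4
      rw [D.sum_delete S, hS _ _ ⟨i.1, i.2, rfl⟩ (Or.inl ⟨j.1, j.2, rfl⟩), zero_add]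
      rfl
  rw [G_eq, G_eq, D.sum_delete S]
  have e1 : ∑ i ∈ S, ∑ j, D.weight a i * D.weight b j *
      (T (D.inter (D.alpha i) (D.beta j)) - T (D.inter (D.alpha i) (D.beta i))) = 0 := by
    rw [Finset.sum_comm]
    refine Finset.sum_eq_zero fun j _ => ?_
    rw [← mul_zero (D.weight b j), ← h1 j, Finset.mul_sum]
    exact Finset.sum_congr rfl fun i _ => by ring
  rw [e1, zero_add]
  refine Finset.sum_congr rfl fun i _ => ?_
  rw [D.sum_delete S]
  have e2 : ∑ j ∈ S, D.weight a i.1 * D.weight b j *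
      (T (D.inter (D.alpha i.1) (D.beta j)) - T (D.inter (D.alpha i.1) (D.beta i.1))) = 0 := by
    rw [← mul_zero (D.weight a i.1), ← h2 i.1, Finset.mul_sum]
    exact Finset.sum_congr rfl fun i _ => by ring
  rw [e2, zero_add]
  refine Finset.sum_congr rfl fun j _ => ?_
  rw [hq, hq]
  rfl

theorem Adjacent.alpha_eq {D : LongGaussDiagram} {p q : D.Passage} (h : D.Adjacent p q)
    (i : D.Crossing) (hp : p.1 ≠ i) (hq : q.1 ≠ i) : D.alpha i p = D.alpha i q := by
  have hne : ∀ r : D.Passage, r.1 ≠ i → ∀ o, D.time r ≠ D.time (i, o) := fun r hr o e =>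
    hr (by rw [D.time_injective e])
  have a1 := h (i, true) (fun e => hp (by rw [← e])) (fun e => hq (by rw [← e]))
  have a2 := h (i, false) (fun e => hp (by rw [← e])) (fun e => hq (by rw [← e]))
  have b1 := hne p hp true
  have b2 := hne p hp false
  have b3 := hne q hq true
  have b4 := hne q hq false
  rw [alpha_of_ne D i p hp, alpha_of_ne D i q hq]
  simp only [first, last]
  split_ifs <;> omega

theorem G_reidemeister1 (D : LongGaussDiagram) (c : D.Crossing)
    (hadj : D.Adjacent (c, true) (c, false)) (a b : Fin 2) :
    D.G a b = (D.delete {c}).G a b := by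
  have hc : ∀ i, D.alpha i (c, true) = D.alpha i (c, false) := by
    intro i
    by_cases hi : c = i
    · subst hi
      rw [alpha_self, alpha_self]
    · exact hadj.alpha_eq i hi hi
  have h0 : ∀ p : D.Passage, p.1 ≠ c → D.alpha c p = 0 := by
    intro p hp
    have a1 := hadj p (fun e => hp (by rw [e])) (fun e => hp (by rw [e]))
    have b1 : D.time p ≠ D.time (c, true) := fun e => hp (by rw [D.time_injective e])
    have b2 : D.time p ≠ D.time (c, false) := fun e => hp (by rw [D.time_injective e])
    rw [alpha_of_ne D c p hp]
    simp only [first, last]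
    split_ifs <;> omega
  have hz : ∀ y : D.Passage → ℤ, y (c, true) = y (c, false) → D.inter4 (D.alpha c) y = 0 := by
    intro y hy
    refine Finset.sum_eq_zero fun k _ => ?_
    by_cases hk : k = c
    · subst hk
      rw [hc, hy]; ring
    · rw [h0 (k, true) hk, h0 (k, false) hk]; ring
  have hz' : ∀ i, D.inter4 (D.alpha i) (D.alpha c) = 0 := by
    intro i
    refine Finset.sum_eq_zero fun k _ => ?_
    by_cases hk : k = c
    · subst hk
      rw [hc i, hc k]; ring
    · rw [h0 (k, true) hk, h0 (k, false) hk]; ring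
  have hself : ∀ i, D.inter4 (D.alpha i) (D.alpha i) = 0 := fun i =>
    Finset.sum_eq_zero fun k _ => by ring
  refine D.G_delete {c} ?_ a b ?_ ?_
  · rintro x y ⟨i, -, rfl⟩ (⟨j, -, rfl⟩ | rfl)
    · simp [hc]
    · simp [hc, gamma]
  · intro j
    have : ∀ j, D.inter (D.alpha c) (D.beta j) = 0 := fun j => by
      unfold inter
      rw [hz _ (by simp only [beta, hc, gamma])]
      rfl
    simp [this]
  · intro i
    have : D.inter (D.alpha i) (D.beta c) = D.inter (D.alpha i) (D.beta i) := by
      unfold inter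
      rw [inter4_alpha_beta, inter4_alpha_beta, hz', hself]
    simp [this]

theorem inter4_swap (D : LongGaussDiagram) (x y : D.Passage → ℤ) :
    D.inter4 y x = -D.inter4 x y := by
  unfold inter4
  rw [← Finset.sum_neg_distrib]
  exact Finset.sum_congr rfl fun k _ => by ring

theorem G_reidemeister2 (D : LongGaussDiagram) (c d : D.Crossing) (hcd : c ≠ d)
    (hsign : D.sign d = -D.sign c)
    (hover : D.Adjacent (c, true) (d, true))
    (hunder : D.Adjacent (c, false) (d, false)) (a b : Fin 2) :
    D.G a b = (D.delete {c, d}).G a b := by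
  have hdc := hcd.symm
  have hs : (D.sign d : ℤ) = -(D.sign c : ℤ) := by rw [hsign]; simp
  have t1 : D.time (c, true) ≠ D.time (c, false) := fun h => by simpa using D.time_injective h
  have t2 : D.time (d, true) ≠ D.time (d, false) := fun h => by simpa using D.time_injective h
  have t3 : D.time (c, true) ≠ D.time (d, false) := fun h => by simpa using D.time_injective h
  have t4 : D.time (d, true) ≠ D.time (c, false) := fun h => by simpa using D.time_injective h
  have t5 : D.time (c, true) ≠ D.time (d, true) := fun h => by
    have := D.time_injective h
    simp_all
  have t6 : D.time (c, false) ≠ D.time (d, false) := fun h => by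
    have := D.time_injective h
    simp_all
  have a1 := hover (c, false) (by simp) (by simp)
  have a2 := hover (d, false) (by simp) (by simp)
  have a3 := hunder (c, true) (by simp) (by simp)
  have a4 := hunder (d, true) (by simp) (by simp)
  have htype : D.type c = D.type d := by
    unfold type
    split_ifs <;> first | rfl | omega
  have hw : ∀ a, D.weight a d = -D.weight a c := by
    intro a
    unfold weight
    rw [htype, hs]
    split_ifs <;> simp
  have h0 : ∀ p : D.Passage, p.1 ≠ c → p.1 ≠ d → D.alpha c p = D.alpha d p := by
    intro p hp hp'
    have u1 := hover p (fun e => hp (by rw [e])) (fun e => hp' (by rw [e]))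
    have u2 := hunder p (fun e => hp (by rw [e])) (fun e => hp' (by rw [e]))
    have b1 : D.time p ≠ D.time (c, true) := fun e => hp (by rw [D.time_injective e])
    have b2 : D.time p ≠ D.time (c, false) := fun e => hp (by rw [D.time_injective e])
    have b3 : D.time p ≠ D.time (d, true) := fun e => hp' (by rw [D.time_injective e])
    have b4 : D.time p ≠ D.time (d, false) := fun e => hp' (by rw [D.time_injective e])
    rw [alpha_of_ne D c p hp, alpha_of_ne D d p hp']
    simp only [first, last]
    split_ifs <;> omega
  -- the values of the two cycles at the four passages
  have v1 : D.alpha c (d, true) + D.alpha d (c, true) = 2 := by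
    rw [alpha_of_ne D c (d, true) hdc, alpha_of_ne D d (c, true) hcd]
    simp only [first, last]
    split_ifs <;> omega
  have v2 : D.alpha c (d, false) + D.alpha d (c, false) = 2 := by
    rw [alpha_of_ne D c (d, false) hdc, alpha_of_ne D d (c, false) hcd]
    simp only [first, last]
    split_ifs <;> omega
  -- splitting off the two crossings
  have split : ∀ x y : D.Passage → ℤ, D.inter4 x y =
      (D.sign c : ℤ) * (x (c, true) * y (c, false) - x (c, false) * y (c, true)
        - (x (d, true) * y (d, false) - x (d, false) * y (d, true))) +
      ∑ k ∈ (Finset.univ.erase c).erase d,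
        (D.sign k : ℤ) * (x (k, true) * y (k, false) - x (k, false) * y (k, true)) := by
    intro x y
    unfold inter4
    rw [← Finset.add_sum_erase _ _ (Finset.mem_univ c),
      ← Finset.add_sum_erase _ _ (Finset.mem_erase.2 ⟨hdc, Finset.mem_univ d⟩), hs]
    ring
  have rest : ∀ y : D.Passage → ℤ, ∑ k ∈ (Finset.univ.erase c).erase d,
        (D.sign k : ℤ) * (D.alpha c (k, true) * y (k, false) - D.alpha c (k, false) * y (k, true)) =
      ∑ k ∈ (Finset.univ.erase c).erase d,
        (D.sign k : ℤ) * (D.alpha d (k, true) * y (k, false) -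
          D.alpha d (k, false) * y (k, true)) := by
    intro y
    refine Finset.sum_congr rfl fun k hk => ?_
    simp only [Finset.mem_erase] at hk
    rw [h0 (k, true) hk.2.1 hk.1, h0 (k, false) hk.2.1 hk.1]
  have key : ∀ y : D.Passage → ℤ, y (c, true) = y (d, true) → y (c, false) = y (d, false) →
      D.inter4 (D.alpha c) y = D.inter4 (D.alpha d) y := by
    intro y y1 y2
    rw [split, split, rest, alpha_self, alpha_self, alpha_self, alpha_self, y1, y2]
    linear_combination (D.sign c : ℤ) * (v2 * y (d, true) - v1 * y (d, false))
  have key2 : D.inter4 (D.alpha c) (D.alpha d) = 0 := by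
    have hcc : ∑ k ∈ (Finset.univ.erase c).erase d, (D.sign k : ℤ) *
        (D.alpha d (k, true) * D.alpha d (k, false) - D.alpha d (k, false) * D.alpha d (k, true))
          = 0 := Finset.sum_eq_zero fun k _ => by ring
    rw [split, rest, hcc, alpha_self, alpha_self, alpha_self, alpha_self]
    linear_combination (D.sign c : ℤ) * (v2 - v1)
  have hself : ∀ i, D.inter4 (D.alpha i) (D.alpha i) = 0 := fun i =>
    Finset.sum_eq_zero fun k _ => by ring
  have kγ : D.inter4 (D.alpha c) D.gamma = D.inter4 (D.alpha d) D.gamma := key _ rfl rfl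
  have kα : ∀ j, D.inter4 (D.alpha c) (D.alpha j) = D.inter4 (D.alpha d) (D.alpha j) := by
    intro j
    by_cases h : c = j
    · subst h
      rw [hself, inter4_swap, key2, neg_zero]
    by_cases h' : d = j
    · subst h'
      rw [hself, key2]
    exact key _ (hover.alpha_eq j h h') (hunder.alpha_eq j h h')
  have q1 : ∀ j, D.inter (D.alpha c) (D.beta j) = D.inter (D.alpha d) (D.beta j) := by
    intro j
    unfold inter
    rw [inter4_alpha_beta, inter4_alpha_beta, kγ, kα]
  have q2 : ∀ i, D.inter (D.alpha i) (D.beta c) = D.inter (D.alpha i) (D.beta d) := by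
    intro i
    unfold inter
    rw [inter4_alpha_beta, inter4_alpha_beta, inter4_swap D (D.alpha c), kα,
      inter4_swap D (D.alpha i) (D.alpha d), neg_neg]
  refine D.G_delete {c, d} ?_ a b ?_ ?_
  · have hne : ∀ i ∉ ({c, d} : Finset D.Crossing), c ≠ i ∧ d ≠ i := by
      intro i hi
      simp only [Finset.mem_insert, Finset.mem_singleton, not_or] at hi
      exact ⟨Ne.symm hi.1, Ne.symm hi.2⟩
    rintro x y ⟨i, hi, rfl⟩ hy
    obtain ⟨y1, y2⟩ : y (c, true) = y (d, true) ∧ y (c, false) = y (d, false) := by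
      rcases hy with ⟨j, hj, rfl⟩ | rfl
      · exact ⟨hover.alpha_eq j (hne j hj).1 (hne j hj).2,
          hunder.alpha_eq j (hne j hj).1 (hne j hj).2⟩
      · exact ⟨rfl, rfl⟩
    rw [Finset.sum_pair hcd, hs, y1, y2, hover.alpha_eq i (hne i hi).1 (hne i hi).2,
      hunder.alpha_eq i (hne i hi).1 (hne i hi).2]
    ring
  · intro j
    rw [Finset.sum_pair hcd, hw, q1, q1, q2]
    ring
  · intro i
    rw [Finset.sum_pair hcd, hw, q2]
    ring

/-- The sign of a comparison of times. -/
def cmp (D : LongGaussDiagram) (p q : D.Passage) : ℤ := Int.sign (D.time p - D.time q)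

theorem alpha_eq_cmp (D : LongGaussDiagram) (i : D.Crossing) (p : D.Passage) :
    D.alpha i p = D.cmp (i, true) (i, false) * (D.cmp p (i, false) - D.cmp p (i, true)) := by
  have t1 : D.time (i, true) ≠ D.time (i, false) := fun h => by simpa using D.time_injective h
  have hs : ∀ x : ℤ, (x < 0 ∧ Int.sign x = -1) ∨ (x = 0 ∧ Int.sign x = 0) ∨
      (0 < x ∧ Int.sign x = 1) := by
    intro x
    rcases lt_trichotomy x 0 with h | h | h
    · exact Or.inl ⟨h, Int.sign_eq_neg_one_of_neg h⟩
    · exact Or.inr (Or.inl ⟨h, by simp [h]⟩)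
    · exact Or.inr (Or.inr ⟨h, Int.sign_eq_one_of_pos h⟩)
  simp only [alpha, cmp, first, last]
  rcases hs (D.time (i, true) - D.time (i, false)) with ⟨h, e⟩ | ⟨h, e⟩ | ⟨h, e⟩ <;>
  rcases hs (D.time p - D.time (i, false)) with ⟨h', e'⟩ | ⟨h', e'⟩ | ⟨h', e'⟩ <;>
  rcases hs (D.time p - D.time (i, true)) with ⟨h'', e''⟩ | ⟨h'', e''⟩ | ⟨h'', e''⟩ <;>
  rw [e, e', e''] <;> split_ifs <;> omega

theorem cmp_self (D : LongGaussDiagram) (p : D.Passage) : D.cmp p p = 0 := by simp [cmp]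

theorem cmp_swap (D : LongGaussDiagram) (p q : D.Passage) : D.cmp q p = -D.cmp p q := by
  rw [cmp, cmp, ← Int.sign_neg, neg_sub]

theorem cmp_sq (D : LongGaussDiagram) {p q : D.Passage} (h : p ≠ q) :
    D.cmp p q * D.cmp p q = 1 := by
  have : D.time p - D.time q ≠ 0 := sub_ne_zero.2 fun e => h (D.time_injective e)
  rcases lt_or_gt_of_ne this with h | h
  · rw [cmp, Int.sign_eq_neg_one_of_neg h]; rfl
  · rw [cmp, Int.sign_eq_one_of_pos h]; rfl

theorem cmp_eq_neg_order (D : LongGaussDiagram) {p q : D.Passage} (h : p ≠ q) :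
    (D.order p q : ℤ) = -D.cmp p q := by
  have : D.time p ≠ D.time q := fun e => h (D.time_injective e)
  unfold order cmp
  split_ifs with h'
  · rw [Int.sign_eq_neg_one_of_neg (by omega)]; simp
  · rw [Int.sign_eq_one_of_pos (by omega)]; simp

theorem Adjacent.cmp_eq {D : LongGaussDiagram} {p q : D.Passage} (h : D.Adjacent p q)
    (r : D.Passage) (hp : r ≠ p) (hq : r ≠ q) : D.cmp r p = D.cmp r q := by
  have h1 := h r hp hq
  have h2 : D.time r ≠ D.time p := fun e => hp (D.time_injective e)
  have h3 : D.time r ≠ D.time q := fun e => hq (D.time_injective e)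
  unfold cmp
  rcases lt_or_gt_of_ne h2 with h4 | h4
  · rw [Int.sign_eq_neg_one_of_neg (by omega), Int.sign_eq_neg_one_of_neg (by omega)]
  · rw [Int.sign_eq_one_of_pos (by omega), Int.sign_eq_one_of_pos (by omega)]

/-- The values of the cycles `α_a`, `α_b`, `α_c` on the sides of a triangle. -/
theorem triangle_values (D : LongGaussDiagram) (a b c : D.Crossing)
    (hab : a ≠ b) (hac : a ≠ c) (hbc : b ≠ c)
    (htop : D.Adjacent (a, true) (b, true))
    (hmiddle : D.Adjacent (a, false) (c, true))
    (hbottom : D.Adjacent (b, false) (c, false))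
    {u v w r s t : ℤ} (hu : D.cmp (a, true) (a, false) = u) (hv : D.cmp (b, true) (b, false) = v)
    (hw : D.cmp (c, true) (c, false) = w) (hr : D.cmp (a, true) (b, true) = r)
    (hs : D.cmp (a, false) (c, true) = s) (ht : D.cmp (b, false) (c, false) = t) :
    (D.alpha a (b, true) = 1 + u * r ∧ D.alpha a (b, false) = u * (v - w) ∧
      D.alpha a (c, true) = 1 - u * s ∧ D.alpha a (c, false) = u * (v - w)) ∧
    (D.alpha b (a, true) = 1 - v * r ∧ D.alpha b (a, false) = v * (w + u) ∧
      D.alpha b (c, true) = v * (w + u) ∧ D.alpha b (c, false) = 1 - v * t) ∧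
    (D.alpha c (a, true) = w * (v - u) ∧ D.alpha c (a, false) = 1 - w * s ∧
      D.alpha c (b, true) = w * (v - u) ∧ D.alpha c (b, false) = 1 + w * t) := by
  have hba := hab.symm
  have hca := hac.symm
  have hcb := hbc.symm
  have uu : u * u = 1 := by rw [← hu]; exact D.cmp_sq (by simp)
  have vv : v * v = 1 := by rw [← hv]; exact D.cmp_sq (by simp)
  have ww : w * w = 1 := by rw [← hw]; exact D.cmp_sq (by simp)
  -- top and middle strand
  have u1 : D.cmp (a, true) (c, true) = u := by
    rw [← hu]; exact (hmiddle.cmp_eq _ (by simp) (by simp [hac])).symm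
  have u2 : D.cmp (b, true) (a, false) = u := by
    rw [← hu, D.cmp_swap (a, false), D.cmp_swap (a, false) (a, true),
      htop.cmp_eq _ (by simp) (by simp)]
  -- top and bottom strand
  have v1 : D.cmp (a, true) (b, false) = v := by
    rw [← hv, D.cmp_swap (b, false), D.cmp_swap (b, false) (b, true),
      htop.cmp_eq _ (by simp) (by simp)]
  have v2 : D.cmp (b, true) (c, false) = v := by
    rw [← hv]; exact (hbottom.cmp_eq _ (by simp) (by simp)).symm
  have v3 : D.cmp (a, true) (c, false) = v := by
    rw [← v1]; exact (hbottom.cmp_eq _ (by simp) (by simp)).symm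
  -- middle and bottom strand
  have w1 : D.cmp (a, false) (c, false) = w := by
    rw [← hw, D.cmp_swap (c, false), D.cmp_swap (c, false) (c, true),
      hmiddle.cmp_eq _ (by simp [hca]) (by simp)]
  have w2 : D.cmp (c, true) (b, false) = w := by
    rw [← hw]; exact hbottom.cmp_eq _ (by simp) (by simp)
  have w3 : D.cmp (a, false) (b, false) = w := by
    rw [← w1]; exact hbottom.cmp_eq _ (by simp [hab]) (by simp [hac])
  simp only [alpha_eq_cmp, hu, hv, hw]
  refine ⟨⟨?_, ?_, ?_, ?_⟩, ⟨?_, ?_, ?_, ?_⟩, ⟨?_, ?_, ?_, ?_⟩⟩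
  · rw [u2, D.cmp_swap (a, true), hr]; linear_combination uu
  · rw [D.cmp_swap (a, false), D.cmp_swap (a, true), w3, v1]; ring
  · rw [D.cmp_swap (a, false), D.cmp_swap (a, true), hs, u1]; linear_combination uu
  · rw [D.cmp_swap (a, false), D.cmp_swap (a, true), w1, v3]; ring
  · rw [v1, hr]; linear_combination vv
  · rw [w3, D.cmp_swap (b, true), u2]; ring
  · rw [w2, D.cmp_swap (b, true), ← hmiddle.cmp_eq _ (by simp) (by simp [hbc]), u2]; ring
  · rw [D.cmp_swap (b, false), D.cmp_swap (b, true), ht, v2]; linear_combination vv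
  · rw [v3, u1]
  · rw [w1, hs]; linear_combination ww
  · rw [v2, ← hmiddle.cmp_eq _ (by simp) (by simp [hbc]), u2]
  · rw [ht, D.cmp_swap (c, true), w2]; linear_combination ww

/-- The cycle `α_i` of the diagram with permuted passages. -/
def palpha (D : LongGaussDiagram) (π : Equiv.Perm D.Passage) (i : D.Crossing) (p : D.Passage) : ℤ :=
  (D.permute π).alpha i p

/-- The comparison of times in the diagram with permuted passages. -/
def pcmp (D : LongGaussDiagram) (π : Equiv.Perm D.Passage) (p q : D.Passage) : ℤ :=
  D.cmp (π p) (π q)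

theorem palpha_self (D : LongGaussDiagram) (π : Equiv.Perm D.Passage) (i : D.Crossing) (o : Bool) :
    D.palpha π i (i, o) = 1 := (D.permute π).alpha_self i o

theorem palpha_eq (D : LongGaussDiagram) (π : Equiv.Perm D.Passage) (i : D.Crossing)
    (p : D.Passage) : D.palpha π i p =
      D.pcmp π (i, true) (i, false) * (D.pcmp π p (i, false) - D.pcmp π p (i, true)) :=
  (D.permute π).alpha_eq_cmp i p

theorem permute_adjacent (D : LongGaussDiagram) (π : Equiv.Perm D.Passage) {p q : D.Passage}
    (h : D.Adjacent (π p) (π q)) : (D.permute π).Adjacent p q := fun r h1 h2 =>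
  h (π r) (fun e => h1 (π.injective e)) (fun e => h2 (π.injective e))

theorem palpha_triangle (D : LongGaussDiagram) (π : Equiv.Perm D.Passage) (a b c : D.Crossing)
    (hab : a ≠ b) (hac : a ≠ c) (hbc : b ≠ c)
    (htop : D.Adjacent (π (a, true)) (π (b, true)))
    (hmiddle : D.Adjacent (π (a, false)) (π (c, true)))
    (hbottom : D.Adjacent (π (b, false)) (π (c, false)))
    {u v w r s t : ℤ} (hu : D.pcmp π (a, true) (a, false) = u)
    (hv : D.pcmp π (b, true) (b, false) = v)
    (hw : D.pcmp π (c, true) (c, false) = w) (hr : D.pcmp π (a, true) (b, true) = r)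
    (hs : D.pcmp π (a, false) (c, true) = s) (ht : D.pcmp π (b, false) (c, false) = t) :
    (D.palpha π a (b, true) = 1 + u * r ∧ D.palpha π a (b, false) = u * (v - w) ∧
      D.palpha π a (c, true) = 1 - u * s ∧ D.palpha π a (c, false) = u * (v - w)) ∧
    (D.palpha π b (a, true) = 1 - v * r ∧ D.palpha π b (a, false) = v * (w + u) ∧
      D.palpha π b (c, true) = v * (w + u) ∧ D.palpha π b (c, false) = 1 - v * t) ∧
    (D.palpha π c (a, true) = w * (v - u) ∧ D.palpha π c (a, false) = 1 - w * s ∧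
      D.palpha π c (b, true) = w * (v - u) ∧ D.palpha π c (b, false) = 1 + w * t) :=
  (D.permute π).triangle_values a b c hab hac hbc (D.permute_adjacent π htop)
    (D.permute_adjacent π hmiddle) (D.permute_adjacent π hbottom) hu hv hw hr hs ht

theorem type_permute (D : LongGaussDiagram) (π : Equiv.Perm D.Passage) (i : D.Crossing)
    (h : D.pcmp π (i, true) (i, false) = D.cmp (i, true) (i, false)) :
    (D.permute π).type i = D.type i := by
  have hlt : ∀ z : ℤ, Int.sign z = -1 ↔ z < 0 := fun z => Int.sign_eq_neg_one_iff_neg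
  have : D.time (π (i, true)) < D.time (π (i, false)) ↔ D.time (i, true) < D.time (i, false) := by
    rw [← sub_neg, ← hlt, ← sub_neg (a := D.time (i, true)), ← hlt]
    exact Eq.congr_left h
  exact if_congr this rfl rfl

theorem G_permute (D : LongGaussDiagram) (π : Equiv.Perm D.Passage)
    (h : ∀ i, D.pcmp π (i, true) (i, false) = D.cmp (i, true) (i, false))
    (hα : ∀ i j, D.inter4 (D.palpha π i) (D.palpha π j) = D.inter4 (D.alpha i) (D.alpha j))
    (hγ : ∀ i, D.inter4 (D.palpha π i) D.gamma = D.inter4 (D.alpha i) D.gamma) (a b : Fin 2) :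
    D.G a b = (D.permute π).G a b := by
  refine G_congr (D' := D.permute π) (Equiv.refl D.Crossing) (fun _ => rfl)
    (fun i => D.type_permute π i (h i)) (fun i j => ?_) a b
  have e : (D.permute π).inter4 ((D.permute π).alpha i) ((D.permute π).beta j) =
      D.inter4 (D.alpha i) (D.beta j) :=
    ((D.permute π).inter4_alpha_beta i j).trans
      ((congrArg₂ (· - ·) (hγ i) (hα i j)).trans (D.inter4_alpha_beta i j).symm)
  exact congrArg (· / 4) e

set_option linter.unusedSimpArgs false in
theorem G_reidemeister3 (D : LongGaussDiagram) (a b c : D.Crossing)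
    (hab : a ≠ b) (hac : a ≠ c) (hbc : b ≠ c)
    (htop : D.Adjacent (a, true) (b, true))
    (hmiddle : D.Adjacent (a, false) (c, true))
    (hbottom : D.Adjacent (b, false) (c, false))
    (hsign₁ : D.order (a, true) (b, true) * D.sign b =
      D.order (a, false) (c, true) * D.sign c)
    (hsign₂ : D.order (a, false) (c, true) * D.sign c =
      D.order (b, false) (c, false) * (D.sign a * D.sign b * D.sign c)) (x y : Fin 2) :
    D.G x y = (D.permute (D.trianglePerm a b c)).G x y := by
  have hba := hab.symm
  have hca := hac.symm
  have hcb := hbc.symm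
  set π := D.trianglePerm a b c with hπ
  have p1 : π (a, true) = (b, true) := by
    simp [hπ, trianglePerm, Equiv.swap_apply_def, hab, hac, hbc, hba, hca, hcb]
  have p2 : π (b, true) = (a, true) := by
    simp [hπ, trianglePerm, Equiv.swap_apply_def, hab, hac, hbc, hba, hca, hcb]
  have p3 : π (a, false) = (c, true) := by
    simp [hπ, trianglePerm, Equiv.swap_apply_def, hab, hac, hbc, hba, hca, hcb]
  have p4 : π (c, true) = (a, false) := by
    simp [hπ, trianglePerm, Equiv.swap_apply_def, hab, hac, hbc, hba, hca, hcb]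
  have p5 : π (b, false) = (c, false) := by
    simp [hπ, trianglePerm, Equiv.swap_apply_def, hab, hac, hbc, hba, hca, hcb]
  have p6 : π (c, false) = (b, false) := by
    simp [hπ, trianglePerm, Equiv.swap_apply_def, hab, hac, hbc, hba, hca, hcb]
  have p7 : ∀ k o, k ≠ a → k ≠ b → k ≠ c → π (k, o) = (k, o) := by
    intro k o h1 h2 h3
    simp [hπ, trianglePerm, Equiv.swap_apply_def, h1, h2, h3]
  have cases4 : ∀ k : D.Crossing, k = a ∨ k = b ∨ k = c ∨ (k ≠ a ∧ k ≠ b ∧ k ≠ c) := by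
    intro k; tauto
  have hinv : ∀ p, π (π p) = p := by
    rintro ⟨k, o⟩
    rcases cases4 k with rfl | rfl | rfl | ⟨h1, h2, h3⟩
    · cases o <;> simp only [p1, p2, p3, p4]
    · cases o <;> simp only [p1, p2, p5, p6]
    · cases o <;> simp only [p3, p4, p5, p6]
    · rw [p7 k o h1 h2 h3, p7 k o h1 h2 h3]
  have hsymm : ∀ {p q : D.Passage}, D.Adjacent p q → D.Adjacent q p := fun h r h1 h2 =>
    (h r h2 h1).symm
  have hadj : ∀ p, D.Adjacent p (π p) := by
    rintro ⟨k, o⟩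
    rcases cases4 k with rfl | rfl | rfl | ⟨h1, h2, h3⟩
    · cases o
      · rw [p3]; exact hmiddle
      · rw [p1]; exact htop
    · cases o
      · rw [p5]; exact hbottom
      · rw [p2]; exact hsymm htop
    · cases o
      · rw [p6]; exact hsymm hbottom
      · rw [p4]; exact hsymm hmiddle
    · rw [p7 k o h1 h2 h3]; exact fun r _ _ => Iff.rfl
  have hcmp0 : ∀ p q, D.pcmp π p q = D.cmp (π p) (π q) := fun p q => rfl
  have hcmp : ∀ p q, p ≠ q → π p ≠ q → D.pcmp π p q = D.cmp p q := by
    intro p q h1 h2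
    rw [hcmp0]
    have h3 : π q ≠ p := fun e => h2 (by rw [← e, hinv])
    have h4 : π q ≠ π p := fun e => h1 (π.injective e).symm
    rw [D.cmp_swap (π q) (π p), ← (hadj p).cmp_eq (π q) h3 h4, ← D.cmp_swap (π q) p,
      ← (hadj q).cmp_eq p h1 h3.symm]
  have hcmp' : ∀ p q, π p = q → D.pcmp π p q = - D.cmp p q := by
    intro p q h
    subst h
    rw [hcmp0, hinv, D.cmp_swap]
  have hπi : ∀ i, π (i, true) ≠ (i, false) := by
    intro i
    rcases cases4 i with rfl | rfl | rfl | ⟨h1, h2, h3⟩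
    · rw [p1]; simp
    · rw [p2]; simp
    · rw [p4]; simp [hac]
    · rw [p7 _ _ h1 h2 h3]; simp
  have hself : ∀ i, D.pcmp π (i, true) (i, false) = D.cmp (i, true) (i, false) := fun i =>
    hcmp _ _ (by simp) (hπi i)
  have hα : ∀ i p, (π p).1 ≠ i ∨ π p = p → D.palpha π i p = D.alpha i p := by
    intro i p h
    have h' : ∀ o, D.pcmp π p (i, o) = D.cmp p (i, o) := by
      intro o
      by_cases hp : p = (i, o)
      · rw [hp, hcmp0, D.cmp_self, D.cmp_self]
      · refine hcmp _ _ hp fun e => ?_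
        rcases h with h | h
        · exact h (by rw [e])
        · exact hp (h.symm.trans e)
    rw [palpha_eq, alpha_eq_cmp, hself, h', h']
  -- the six values of every cycle
  have vD := D.triangle_values a b c hab hac hbc htop hmiddle hbottom rfl rfl rfl rfl rfl rfl
  have vE := D.palpha_triangle π a b c hab hac hbc (by rw [p1, p2]; exact hsymm htop)
    (by rw [p3, p4]; exact hsymm hmiddle) (by rw [p5, p6]; exact hsymm hbottom)
    (hself a) (hself b) (hself c) (hcmp' _ _ p1) (hcmp' _ _ p3) (hcmp' _ _ p5)
  -- the conditions on the signs
  have sq : ∀ z : ℤˣ, (z : ℤ) * z = 1 := fun z => by rw [← Units.val_mul]; simp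
  have k1 := congrArg (Units.val) hsign₁
  have k2 := congrArg (Units.val) hsign₂
  simp only [Units.val_mul] at k1 k2
  rw [cmp_eq_neg_order _ (by simpa using hab), cmp_eq_neg_order _ (by simp)] at k1
  rw [cmp_eq_neg_order _ (by simp), cmp_eq_neg_order _ (by simpa using hbc)] at k2
  generalize D.cmp (a, true) (a, false) = u at vD vE
  generalize D.cmp (b, true) (b, false) = v at vD vE
  generalize D.cmp (c, true) (c, false) = w at vD vE
  generalize D.cmp (a, true) (b, true) = r at vD vE k1 k2
  generalize D.cmp (a, false) (c, true) = s at vD vE k1 k2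
  generalize D.cmp (b, false) (c, false) = t at vD vE k1 k2
  have sa := sq (D.sign a)
  have sb := sq (D.sign b)
  have sc := sq (D.sign c)
  have h1 : r * D.sign b = s * D.sign c := by linear_combination -k1
  have h3 : s * D.sign a = t * D.sign b := by
    linear_combination (-(D.sign c * D.sign a : ℤ)) * k2 - s * D.sign a * sc +
      t * D.sign b * D.sign c * D.sign c * sa + t * D.sign b * sc
  have h2 : r * D.sign a = t * D.sign c := by
    linear_combination (D.sign a * D.sign b : ℤ) * h1 + D.sign c * D.sign b * h3 -
      r * D.sign a * sb + t * D.sign c * sb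
  obtain ⟨⟨a1, a2, a3, a4⟩, ⟨b1, b2, b3, b4⟩, ⟨c1, c2, c3, c4⟩⟩ := vD
  obtain ⟨⟨a1', a2', a3', a4'⟩, ⟨b1', b2', b3', b4'⟩, ⟨c1', c2', c3', c4'⟩⟩ := vE
  -- reduction to the three crossings
  have split : ∀ (x y : D.Passage → ℤ), D.inter4 x y =
      (D.sign a : ℤ) * (x (a, true) * y (a, false) - x (a, false) * y (a, true)) +
      (D.sign b : ℤ) * (x (b, true) * y (b, false) - x (b, false) * y (b, true)) +
      (D.sign c : ℤ) * (x (c, true) * y (c, false) - x (c, false) * y (c, true)) +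
      ∑ k ∈ ((Finset.univ.erase a).erase b).erase c,
        (D.sign k : ℤ) * (x (k, true) * y (k, false) - x (k, false) * y (k, true)) := by
    intro x y
    unfold inter4
    rw [← Finset.add_sum_erase _ _ (Finset.mem_univ a),
      ← Finset.add_sum_erase _ _ (Finset.mem_erase.2 ⟨hab.symm, Finset.mem_univ b⟩),
      ← Finset.add_sum_erase _ _ (Finset.mem_erase.2 ⟨hbc.symm,
        Finset.mem_erase.2 ⟨hac.symm, Finset.mem_univ c⟩⟩)]
    ring
  have gen : ∀ i, i ≠ a → i ≠ b → i ≠ c →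
      D.alpha i (b, true) = D.alpha i (a, true) ∧ D.alpha i (c, true) = D.alpha i (a, false) ∧
      D.alpha i (c, false) = D.alpha i (b, false) := by
    intro i i1 i2 i3
    exact ⟨(htop.alpha_eq i i1.symm i2.symm).symm, (hmiddle.alpha_eq i i1.symm i3.symm).symm,
      (hbottom.alpha_eq i i2.symm i3.symm).symm⟩
  have gen' : ∀ i, i ≠ a → i ≠ b → i ≠ c → ∀ p, D.palpha π i p = D.alpha i p := by
    intro i i1 i2 i3 p
    apply hα
    by_contra! h
    have : π p = (i, (π p).2) := by rw [← h.1]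
    have h' := p7 i (π p).2 i1 i2 i3
    rw [← this, hinv] at h'
    exact h.2 h'.symm
  have out : ∀ i k o, k ≠ a → k ≠ b → k ≠ c → D.palpha π i (k, o) = D.alpha i (k, o) :=
    fun i k o k1 k2 k3 => hα i _ (Or.inr (p7 k o k1 k2 k3))
  have key : ∀ (x x' y y' : D.Passage → ℤ),
      (∀ k o, k ≠ a → k ≠ b → k ≠ c → x' (k, o) = x (k, o)) →
      (∀ k o, k ≠ a → k ≠ b → k ≠ c → y' (k, o) = y (k, o)) →
      (D.sign a : ℤ) * (x' (a, true) * y' (a, false) - x' (a, false) * y' (a, true)) +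
      (D.sign b : ℤ) * (x' (b, true) * y' (b, false) - x' (b, false) * y' (b, true)) +
      (D.sign c : ℤ) * (x' (c, true) * y' (c, false) - x' (c, false) * y' (c, true)) =
      (D.sign a : ℤ) * (x (a, true) * y (a, false) - x (a, false) * y (a, true)) +
      (D.sign b : ℤ) * (x (b, true) * y (b, false) - x (b, false) * y (b, true)) +
      (D.sign c : ℤ) * (x (c, true) * y (c, false) - x (c, false) * y (c, true)) →
      D.inter4 x' y' = D.inter4 x y := by
    intro x x' y y' hx hy h
    rw [split, split x, h]
    refine congrArg₂ (· + ·) rfl (Finset.sum_congr rfl fun k hk => ?_)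
    simp only [Finset.mem_erase] at hk
    obtain ⟨k3, k2, k1, -⟩ := hk
    rw [hx k _ k1 k2 k3, hx k _ k1 k2 k3, hy k _ k1 k2 k3, hy k _ k1 k2 k3]
  have e1 := fun o => D.alpha_self a o
  have e2 := fun o => D.alpha_self b o
  have e3 := fun o => D.alpha_self c o
  have e1' : ∀ o, D.palpha π a (a, o) = 1 := fun o => D.palpha_self π a o
  have e2' : ∀ o, D.palpha π b (b, o) = 1 := fun o => D.palpha_self π b o
  have e3' : ∀ o, D.palpha π c (c, o) = 1 := fun o => D.palpha_self π c o
  -- a cycle that is not involved in the triangle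
  have key_gen : ∀ i (y y' : D.Passage → ℤ), (∀ p, y' p = y p) → y (b, true) = y (a, true) →
      y (c, true) = y (a, false) → y (c, false) = y (b, false) →
      D.inter4 (D.palpha π i) y' = D.inter4 (D.alpha i) y := by
    intro i y y' hy y1 y2 y3
    refine key _ _ _ _ (out i) (fun k o _ _ _ => hy _) ?_
    simp only [hy, y1, y2, y3]
    rcases cases4 i with rfl | rfl | rfl | ⟨i1, i2, i3⟩
    · rw [a1, a2, a3, a4, a1', a2', a3', a4', e1, e1, e1', e1']
      linear_combination (-2 * u * y (b, false)) * h1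
    · rw [b1, b2, b3, b4, b1', b2', b3', b4', e2, e2, e2', e2']
      linear_combination (2 * v * y (a, false)) * h2
    · rw [c1, c2, c3, c4, c1', c2', c3', c4', e3, e3, e3', e3']
      linear_combination (-2 * w * y (a, true)) * h3
    · simp only [gen' i i1 i2 i3]
  have kγ : ∀ i, D.inter4 (D.palpha π i) D.gamma = D.inter4 (D.alpha i) D.gamma := fun i =>
    key_gen i _ _ (fun _ => rfl) rfl rfl rfl
  have kz : ∀ x, D.inter4 x x = 0 := fun x =>
    Finset.sum_eq_zero fun k _ => by ring
  have kab : D.inter4 (D.palpha π a) (D.palpha π b) = D.inter4 (D.alpha a) (D.alpha b) := by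
    refine key _ _ _ _ (out a) (out b) ?_
    rw [a1, a2, a3, a4, a1', a2', a3', a4', e1, e1, e1', e1',
      b1, b2, b3, b4, b1', b2', b3', b4', e2, e2, e2', e2']
    linear_combination (-2 * v) * h2 - 2 * u * h1
  have kac : D.inter4 (D.palpha π a) (D.palpha π c) = D.inter4 (D.alpha a) (D.alpha c) := by
    refine key _ _ _ _ (out a) (out c) ?_
    rw [a1, a2, a3, a4, a1', a2', a3', a4', e1, e1, e1', e1',
      c1, c2, c3, c4, c1', c2', c3', c4', e3, e3, e3', e3']
    linear_combination (-2 * u) * h1 + 2 * w * h3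
  have kbc : D.inter4 (D.palpha π b) (D.palpha π c) = D.inter4 (D.alpha b) (D.alpha c) := by
    refine key _ _ _ _ (out b) (out c) ?_
    rw [b1, b2, b3, b4, b1', b2', b3', b4', e2, e2, e2', e2',
      c1, c2, c3, c4, c1', c2', c3', c4', e3, e3, e3', e3']
    linear_combination (2 * v) * h2 + 2 * w * h3
  have kgen : ∀ i j, j ≠ a → j ≠ b → j ≠ c →
      D.inter4 (D.palpha π i) (D.palpha π j) = D.inter4 (D.alpha i) (D.alpha j) := by
    intro i j j1 j2 j3
    obtain ⟨g1, g2, g3⟩ := gen j j1 j2 j3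
    exact key_gen i _ _ (gen' j j1 j2 j3) g1 g2 g3
  have kα : ∀ i j : D.Crossing,
      D.inter4 (D.palpha π i) (D.palpha π j) = D.inter4 (D.alpha i) (D.alpha j) := by
    intro i j
    rcases cases4 j with rfl | rfl | rfl | ⟨j1, j2, j3⟩
    · rcases cases4 i with rfl | rfl | rfl | ⟨i1, i2, i3⟩
      · rw [kz, kz]
      · rw [inter4_swap D (D.palpha π j), inter4_swap D (D.alpha j), kab]
      · rw [inter4_swap D (D.palpha π j), inter4_swap D (D.alpha j), kac]
      · rw [inter4_swap D (D.palpha π j), inter4_swap D (D.alpha j), kgen _ _ i1 i2 i3]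
    · rcases cases4 i with rfl | rfl | rfl | ⟨i1, i2, i3⟩
      · exact kab
      · rw [kz, kz]
      · rw [inter4_swap D (D.palpha π j), inter4_swap D (D.alpha j), kbc]
      · rw [inter4_swap D (D.palpha π j), inter4_swap D (D.alpha j), kgen _ _ i1 i2 i3]
    · rcases cases4 i with rfl | rfl | rfl | ⟨i1, i2, i3⟩
      · exact kac
      · exact kbc
      · rw [kz, kz]
      · rw [inter4_swap D (D.palpha π j), inter4_swap D (D.alpha j), kgen _ _ i1 i2 i3]
    · exact kgen i j j1 j2 j3
  exact D.G_permute π hself kα kγ x y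

theorem G_relabel (D D' : LongGaussDiagram) (e : D.Crossing ≃ D'.Crossing)
    (hsign : ∀ c, D'.sign (e c) = D.sign c)
    (htime : ∀ p q : D.Passage,
      D'.time (e p.1, p.2) < D'.time (e q.1, q.2) ↔ D.time p < D.time q) (a b : Fin 2) :
    D.G a b = D'.G a b := by
  have hα : ∀ i k o, D'.alpha (e i) (e k, o) = D.alpha i (k, o) := by
    intro i k o
    have h1 := htime (i, true) (k, o)
    have h2 := htime (i, false) (k, o)
    have h3 := htime (k, o) (i, true)
    have h4 := htime (k, o) (i, false)
    have h5 := htime (i, true) (i, false)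
    simp only [alpha, first, last] at *
    split_ifs <;> omega
  refine G_congr e hsign (fun c => if_congr (htime (c, true) (c, false)) rfl rfl) (fun i j => ?_) a b
  unfold inter
  rw [inter4_alpha_beta, inter4_alpha_beta]
  congr 2
  · unfold inter4
    rw [← e.sum_comp]
    refine Finset.sum_congr rfl fun k _ => ?_
    simp only [hsign, hα, gamma]
  · unfold inter4
    rw [← e.sum_comp]
    refine Finset.sum_congr rfl fun k _ => ?_
    simp only [hsign, hα]

theorem Move.G_eq {D D' : LongGaussDiagram} (h : Move D D') (a b : Fin 2) :
    D.G a b = D'.G a b := by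
  cases h with
  | relabel _ e hsign htime => exact G_relabel _ _ e hsign htime a b
  | reidemeister1 c hadj => exact G_reidemeister1 _ c hadj a b
  | reidemeister2 c d hcd hsign hover hunder =>
    exact G_reidemeister2 _ c d hcd hsign hover hunder a b
  | reidemeister3 i j k hij hik hjk h1 h2 h3 h4 h5 =>
    exact G_reidemeister3 _ i j k hij hik hjk h1 h2 h3 h4 h5 a b

end LongGaussDiagram

/-! ### Long virtual knots -/

/-- A long virtual knot: a diagram up to the equivalence relation generated by the moves. -/
def LongVirtualKnot : Type 1 := Quot LongGaussDiagram.Move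

/-- The long virtual knot presented by a diagram. -/
def LongGaussDiagram.knot (D : LongGaussDiagram) : LongVirtualKnot := Quot.mk _ D

/-- The intersection polynomial `G_{ab}(K; t)` of a long virtual knot. -/
noncomputable def LongVirtualKnot.G (K : LongVirtualKnot) (a b : Fin 2) : ℤ[T;T⁻¹] :=
  Quot.lift (fun D : LongGaussDiagram => D.G a b) (fun _ _ h => h.G_eq a b) K

/-! ### Surface realizations and the supporting genus -/

/-- A closed connected oriented surface with a finite cell decomposition (with at least one edge):
the set of oriented edges ("darts"), the permutation `rot` that takes a dart to the
counterclockwise next one among the darts leaving the same vertex, and the involution `flip` that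
reverses darts. Vertices, edges and faces are the cycles of `rot`, of `flip` and of
`rot * flip`. -/
structure CellularSurface : Type 1 where
  Dart : Type
  [fintypeDart : Fintype Dart]
  [nonemptyDart : Nonempty Dart]
  rot : Equiv.Perm Dart
  flip : Equiv.Perm Dart
  flip_flip : ∀ d, flip (flip d) = d
  flip_ne : ∀ d, flip d ≠ d
  connected : ∀ d d' : Dart, Relation.ReflTransGen (fun x y => y = rot x ∨ y = flip x) d d'

/-- The number of cycles (fixed points included) of a permutation. -/
noncomputable def numCycles {X : Type} (π : Equiv.Perm X) : ℕ :=
  Nat.card (Quotient (Equiv.Perm.SameCycle.setoid π))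

/-- The surface has genus `g`: its Euler characteristic is `2 - 2g`. -/
def CellularSurface.HasGenus (S : CellularSurface) (g : ℕ) : Prop :=
  (numCycles S.rot : ℤ) - numCycles S.flip + numCycles (S.rot * S.flip) = 2 - 2 * g

namespace LongGaussDiagram

/-- The vertices of the closed curve presented by `D`: the passages, and the basepoint `none`
that corresponds to `±∞`. -/
abbrev Stop (D : LongGaussDiagram) : Type := Option D.Passage

/-- `D.Next p q` says that `q` is the stop that directly follows the stop `p` on the closed
curve. -/
def Next (D : LongGaussDiagram) : D.Stop → D.Stop → Prop
  | none, none => IsEmpty D.Crossing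
  | none, some q => ∀ r, D.time q ≤ D.time r
  | some p, none => ∀ r, D.time r ≤ D.time p
  | some p, some q => D.time p < D.time q ∧ ∀ r, ¬ (D.time p < D.time r ∧ D.time r < D.time q)

/-- The half-edges of the closed curve: `(p, true)` leaves the stop `p` in the direction of the
curve, `(p, false)` leaves it in the opposite direction. -/
abbrev HalfEdge (D : LongGaussDiagram) : Type := D.Stop × Bool

/-- The counterclockwise next half-edge. At a positive crossing the counterclockwise order is:
over-strand forward, under-strand forward, over-strand backward, under-strand backward. At a
negative crossing it is: over-strand forward, under-strand backward, over-strand backward,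
under-strand forward. -/
def nextHalfEdge (D : LongGaussDiagram) : D.HalfEdge → D.HalfEdge
  | (none, b) => (none, !b)
  | (some (c, true), b) => (some (c, false), if D.sign c = 1 then b else !b)
  | (some (c, false), b) => (some (c, true), if D.sign c = 1 then !b else b)

/-- A realization of the diagram `D` on a closed oriented surface: the closed curve, with its
basepoint, its crossings and their signs as prescribed by `D`, is embedded as a subgraph in the
graph of a cell decomposition of the surface. The complement of the curve need not consist of
disks, since the cell decomposition may have further vertices and edges. -/
structure SurfaceRealization (D : LongGaussDiagram) (S : CellularSurface) where
  dart : D.HalfEdge → S.Dart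
  dart_injective : Function.Injective dart
  /-- The edge leaving a stop forward leads to the next stop. -/
  flip_dart : ∀ p q, D.Next p q → S.flip (dart (p, true)) = dart (q, false)
  /-- Turning counterclockwise about a vertex, one meets the half-edges of `D` there in the
  prescribed cyclic order, and no other half-edges of `D`. -/
  rot_dart : ∀ h, ∃ n : ℕ, 0 < n ∧ (S.rot ^ n) (dart h) = dart (D.nextHalfEdge h) ∧
    ∀ m : ℕ, 0 < m → m < n → (S.rot ^ m) (dart h) ∉ Set.range dart

end LongGaussDiagram

/-- The `1`-supporting genus `sg₁(K)`: the minimal genus of a closed oriented surface on which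
some diagram of `K` is realized. -/
noncomputable def LongVirtualKnot.sg₁ (K : LongVirtualKnot) : ℕ∞ :=
  sInf {n : ℕ∞ | ∃ g : ℕ, n = g ∧ ∃ (D : LongGaussDiagram) (S : CellularSurface),
    D.knot = K ∧ S.HasGenus g ∧ Nonempty (D.SurfaceRealization S)}

/-! ### Values and derivatives of Laurent polynomials at `1` -/

/-! Necessity. Absorbing the term `ω W`, the polynomial `G_aa` becomes the sum over pairs of
crossings of type `a` of `ε_i ε_j (t ^ (α_i · β_j) - t ^ (α_i · β_i))`. Its value at `1` vanishes
term by term. Since `β_j = γ - α_j`, its derivative at `1` is `-∑ ε_i ε_j (α_i · α_j)`, which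
vanishes because the intersection form is antisymmetric (`laurentEvalOne_G`, `laurentDerivOne_G`).

Sufficiency. Suppose the crossings fall into two classes with indicator `s` such that, with `e_i =
α_i · γ`, one has `α_i · α_j = e_i s_j - e_j s_i`, as if `(s_i, e_i)` were the coordinates of `α_i`
in the homology of a torus. Then `G_aa` is the product of the sums of `ε_i (t ^ e_i - 1)` over the
two classes of crossings of type `a` (`G_eq_mul`). Crossing changes affect neither the intersection
numbers nor the realizability on a surface, but they switch types. Hence in a diagram with all
crossings of type `0` any set of crossings can be selected to contribute (`exists_knot_G_eq`).

The grid diagrams have this form (`grid_inter`). On the first `2 * M` columns the exponents `-1, …,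
-A` are available, each with `M` crossings of either sign; on the last two columns the exponents `1,
…, A`, each once with either sign. A Laurent polynomial with a double zero at `1` is `t ^ (-m) (t -
1) u` with a polynomial `u` vanishing at `1`. The last columns supply `t ^ (n + 1) - t ^ n` and the
first columns supply `t ^ (-m - n) u`; the constants `-1` in the terms `t ^ e - 1` add up to `-u(1)
= 0`.

Gluing disks to a grid gives a torus, because the number of faces equals the number of crossings
(`numCycles_gridFacePerm`). The faces are counted by an explicit labelling of the half-edges. -/

theorem laurentEvalOne_C_mul_T (z n : ℤ) : laurentEvalOne (C z * T n) = z := by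
  simp [laurentEvalOne]

theorem laurentDeriv_add (f g : ℤ[T;T⁻¹]) :
    laurentDeriv (f + g) = laurentDeriv f + laurentDeriv g := by
  unfold laurentDeriv
  rw [AddMonoidAlgebra.coeff_add, Finsupp.sum_add_index']
  · intro n; simp
  · intro n x y; rw [mul_add, map_add, add_mul]

theorem laurentDeriv_C_mul_T (z n : ℤ) : laurentDeriv (C z * T n) = C (n * z) * T (n - 1) := by
  unfold laurentDeriv
  rw [← single_eq_C_mul_T, AddMonoidAlgebra.coeff_single, Finsupp.sum_single_index]
  simp

/-- The value `f'(1)` as an additive map. -/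
noncomputable def laurentDerivOne : ℤ[T;T⁻¹] →+ ℤ where
  toFun f := laurentEvalOne (laurentDeriv f)
  map_zero' := by simp [laurentDeriv, laurentEvalOne]
  map_add' f g := by rw [laurentDeriv_add]; exact map_add (LaurentPolynomial.eval₂ _ _) _ _

theorem laurentDerivOne_C_mul_T (z n : ℤ) : laurentDerivOne (C z * T n) = n * z := by
  change laurentEvalOne (laurentDeriv _) = _
  rw [laurentDeriv_C_mul_T, laurentEvalOne_C_mul_T]

/-- The product rule at `1`. It allows negative powers to be cleared: for `f` vanishing at `1`, a
factor `T m` does not affect the derivative there. -/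
theorem laurentDerivOne_mul_T (f : ℤ[T;T⁻¹]) (m : ℤ) :
    laurentDerivOne (f * T m) = laurentDerivOne f + m * laurentEvalOne f := by
  induction f using LaurentPolynomial.induction_on' with
  | add p q hp hq =>
    have : laurentEvalOne (p + q) = laurentEvalOne p + laurentEvalOne q :=
      map_add (LaurentPolynomial.eval₂ _ _) _ _
    rw [add_mul, map_add, map_add, hp, hq, this]; ring
  | C_mul_T n a =>
    rw [mul_assoc, ← T_add, laurentDerivOne_C_mul_T, laurentDerivOne_C_mul_T,
      laurentEvalOne_C_mul_T]
    ring

theorem laurentDerivOne_toLaurent (p : Polynomial ℤ) :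
    laurentDerivOne (Polynomial.toLaurent p) = p.derivative.eval 1 := by
  induction p using Polynomial.induction_on' with
  | add p q hp hq => simp only [map_add, Polynomial.eval_add, hp, hq]
  | monomial n a =>
    rw [Polynomial.toLaurent_C_mul_T, laurentDerivOne_C_mul_T]
    simp [Polynomial.derivative_monomial, mul_comm]

/-- A Laurent polynomial with `f(1) = f'(1) = 0` is a multiple of `(t - 1)²`. -/
theorem exists_eq_mul_of_laurentDerivOne_eq_zero (f : ℤ[T;T⁻¹]) (h0 : laurentEvalOne f = 0)
    (h1 : laurentDerivOne f = 0) :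
    ∃ (m : ℕ) (q : Polynomial ℤ),
      f = T (-m) * (T 1 - 1) * Polynomial.toLaurent ((Polynomial.X - 1) * q) := by
  obtain ⟨m, p, hp⟩ := f.exists_T_pow
  have e0 : p.IsRoot 1 := by
    have h : laurentEvalOne (Polynomial.toLaurent p) = 0 := by
      rw [hp]
      exact (map_mul (LaurentPolynomial.eval₂ _ _) _ _).trans (mul_eq_zero_of_left h0 _)
    simpa [laurentEvalOne, Polynomial.eval₂_id] using h
  have e1 : p.derivative.eval 1 = 0 := by
    rw [← laurentDerivOne_toLaurent, hp, laurentDerivOne_mul_T, h0, h1]; simp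
  obtain ⟨u, rfl⟩ := Polynomial.dvd_iff_isRoot.2 e0
  -- The derivative of `(X - 1) * u` at `1` is the value of `u` at `1`.
  have e2 : u.IsRoot 1 := by simpa [Polynomial.derivative_mul] using e1
  obtain ⟨q, rfl⟩ := Polynomial.dvd_iff_isRoot.2 e2
  refine ⟨m, q, ?_⟩
  have : f = T (-m) * (f * T m) := by
    rw [mul_left_comm, ← T_add]; simp
  rw [this, ← hp]
  simp only [map_mul, map_sub, Polynomial.toLaurent_X, map_one]
  ring

/-! ### The conditions at `1`, and a product formula for the intersection polynomial. -/

namespace LongGaussDiagram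

/-- The integer underlying `weight`. -/
def intWeight (D : LongGaussDiagram) (a : Fin 2) (i : D.Crossing) : ℤ :=
  if D.type i = a then (D.sign i : ℤ) else 0

theorem weight_eq_C (D : LongGaussDiagram) (a : Fin 2) (i : D.Crossing) :
    D.weight a i = C (D.intWeight a i) := by
  unfold weight intWeight
  split_ifs <;> simp

/-- Both monomials of each difference have the same coefficient, so the value and the derivative at
`1` can be read off termwise. -/
theorem G_eq_sum (D : LongGaussDiagram) (a b : Fin 2) :
    D.G a b = ∑ i, ∑ j, (C (D.intWeight a i * D.intWeight b j) *
        T (D.inter (D.alpha i) (D.beta j)) -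
      C (D.intWeight a i * D.intWeight b j) * T (D.inter (D.alpha i) (D.beta i))) := by
  rw [G_eq]
  simp only [weight_eq_C, map_mul, mul_sub]

theorem laurentEvalOne_G (D : LongGaussDiagram) (a b : Fin 2) : laurentEvalOne (D.G a b) = 0 := by
  rw [G_eq_sum]
  refine (map_sum (LaurentPolynomial.eval₂ _ _) _ _).trans (Finset.sum_eq_zero fun i _ => ?_)
  refine (map_sum (LaurentPolynomial.eval₂ _ _) _ _).trans (Finset.sum_eq_zero fun j _ => ?_)
  refine (map_sub (LaurentPolynomial.eval₂ _ _) _ _).trans (sub_eq_zero.2 ?_)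
  exact (laurentEvalOne_C_mul_T _ _).trans (laurentEvalOne_C_mul_T _ _).symm

theorem inter4_antisymm (D : LongGaussDiagram) (x y : D.Passage → ℤ) :
    D.inter4 x y = -D.inter4 y x := by
  simp only [inter4, ← Finset.sum_neg_distrib]
  exact Finset.sum_congr rfl fun k _ => by ring

/-- Since `β_j = γ - α_j`, the difference of the exponents `α_i · β_j` and `α_i · β_i` is `-(α_i ·
α_j)`. The weights are symmetric in `i` and `j` because both types are `a`, so the double sum equals
its own negative. -/
theorem laurentDerivOne_G (D : LongGaussDiagram) (a : Fin 2) :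
    laurentDerivOne (D.G a a) = 0 := by
  rw [G_eq_sum]
  simp only [map_sum, map_sub, laurentDerivOne_C_mul_T]
  set w := D.intWeight a
  set F : D.Crossing → D.Crossing → ℤ := fun i j =>
    D.inter (D.alpha i) (D.beta j) * (w i * w j) - D.inter (D.alpha i) (D.beta i) * (w i * w j)
    with hF
  have key : ∀ i j, F i j = -F j i := by
    intro i j
    -- Passing to four times the intersection numbers removes the integer division, so that
    -- bilinearity applies.
    have h1 := D.four_mul_inter_alpha_beta i j
    have h2 := D.four_mul_inter_alpha_beta i i
    have h3 := D.four_mul_inter_alpha_beta j i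
    have h4 := D.four_mul_inter_alpha_beta j j
    rw [inter4_alpha_beta] at h1 h2 h3 h4
    have h5 := D.inter4_antisymm (D.alpha i) (D.alpha j)
    have h6 := D.inter4_antisymm (D.alpha i) (D.alpha i)
    have h7 := D.inter4_antisymm (D.alpha j) (D.alpha j)
    have h8 : D.inter (D.alpha i) (D.beta j) - D.inter (D.alpha i) (D.beta i) =
        -(D.inter (D.alpha j) (D.beta i) - D.inter (D.alpha j) (D.beta j)) := by omega
    simp only [hF]
    linear_combination (w i * w j) * h8
  have h : ∑ i, ∑ j, F i j = -∑ i, ∑ j, F i j := by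
    conv_rhs => rw [Finset.sum_comm]
    simp only [← Finset.sum_neg_distrib]
    exact Finset.sum_congr rfl fun i _ => Finset.sum_congr rfl fun j _ => key i j
  change ∑ i, ∑ j, F i j = 0
  omega

/-- The hypothesis says that `α_i · γ = e i` and that `α_i · α_j` is a determinant of the pairs `(e,
s)`. Pairs within one class contribute nothing in total. The pairs `(i, j)` and `(j, i)` with `i` in
`s` and `j` outside together contribute `w_i w_j (t ^ e_i - 1) (t ^ e_j - 1)`. -/
theorem G_eq_mul (D : LongGaussDiagram) (a : Fin 2) (s : D.Crossing → Prop) [DecidablePred s]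
    (e : D.Crossing → ℤ)
    (h : ∀ i j, D.inter (D.alpha i) (D.beta j) =
      e i - (e i * (if s j then 1 else 0) - e j * (if s i then 1 else 0))) :
    D.G a a = (∑ i, if s i then D.weight a i * (T (e i) - 1) else 0) *
      (∑ i, if s i then 0 else D.weight a i * (T (e i) - 1)) := by
  rw [G_eq]
  set w := D.weight a
  set x : D.Crossing → ℤ[T;T⁻¹] := fun i => if s i then w i * T (e i) else 0 with hx
  set y : D.Crossing → ℤ[T;T⁻¹] := fun i => if s i then w i else 0 with hy
  set z : D.Crossing → ℤ[T;T⁻¹] := fun i => if s i then 0 else w i * T (e i) with hz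
  set u : D.Crossing → ℤ[T;T⁻¹] := fun i => if s i then 0 else w i with hu
  -- The first two terms are the case of two crossings in `s` and cancel after summation; the next
  -- two belong to `i` in `s` and `j` outside, the last two to the opposite case. For two crossings
  -- outside `s` the exponents agree.
  have e1 : ∀ i j, w i * w j *
      (T (D.inter (D.alpha i) (D.beta j)) - T (D.inter (D.alpha i) (D.beta i))) =
      y i * x j - x i * y j + x i * z j - x i * u j + u i * y j - z i * y j := by
    intro i j
    rw [h, h]
    simp only [hx, hy, hz, hu]
    by_cases hi : s i <;> by_cases hj : s j <;>
      simp only [hi, hj, if_true, if_false, mul_one, mul_zero, sub_zero, sub_self, zero_sub,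
        sub_neg_eq_add, sub_sub_cancel, T_add, T_zero] <;> ring
  have e2 : (∑ i, if s i then w i * (T (e i) - 1) else 0) = ∑ i, x i - ∑ i, y i := by
    rw [← Finset.sum_sub_distrib]
    refine Finset.sum_congr rfl fun i _ => ?_
    simp only [hx, hy]
    split_ifs <;> ring
  have e3 : (∑ i, if s i then 0 else w i * (T (e i) - 1)) = ∑ i, z i - ∑ i, u i := by
    rw [← Finset.sum_sub_distrib]
    refine Finset.sum_congr rfl fun i _ => ?_
    simp only [hz, hu]
    split_ifs <;> ring
  rw [e2, e3]
  simp only [e1, Finset.sum_add_distrib, Finset.sum_sub_distrib, ← Finset.mul_sum,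
    ← Finset.sum_mul]
  ring

/-! ### Crossing changes -/

/-- The diagram with the crossings in `X` changed. -/
def change (D : LongGaussDiagram) (X : Finset D.Crossing) : LongGaussDiagram where
  Crossing := D.Crossing
  sign c := if c ∈ X then -D.sign c else D.sign c
  time p := D.time (p.1, if p.1 ∈ X then !p.2 else p.2)
  time_injective := by
    rintro ⟨c, o⟩ ⟨c', o'⟩ h
    have h' := D.time_injective h
    simp only [Prod.mk.injEq] at h'
    obtain ⟨rfl, h'⟩ := h'
    split_ifs at h' <;> simp_all

theorem alpha_change (D : LongGaussDiagram) (X : Finset D.Crossing) (c : D.Crossing)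
    (p : D.Passage) :
    (D.change X).alpha c p = D.alpha c (p.1, if p.1 ∈ X then !p.2 else p.2) := by
  have h1 : (D.change X).first c = D.first c := by
    by_cases h : c ∈ X <;> simp [first, change, h, min_comm]
  have h2 : (D.change X).last c = D.last c := by
    by_cases h : c ∈ X <;> simp [last, change, h, max_comm]
  unfold alpha
  rw [h1, h2]
  rfl

theorem sign_change_of_mem (D : LongGaussDiagram) (X : Finset D.Crossing) {c : D.Crossing}
    (hc : c ∈ X) : (D.change X).sign c = -D.sign c := if_pos hc

theorem sign_change_of_notMem (D : LongGaussDiagram) (X : Finset D.Crossing) {c : D.Crossing}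
    (hc : c ∉ X) : (D.change X).sign c = D.sign c := if_neg hc

/-- At a changed crossing the sign is reversed and the two strands are exchanged, so the local
contribution to the intersection form, skew in the strands, stays the same. -/
theorem inter_change (D : LongGaussDiagram) (X : Finset D.Crossing) (i j : D.Crossing) :
    (D.change X).inter ((D.change X).alpha i) ((D.change X).beta j) =
      D.inter (D.alpha i) (D.beta j) := by
  unfold inter inter4
  congr 1
  have hα : ∀ (i k : D.Crossing) (o : Bool),
      (D.change X).alpha i (k, o) = D.alpha i (k, if k ∈ X then !o else o) :=
    fun i k o => D.alpha_change X i (k, o)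
  refine Finset.sum_congr rfl fun (k : D.Crossing) _ => ?_
  change ((D.change X).sign k : ℤ) *
    ((D.change X).alpha i (k, true) * (1 + 1 - (D.change X).alpha j (k, false)) -
      (D.change X).alpha i (k, false) * (1 + 1 - (D.change X).alpha j (k, true))) =
    (D.sign k : ℤ) * (D.alpha i (k, true) * (1 + 1 - D.alpha j (k, false)) -
      D.alpha i (k, false) * (1 + 1 - D.alpha j (k, true)))
  rw [hα, hα, hα, hα]
  by_cases h : k ∈ X
  · rw [sign_change_of_mem D X h, if_pos h, if_pos h, Units.val_neg]
    simp only [Bool.not_true, Bool.not_false]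
    ring
  · rw [sign_change_of_notMem D X h, if_neg h, if_neg h]

/-- This turns crossing changes into a means of selection: the complement of `X` carries type `0`
with the old signs, and `X` carries type `1` with reversed signs. -/
theorem type_change (D : LongGaussDiagram) (X : Finset D.Crossing) (hD : ∀ c, D.type c = 0)
    (c : D.Crossing) : (D.change X).type c = if c ∈ X then 1 else 0 := by
  have h := hD c
  unfold type at h ⊢
  by_cases hc : c ∈ X
  · simp only [change, hc, if_true, Bool.not_true, Bool.not_false]
    have : D.time (c, true) < D.time (c, false) := by
      by_contra h'; simp [h'] at h
    rw [if_neg (by omega)]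
  · simpa [change, hc] using h

theorem weight_change_zero (D : LongGaussDiagram) (X : Finset D.Crossing)
    (hD : ∀ c, D.type c = 0) (c : D.Crossing) :
    (D.change X).weight 0 c = if c ∈ X then 0 else C (D.sign c : ℤ) := by
  unfold weight
  rw [type_change D X hD]
  by_cases hc : c ∈ X <;> simp [hc, change]

theorem weight_change_one (D : LongGaussDiagram) (X : Finset D.Crossing)
    (hD : ∀ c, D.type c = 0) (c : D.Crossing) :
    (D.change X).weight 1 c = if c ∈ X then -C (D.sign c : ℤ) else 0 := by
  unfold weight
  rw [type_change D X hD]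
  by_cases hc : c ∈ X <;> simp [hc, change]

theorem next_change (D : LongGaussDiagram) (X : Finset D.Crossing) (p q : D.Stop)
    (h : (D.change X).Next p q) :
    D.Next (p.map fun p => (p.1, if p.1 ∈ X then !p.2 else p.2))
      (q.map fun p => (p.1, if p.1 ∈ X then !p.2 else p.2)) := by
  have hs : ∀ r : D.Passage, ∃ r' : D.Passage, (r'.1, if r'.1 ∈ X then !r'.2 else r'.2) = r := by
    rintro ⟨c, o⟩
    refine ⟨(c, if c ∈ X then !o else o), ?_⟩
    by_cases hc : c ∈ X <;> simp [hc]
  match p, q with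
  | none, none => exact h
  | none, some q => exact fun r => by obtain ⟨r, rfl⟩ := hs r; exact h r
  | some p, none => exact fun r => by obtain ⟨r, rfl⟩ := hs r; exact h r
  | some p, some q => exact ⟨h.1, fun r => by obtain ⟨r, rfl⟩ := hs r; exact h.2 r⟩

/-- The crossing information plays no role in the realizability on a surface. -/
theorem nonempty_surfaceRealization_change (D : LongGaussDiagram) (X : Finset D.Crossing)
    {S : CellularSurface} (R : D.SurfaceRealization S) :
    Nonempty ((D.change X).SurfaceRealization S) := by
  set φ : D.HalfEdge → D.HalfEdge := fun h =>
    (h.1.map fun p => (p.1, if p.1 ∈ X then !p.2 else p.2), h.2) with hφ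
  have hφφ : Function.Involutive φ := by
    rintro ⟨_ | ⟨c, o⟩, b⟩
    · rfl
    · by_cases hc : c ∈ X <;> simp [hφ, hc]
  have hmem : ∀ (c : D.Crossing) (o b : Bool), c ∈ X → φ (some (c, o), b) = (some (c, !o), b) :=
    fun c o b hc => by simp [hφ, hc]
  have hnotMem : ∀ (c : D.Crossing) (o b : Bool), c ∉ X → φ (some (c, o), b) = (some (c, o), b) :=
    fun c o b hc => by simp [hφ, hc]
  -- Exchanging the strands and reversing the sign leaves the counterclockwise order of the four
  -- half-edges as it was.
  have hsome : ∀ (c : D.Crossing) (o b : Bool),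
      φ ((D.change X).nextHalfEdge (some (c, o), b)) = D.nextHalfEdge (φ (some (c, o), b)) := by
    intro c o b
    have h1 : (1 : ℤˣ) ≠ -1 := by decide
    have h2 : (-1 : ℤˣ) ≠ 1 := by decide
    by_cases hc : c ∈ X
    · rw [hmem c o b hc]
      rcases Int.units_eq_one_or (D.sign c) with hs | hs <;> cases o <;> cases b <;>
        simp only [nextHalfEdge, sign_change_of_mem D X hc, hs, Bool.not_true, Bool.not_false,
          neg_neg, h2, if_true, if_false] <;> exact hmem c _ _ hc
    · rw [hnotMem c o b hc]
      rcases Int.units_eq_one_or (D.sign c) with hs | hs <;> cases o <;> cases b <;>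
        simp only [nextHalfEdge, sign_change_of_notMem D X hc, hs, Bool.not_true, Bool.not_false,
          h2, if_true, if_false] <;> exact hnotMem c _ _ hc
  have hnext : ∀ h, φ ((D.change X).nextHalfEdge h) = D.nextHalfEdge (φ h) := by
    rintro ⟨_ | ⟨c, o⟩, b⟩
    · rfl
    · exact hsome c o b
  refine ⟨⟨fun h => R.dart (φ h), R.dart_injective.comp hφφ.injective, ?_, ?_⟩⟩
  · intro p q hpq
    exact R.flip_dart _ _ (D.next_change X p q hpq)
  · intro h
    obtain ⟨n, hn, h1, h2⟩ := R.rot_dart (φ h)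
    refine ⟨n, hn, by rw [h1, hnext], fun m hm hmn hmem => h2 m hm hmn ?_⟩
    obtain ⟨h', h'e⟩ := hmem
    exact ⟨_, h'e⟩

end LongGaussDiagram

/-! ### Counting the cycles of a permutation -/

/-- A label that is constant along `π`, with a representative of each label lying on the cycle of
every element so labelled, identifies cycles with labels. Vertices, edges and faces are all counted
in this way. -/
theorem numCycles_eq_card {X L : Type} (π : Equiv.Perm X) (label : X → L) (rep : L → X)
    (hlabel : ∀ x, label (π x) = label x) (hrep : ∀ l, label (rep l) = l)
    (hcycle : ∀ x, π.SameCycle x (rep (label x))) : numCycles π = Nat.card L := by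
  have hpow : ∀ (n : ℕ) x, label ((π ^ n) x) = label x := by
    intro n
    induction n with
    | zero => intro x; rfl
    | succ n ih => intro x; rw [pow_succ, Equiv.Perm.mul_apply, ih, hlabel]
  have hzpow : ∀ (n : ℤ) x, label ((π ^ n) x) = label x := by
    intro n x
    obtain ⟨n, rfl | rfl⟩ := n.eq_nat_or_neg
    · rw [zpow_natCast, hpow]
    · rw [← hpow n, zpow_neg, zpow_natCast]; simp
  refine Nat.card_congr ⟨Quotient.lift label ?_, fun l => Quotient.mk _ (rep l), ?_, hrep⟩
  · rintro x y ⟨n, rfl⟩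
    exact (hzpow n x).symm
  · rintro ⟨x⟩
    exact Quotient.sound (hcycle x).symm

namespace LongGaussDiagram

/-! ### The surface obtained by gluing disks to a closed curve -/

/-- The times of the passages are `0, 1, 2, …`. -/
def IsTight (D : LongGaussDiagram) : Prop :=
  ∀ p, 0 ≤ D.time p ∧ D.time p < Fintype.card D.Passage

/-- An injection between finite sets of equal size is onto. So the times have no gaps, and
consecutive passages differ by exactly `1` in time. -/
theorem IsTight.bijective {D : LongGaussDiagram} (hD : D.IsTight) :
    Function.Bijective (fun p : D.Passage =>
      (⟨(D.time p).toNat, by have := hD p; omega⟩ : Fin (Fintype.card D.Passage))) := by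
  rw [Fintype.bijective_iff_injective_and_card, Fintype.card_fin]
  refine ⟨fun p q h => D.time_injective ?_, rfl⟩
  have h1 := hD p
  have h2 := hD q
  simp only [Fin.mk.injEq] at h
  omega

/-- The positions of the stops on the closed curve; the basepoint is the last one. -/
noncomputable def IsTight.pos {D : LongGaussDiagram} (hD : D.IsTight) :
    D.Stop ≃ Fin (Fintype.card D.Passage + 1) :=
  (Equiv.optionCongr (Equiv.ofBijective _ hD.bijective)).trans (finSuccEquivLast).symm

theorem IsTight.pos_none {D : LongGaussDiagram} (hD : D.IsTight) :
    hD.pos none = Fin.last _ := by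
  simp [pos]

theorem IsTight.pos_some {D : LongGaussDiagram} (hD : D.IsTight) (p : D.Passage) :
    ((hD.pos (some p) : ℕ) : ℤ) = D.time p := by
  have := hD p
  simp [pos]
  omega

/-- The next stop. -/
noncomputable def IsTight.next {D : LongGaussDiagram} (hD : D.IsTight) : Equiv.Perm D.Stop :=
  hD.pos.trans ((finRotate _).trans hD.pos.symm)

theorem IsTight.exists_time_eq {D : LongGaussDiagram} (hD : D.IsTight) (t : ℤ) (h0 : 0 ≤ t)
    (h1 : t < Fintype.card D.Passage) : ∃ p, D.time p = t := by
  obtain ⟨p, hp⟩ := hD.bijective.2 ⟨t.toNat, by omega⟩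
  refine ⟨p, ?_⟩
  have := hD p
  simp only [Fin.mk.injEq] at hp
  omega

theorem IsTight.pos_next {D : LongGaussDiagram} (hD : D.IsTight) (p : D.Stop) :
    hD.pos (hD.next p) = finRotate _ (hD.pos p) := by
  simp [next]

theorem IsTight.next_some_some {D : LongGaussDiagram} (hD : D.IsTight) (p q : D.Passage)
    (h : D.time q = D.time p + 1) : hD.next (some p) = some q := by
  apply hD.pos.injective
  rw [hD.pos_next]
  have hp := hD.pos_some p
  have hq := hD.pos_some q
  have hq' := hD q
  have : hD.pos (some p) ≠ Fin.last _ := by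
    intro h'; rw [h', Fin.val_last] at hp; omega
  apply Fin.ext
  rw [coe_finRotate_of_ne_last this]
  omega

theorem IsTight.next_some_none {D : LongGaussDiagram} (hD : D.IsTight) (p : D.Passage)
    (h : D.time p + 1 = Fintype.card D.Passage) : hD.next (some p) = none := by
  apply hD.pos.injective
  rw [hD.pos_next, hD.pos_none]
  have hp := hD.pos_some p
  have : hD.pos (some p) ≠ Fin.last _ := by
    intro h'; rw [h', Fin.val_last] at hp; omega
  apply Fin.ext
  rw [coe_finRotate_of_ne_last this, Fin.val_last]
  omega

theorem IsTight.next_none_some {D : LongGaussDiagram} (hD : D.IsTight) (p : D.Passage)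
    (h : D.time p = 0) : hD.next none = some p := by
  apply hD.pos.injective
  rw [hD.pos_next, hD.pos_none, finRotate_last]
  have hp := hD.pos_some p
  apply Fin.ext
  rw [Fin.val_zero]
  omega

theorem IsTight.next_eq {D : LongGaussDiagram} (hD : D.IsTight) (p q : D.Stop) (h : D.Next p q) :
    hD.next p = q := by
  match p, q with
  | none, none =>
    -- Without crossings the basepoint is the only stop and follows itself.
    have h : IsEmpty D.Crossing := h
    apply hD.pos.injective
    rw [hD.pos_next, hD.pos_none, finRotate_last]
    apply Fin.ext
    simp
  | none, some q =>
    have h : ∀ r, D.time q ≤ D.time r := h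
    have h1 := hD q
    obtain ⟨r, hr⟩ := hD.exists_time_eq 0 le_rfl (by omega)
    have := h r
    exact hD.next_none_some q (by omega)
  | some p, none =>
    have h : ∀ r, D.time r ≤ D.time p := h
    have h1 := hD p
    refine hD.next_some_none p ?_
    by_contra h2
    obtain ⟨r, hr⟩ := hD.exists_time_eq (D.time p + 1) (by omega) (by omega)
    have := h r
    omega
  | some p, some q =>
    have h : D.time p < D.time q ∧ ∀ r, ¬ (D.time p < D.time r ∧ D.time r < D.time q) := h
    have h1 := hD p
    have h2 := hD q
    refine hD.next_some_some p q ?_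
    by_contra h3
    obtain ⟨r, hr⟩ := hD.exists_time_eq (D.time p + 1) (by omega) (by omega)
    have := h.2 r
    omega

/-- Every stop is reached from the basepoint. This makes the glued surface connected. -/
theorem IsTight.exists_next_pow {D : LongGaussDiagram} (hD : D.IsTight) (p q : D.Stop) :
    ∃ n : ℕ, (hD.next ^ n) p = q := by
  have hpow : ∀ (n : ℕ) p, hD.pos ((hD.next ^ n) p) = (finRotate _ ^ n) (hD.pos p) := by
    intro n
    induction n with
    | zero => intro p; rfl
    | succ n ih => intro p; rw [pow_succ, pow_succ, Equiv.Perm.mul_apply, ih, pos_next]; rfl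
  -- The basepoint has the last position, so the first step wraps around to position `0`; hence the
  -- exponent `n + 1`.
  have hlast : ∀ (n : ℕ) (hn : n < Fintype.card D.Passage + 1),
      (finRotate _ ^ (n + 1)) (Fin.last (Fintype.card D.Passage)) = ⟨n, hn⟩ := by
    intro n
    induction n with
    | zero => intro hn; simp
    | succ n ih =>
      intro hn
      rw [pow_succ', Equiv.Perm.mul_apply, ih (by omega)]
      apply Fin.ext
      rw [coe_finRotate_of_ne_last]
      intro h
      have := congrArg Fin.val h
      rw [Fin.val_last] at this
      simp only at this
      omega
  have hq : ∀ q, ∃ n : ℕ, (hD.next ^ n) none = q := by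
    intro q
    refine ⟨(hD.pos q : ℕ) + 1, hD.pos.injective ?_⟩
    rw [hpow, hD.pos_none, hlast _ (hD.pos q).2]
  obtain ⟨m, hm⟩ := hq p
  obtain ⟨n, hn⟩ := hq q
  have h := Equiv.Perm.SameCycle.trans (f := hD.next) (x := p) (y := none) (z := q)
    (Equiv.Perm.SameCycle.symm ⟨m, by simpa using hm⟩) ⟨n, by simpa using hn⟩
  have : Finite D.Stop := inferInstance
  obtain ⟨k, -, hk⟩ := h.exists_pow_eq'
  exact ⟨k, hk⟩

/-- `nextHalfEdge` as a permutation. -/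
def rotation (D : LongGaussDiagram) : Equiv.Perm D.HalfEdge where
  toFun := D.nextHalfEdge
  invFun h := D.nextHalfEdge (D.nextHalfEdge (D.nextHalfEdge h))
  left_inv := by
    rintro ⟨_ | ⟨c, o⟩, b⟩
    · simp [nextHalfEdge]
    · by_cases hs : D.sign c = 1 <;> cases o <;> cases b <;> simp [nextHalfEdge, hs]
  right_inv := by
    rintro ⟨_ | ⟨c, o⟩, b⟩
    · simp [nextHalfEdge]
    · by_cases hs : D.sign c = 1 <;> cases o <;> cases b <;> simp [nextHalfEdge, hs]

/-- The other half of a half-edge. -/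
noncomputable def IsTight.otherHalf {D : LongGaussDiagram} (hD : D.IsTight) :
    D.HalfEdge → D.HalfEdge
  | (p, true) => (hD.next p, false)
  | (p, false) => (hD.next.symm p, true)

theorem IsTight.otherHalf_involutive {D : LongGaussDiagram} (hD : D.IsTight) :
    Function.Involutive hD.otherHalf := by
  rintro ⟨p, _ | _⟩ <;> simp [otherHalf]

/-- The two halves of one strand are opposite at the vertex, that is, two quarter turns apart. -/
theorem rotation_rotation (D : LongGaussDiagram) (p : D.Passage) (b : Bool) :
    D.rotation (D.rotation (some p, b)) = (some p, !b) := by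
  obtain ⟨c, o⟩ := p
  by_cases hs : D.sign c = 1 <;> cases o <;> cases b <;> simp [rotation, nextHalfEdge, hs]

/-- The closed surface obtained by gluing disks to the closed curve. -/
noncomputable def IsTight.surface {D : LongGaussDiagram} (hD : D.IsTight) : CellularSurface where
  Dart := D.HalfEdge
  rot := D.rotation
  flip := hD.otherHalf_involutive.toPerm
  flip_flip := hD.otherHalf_involutive
  flip_ne := by rintro ⟨p, _ | _⟩ <;> simp [otherHalf]
  connected := by
    set R : D.HalfEdge → D.HalfEdge → Prop :=
      fun x y => y = D.rotation x ∨ y = (hD.otherHalf_involutive.toPerm) x with hR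
    have hrot : ∀ p b, Relation.ReflTransGen R (p, b) (p, !b) := by
      rintro (_ | p) b
      · exact .single (Or.inl rfl)
      · have h1 : R (some p, b) (D.rotation (some p, b)) := Or.inl rfl
        have h2 : R (D.rotation (some p, b)) (some p, !b) :=
          Or.inl (D.rotation_rotation p b).symm
        exact (Relation.ReflTransGen.single h1).tail h2
    -- One step along the curve is a flip to the next stop, followed by turning to its forward
    -- half-edge.
    have hnext : ∀ (n : ℕ) p, Relation.ReflTransGen R (p, true) ((hD.next ^ n) p, true) := by
      intro n
      induction n with
      | zero => intro p; exact .refl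
      | succ n ih =>
        intro p
        rw [pow_succ', Equiv.Perm.mul_apply]
        exact ((ih p).tail (Or.inr rfl)).trans (hrot _ false)
    have hto : ∀ p b b', Relation.ReflTransGen R (p, b) (p, b') := by
      intro p b b'
      rcases Bool.eq_or_eq_not b' b with rfl | rfl
      · exact .refl
      · exact hrot p b
    rintro ⟨p, b⟩ ⟨q, b'⟩
    obtain ⟨n, rfl⟩ := hD.exists_next_pow p q
    exact ((hto p b true).trans (hnext n p)).trans (hto _ true b')

/-- The graph of the cell decomposition is the curve itself, so a single turn already leads to the
next half-edge. -/
theorem IsTight.nonempty_surfaceRealization {D : LongGaussDiagram} (hD : D.IsTight) :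
    Nonempty (D.SurfaceRealization hD.surface) := by
  refine ⟨⟨id, Function.injective_id, ?_, ?_⟩⟩
  · intro p q h
    exact congrArg (·, false) (hD.next_eq p q h)
  · intro h
    refine ⟨1, one_pos, ?_, fun m h0 h1 => by omega⟩
    rw [pow_one]
    rfl

theorem numCycles_rotation (D : LongGaussDiagram) :
    numCycles D.rotation = Fintype.card D.Crossing + 1 := by
  rw [numCycles_eq_card (L := Option D.Crossing) D.rotation (fun h => h.1.map Prod.fst)
    (fun l => (l.map fun c => (c, true), true)), Nat.card_eq_fintype_card, Fintype.card_option]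
  · rintro ⟨_ | ⟨c, _ | _⟩, b⟩ <;> rfl
  · rintro (_ | c) <;> rfl
  · have h2 : ∀ p b, D.rotation.SameCycle (some p, b) (some p, !b) := fun p b =>
      ⟨2, by rw [← D.rotation_rotation p b]; rfl⟩
    have h3 : ∀ p b, D.rotation.SameCycle (some p, b) (some p, true) := by
      rintro p (_ | _)
      · exact h2 p false
      · exact .refl _ _
    rintro ⟨_ | ⟨c, _ | _⟩, b⟩
    · rcases b with _ | _
      · exact ⟨1, rfl⟩
      · exact .refl _ _
    · refine Equiv.Perm.SameCycle.trans (y := D.rotation (some (c, false), b)) ⟨1, rfl⟩ ?_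
      exact h3 _ _
    · exact h3 _ _

/-- An edge is named by the stop that it leaves in the direction of the curve. -/
theorem IsTight.numCycles_flip {D : LongGaussDiagram} (hD : D.IsTight) :
    numCycles hD.surface.flip = 2 * Fintype.card D.Crossing + 1 := by
  have : 2 * Fintype.card D.Crossing + 1 = Fintype.card D.Stop := by
    simp [Stop, Passage, mul_comm]
  rw [this, ← Nat.card_eq_fintype_card]
  refine numCycles_eq_card (L := D.Stop) hD.surface.flip
    (fun h => if h.2 then h.1 else hD.next.symm h.1) (fun p => (p, true)) ?_ ?_ ?_
  · rintro ⟨p, _ | _⟩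
    · rfl
    · exact hD.next.symm_apply_apply p
  · intro l; rfl
  · rintro ⟨p, _ | _⟩
    · exact ⟨1, rfl⟩
    · exact .refl _ _

/-- With `n` crossings and `n` faces the Euler characteristic is `(n + 1) - (2 * n + 1) + n = 0`. -/
theorem IsTight.hasGenus_one {D : LongGaussDiagram} (hD : D.IsTight)
    (h : numCycles (hD.surface.rot * hD.surface.flip) = Fintype.card D.Crossing) :
    hD.surface.HasGenus 1 := by
  unfold CellularSurface.HasGenus
  rw [h, hD.numCycles_flip]
  have : numCycles hD.surface.rot = Fintype.card D.Crossing + 1 := D.numCycles_rotation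
  rw [this]
  push_cast
  ring

theorem IsTight.sg₁_knot_change_le_one {D : LongGaussDiagram} (hD : D.IsTight)
    (h : numCycles (hD.surface.rot * hD.surface.flip) = Fintype.card D.Crossing)
    (X : Finset D.Crossing) : (D.change X).knot.sg₁ ≤ 1 := by
  obtain ⟨R⟩ := hD.nonempty_surfaceRealization
  exact sInf_le ⟨1, rfl, D.change X, hD.surface, rfl, hD.hasGenus_one h,
    D.nonempty_surfaceRealization_change X R⟩

end LongGaussDiagram

/-! ### The grid diagrams -/

/-- The column `c` of the grid with `2 * M + 2` columns is traversed upwards. -/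
def IsUp (M c : ℕ) : Prop := (c < 2 * M ∧ c % 2 = 0) ∨ c = 2 * M + 1

instance (M c : ℕ) : Decidable (IsUp M c) := inferInstanceAs (Decidable (_ ∨ _))

/-- The time of the passage along the row `r` through the column `c`. -/
def rowTime (M r c : ℕ) : ℕ := r * (2 * M + 2) + c

/-- The time of the passage along the column `c` through the row `r`, after all rows have been
traversed. -/
def colTime (A M r c : ℕ) : ℕ := A * (2 * M + 2) + c * A + if IsUp M c then r else A - 1 - r

/-- Row and column times are two-digit numbers in a fixed base, hence ordered lexicographically. -/
theorem mul_add_lt_mul_add_iff {n a b a' b' : ℕ} (hb : b < n) (hb' : b' < n) :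
    a * n + b < a' * n + b' ↔ a < a' ∨ a = a' ∧ b < b' := by
  constructor
  · intro h
    rcases lt_trichotomy a a' with h1 | h1 | h1
    · exact Or.inl h1
    · subst h1; exact Or.inr ⟨rfl, by omega⟩
    · have := Nat.mul_le_mul_right n (Nat.succ_le_of_lt h1)
      rw [Nat.succ_mul] at this
      omega
  · rintro (h1 | ⟨rfl, h1⟩)
    · have := Nat.mul_le_mul_right n (Nat.succ_le_of_lt h1)
      rw [Nat.succ_mul] at this
      omega
    · omega

theorem rowTime_lt_rowTime {M r c r' c' : ℕ} (hc : c < 2 * M + 2) (hc' : c' < 2 * M + 2) :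
    rowTime M r c < rowTime M r' c' ↔ r < r' ∨ r = r' ∧ c < c' :=
  mul_add_lt_mul_add_iff hc hc'

theorem colTime_lt_colTime {A M r c r' c' : ℕ} (hr : r < A) (hr' : r' < A) :
    colTime A M r c < colTime A M r' c' ↔
      c < c' ∨ c = c' ∧ if IsUp M c then r < r' else r' < r := by
  unfold colTime
  rw [add_assoc, add_assoc, Nat.add_lt_add_iff_left,
    mul_add_lt_mul_add_iff (by split_ifs <;> omega) (by split_ifs <;> omega)]
  refine or_congr_right (and_congr_right ?_)
  rintro rfl
  split_ifs <;> omega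

theorem rowTime_lt {A M r c : ℕ} (hr : r < A) (hc : c < 2 * M + 2) :
    rowTime M r c < A * (2 * M + 2) := by
  have := Nat.mul_le_mul_right (2 * M + 2) (Nat.succ_le_of_lt hr)
  rw [Nat.succ_mul] at this
  unfold rowTime
  omega

theorem le_colTime (A M r c : ℕ) : A * (2 * M + 2) ≤ colTime A M r c := by
  unfold colTime; omega

theorem colTime_lt {A M r c : ℕ} (hr : r < A) (hc : c < 2 * M + 2) :
    colTime A M r c < A * (2 * M + 2) + A * (2 * M + 2) := by
  have := Nat.mul_le_mul_right A (Nat.succ_le_of_lt hc)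
  rw [Nat.succ_mul, mul_comm (2 * M + 2)] at this
  unfold colTime
  split_ifs <;> omega

theorem rowTime_injective {M r c r' c' : ℕ} (hc : c < 2 * M + 2) (hc' : c' < 2 * M + 2)
    (h : rowTime M r c = rowTime M r' c') : r = r' ∧ c = c' := by
  have h1 := rowTime_lt_rowTime (r := r) (r' := r') hc hc'
  have h2 := rowTime_lt_rowTime (r := r') (r' := r) hc' hc
  rw [h] at h1 h2
  simp only [lt_irrefl, false_iff] at h1 h2
  omega

theorem colTime_injective {A M r c r' c' : ℕ} (hr : r < A) (hr' : r' < A)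
    (h : colTime A M r c = colTime A M r' c') : r = r' ∧ c = c' := by
  have h1 := colTime_lt_colTime (M := M) (c := c) (c' := c') hr hr'
  have h2 := colTime_lt_colTime (M := M) (c := c') (c' := c) hr' hr
  rw [h] at h1 h2
  simp only [lt_irrefl, false_iff] at h1 h2
  have h3 : c = c' := by omega
  subst h3
  split_ifs at h1 h2 <;> omega

namespace LongGaussDiagram

/-- The grid diagram: the line first runs through `A` parallel rows from the left to the right,
which form a spiral on the torus, and then through `2 * M + 2` columns alternately upwards and
downwards, always under the rows; the first `M` pairs of columns start upwards, the last pair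
starts downwards. -/
def grid (A M : ℕ) : LongGaussDiagram where
  Crossing := Fin A × Fin (2 * M + 2)
  sign c := if IsUp M c.2 then 1 else -1
  time p := if p.2 then rowTime M p.1.1 p.1.2 else colTime A M p.1.1 p.1.2
  time_injective := by
    rintro ⟨⟨r, c⟩, o⟩ ⟨⟨r', c'⟩, o'⟩ h
    have h1 := rowTime_lt r.2 c.2
    have h2 := rowTime_lt r'.2 c'.2
    have h3 := le_colTime A M r c
    have h4 := le_colTime A M r' c'
    cases o <;> cases o' <;> simp only [if_true, Bool.false_eq_true, if_false] at h
    · obtain ⟨h5, h6⟩ := colTime_injective r.2 r'.2 (by exact_mod_cast h)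
      rw [Fin.ext h5, Fin.ext h6]
    · omega
    · omega
    · obtain ⟨h5, h6⟩ := rowTime_injective c.2 c'.2 (by exact_mod_cast h)
      rw [Fin.ext h5, Fin.ext h6]

end LongGaussDiagram

/-- The coefficient of the cycle `α` of the crossing `(r, c)` of a grid at the row passage
through `(r', c')`. -/
def rowCoeff (r c r' c' : ℕ) : ℤ :=
  if r < r' ∨ r = r' ∧ c < c' then 2 else if r = r' ∧ c = c' then 1 else 0

/-- The coefficient of the cycle `α` of the crossing `(r, c)` of a grid at the column passage
through `(r', c')`. -/
def colCoeff (M r c r' c' : ℕ) : ℤ :=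
  if c' < c ∨ c' = c ∧ (if IsUp M c then r' < r else r < r') then 2
  else if r = r' ∧ c = c' then 1 else 0

/-- The sign of the column `c` of a grid. -/
def colSign (M c : ℕ) : ℤ := if IsUp M c then 1 else -1

/-- The sum over the crossings of a grid of the products of the coefficients on the rows and the
columns. -/
def gridSum (A M : ℕ) (x y : ℕ → ℕ → ℤ) : ℤ :=
  ∑ r ∈ Finset.range A, ∑ c ∈ Finset.range (2 * M + 2), colSign M c * (x r c * y r c)

namespace LongGaussDiagram

theorem grid_time_row {A M : ℕ} (k : (grid A M).Crossing) :
    (grid A M).time (k, true) = rowTime M k.1 k.2 := rfl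

theorem grid_time_col {A M : ℕ} (k : (grid A M).Crossing) :
    (grid A M).time (k, false) = colTime A M k.1 k.2 := rfl

theorem grid_sign {A M : ℕ} (k : (grid A M).Crossing) :
    ((grid A M).sign k : ℤ) = colSign M k.2 := by
  change ((if IsUp M k.2 then (1 : ℤˣ) else -1 : ℤˣ) : ℤ) = _
  unfold colSign
  split_ifs <;> rfl

/-- All rows precede all columns. Hence every crossing has type `0`, and its cycle `α` runs from its
row passage to its column passage. -/
theorem grid_time_row_lt_col {A M : ℕ} (k l : (grid A M).Crossing) :
    (grid A M).time (k, true) < (grid A M).time (l, false) := by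
  have h1 := rowTime_lt k.1.2 k.2.2
  have h2 := le_colTime A M l.1 l.2
  rw [grid_time_row, grid_time_col]
  omega

theorem grid_type {A M : ℕ} (k : (grid A M).Crossing) : (grid A M).type k = 0 :=
  if_pos (grid_time_row_lt_col k k)

theorem grid_first {A M : ℕ} (k : (grid A M).Crossing) :
    (grid A M).first k = rowTime M k.1 k.2 :=
  min_eq_left (grid_time_row_lt_col k k).le

theorem grid_last {A M : ℕ} (k : (grid A M).Crossing) :
    (grid A M).last k = colTime A M k.1 k.2 :=
  max_eq_right (grid_time_row_lt_col k k).le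

theorem grid_isTight (A M : ℕ) : (grid A M).IsTight := by
  have hcard : Fintype.card (grid A M).Passage = A * (2 * M + 2) + A * (2 * M + 2) := by
    change Fintype.card ((Fin A × Fin (2 * M + 2)) × Bool) = _
    simp only [Fintype.card_prod, Fintype.card_fin, Fintype.card_bool]
    ring
  rw [IsTight, hcard]
  rintro ⟨k, _ | _⟩
  · have := colTime_lt k.1.2 k.2.2
    rw [grid_time_col]
    omega
  · have := rowTime_lt k.1.2 k.2.2
    rw [grid_time_row]
    omega

/-- The cycle `α` leaves along the row and returns along the column: it covers all later row
passages and all earlier column passages. -/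
theorem grid_alpha_row {A M : ℕ} (i k : (grid A M).Crossing) :
    (grid A M).alpha i (k, true) = rowCoeff i.1 i.2 k.1 k.2 := by
  have h1 := grid_time_row_lt_col k i
  rw [grid_time_row, grid_time_col] at h1
  have h2 := rowTime_lt_rowTime (r := i.1) (r' := k.1) i.2.2 k.2.2
  have h3 := rowTime_lt_rowTime (r := k.1) (r' := i.1) k.2.2 i.2.2
  unfold alpha rowCoeff
  rw [grid_first, grid_last, grid_time_row]
  simp only [Nat.cast_lt, Nat.cast_le] at h1 ⊢
  split_ifs <;> omega

theorem grid_alpha_col {A M : ℕ} (i k : (grid A M).Crossing) :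
    (grid A M).alpha i (k, false) = colCoeff M i.1 i.2 k.1 k.2 := by
  have h1 := grid_time_row_lt_col i k
  rw [grid_time_row, grid_time_col] at h1
  have h2 := colTime_lt_colTime (M := M) (c := i.2) (c' := k.2) i.1.2 k.1.2
  have h3 := colTime_lt_colTime (M := M) (c := k.2) (c' := i.2) k.1.2 i.1.2
  -- Equal columns have equal direction. The direction is an opaque proposition in the final case
  -- analysis, so this must be supplied to it.
  have h4 : ∀ c c' : ℕ, c = c' → (IsUp M c ↔ IsUp M c') := by rintro c _ rfl; rfl
  have h5 := h4 i.2 k.2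
  unfold alpha colCoeff
  rw [grid_first, grid_last, grid_time_col]
  simp only [Nat.cast_lt, Nat.cast_le] at h1 ⊢
  by_cases hu : IsUp M i.2 <;> by_cases hu' : IsUp M k.2 <;>
    simp only [hu, hu', if_true, if_false, iff_true, iff_false, not_true_eq_false, imp_false,
      implies_true] at h2 h3 h5 ⊢ <;> split_ifs <;> omega

/-- Over-passages lie on rows and under-passages on columns, so the skew form splits into two sums,
each pairing the row coefficients of one cycle with the column coefficients of the other. -/
theorem grid_inter4 {A M : ℕ} (x y : (grid A M).Passage → ℤ) (x₁ x₂ y₁ y₂ : ℕ → ℕ → ℤ)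
    (hx₁ : ∀ k, x (k, true) = x₁ k.1 k.2) (hx₂ : ∀ k, x (k, false) = x₂ k.1 k.2)
    (hy₁ : ∀ k, y (k, true) = y₁ k.1 k.2) (hy₂ : ∀ k, y (k, false) = y₂ k.1 k.2) :
    (grid A M).inter4 x y = gridSum A M x₁ y₂ - gridSum A M y₁ x₂ := by
  unfold inter4 gridSum
  simp only [grid_sign, hx₁, hx₂, hy₁, hy₂]
  refine (Fintype.sum_prod_type (α₁ := Fin A) (α₂ := Fin (2 * M + 2)) _).trans ?_
  rw [← Finset.sum_sub_distrib, Finset.sum_range]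
  refine Finset.sum_congr rfl fun r _ => ?_
  rw [← Finset.sum_sub_distrib, Finset.sum_range]
  exact Finset.sum_congr rfl fun c _ => by ring

end LongGaussDiagram

/-! ### Intersection numbers in grids -/

/-- The sign of the first column of a pair of columns. -/
def pairSign (M k : ℕ) : ℤ := if k < M then 1 else -1

/-- Twice the number of rows below the row `r'` of the row `r`, counted with multiplicity one half
for `r' = r`. -/
def stepCoeff (r r' : ℕ) : ℤ := if r' < r then 2 else if r' = r then 1 else 0

/-- The correction term for the pairs of columns that start downwards. -/
def downShift (M k : ℕ) : ℤ := if k < M then 0 else 2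

/-- The sign of `b - a`. -/
def compareSign (a b : ℕ) : ℤ := if a < b then 1 else if a = b then 0 else -1

theorem sum_range_stepCoeff {A r : ℕ} (hr : r < A) :
    ∑ r' ∈ Finset.range A, stepCoeff r r' = 2 * r + 1 := by
  have h : ∀ n, ∑ r' ∈ Finset.range n, stepCoeff r r' =
      if n ≤ r then 2 * (n : ℤ) else 2 * r + 1 := by
    intro n
    induction n with
    | zero => simp
    | succ n ih =>
      rw [Finset.sum_range_succ, ih]
      unfold stepCoeff
      push_cast
      split_ifs <;> omega
  rw [h, if_neg (by omega)]

theorem isUp_even {M k : ℕ} : IsUp M (2 * k) ↔ k < M := by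
  unfold IsUp; omega

theorem isUp_odd {M k : ℕ} : IsUp M (2 * k + 1) ↔ k = M := by
  unfold IsUp; omega

/-- The two columns of a pair have opposite signs, so whatever is constant on a pair cancels. This
is why the grid is evaluated pair by pair. -/
theorem sum_colSign_mul (M : ℕ) (F : ℕ → ℤ) :
    ∑ c ∈ Finset.range (2 * M + 2), colSign M c * F c =
      ∑ k ∈ Finset.range (M + 1), pairSign M k * (F (2 * k) - F (2 * k + 1)) := by
  have h : ∀ n ≤ M + 1, ∑ c ∈ Finset.range (2 * n), colSign M c * F c =
      ∑ k ∈ Finset.range n, pairSign M k * (F (2 * k) - F (2 * k + 1)) := by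
    intro n
    induction n with
    | zero => simp
    | succ n ih =>
      intro hn
      rw [mul_add, mul_one, Finset.sum_range_succ, Finset.sum_range_succ, Finset.sum_range_succ,
        ih (by omega), colSign, colSign, pairSign]
      simp only [isUp_even, isUp_odd]
      rcases Nat.lt_or_ge n M with h | h
      · have h' : n ≠ M := by omega
        simp only [h, h', if_true, if_false]; ring
      · have h' : n = M := by omega
        simp only [h', lt_irrefl, if_true, if_false]; ring
  exact h (M + 1) le_rfl

theorem gridSum_eq (A M : ℕ) (x y : ℕ → ℕ → ℤ) :
    gridSum A M x y = ∑ r ∈ Finset.range A, ∑ k ∈ Finset.range (M + 1),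
      pairSign M k * (x r (2 * k) * y r (2 * k) - x r (2 * k + 1) * y r (2 * k + 1)) :=
  Finset.sum_congr rfl fun r _ => sum_colSign_mul M fun c => x r c * y r c

section

variable {M r a u r' k : ℕ}

/-- The row coefficients can tell the columns of a pair apart only at the pair that contains the
crossing itself. -/
theorem rowCoeff_pair_of_ne (hu : u < 2) (h : ¬ (r' = r ∧ k = a)) :
    rowCoeff r (2 * a + u) r' (2 * k) =
        (2 - stepCoeff r r') + (if r' = r then compareSign a k else 0) ∧
      rowCoeff r (2 * a + u) r' (2 * k + 1) =
        (2 - stepCoeff r r') + (if r' = r then compareSign a k else 0) := by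
  unfold rowCoeff stepCoeff compareSign
  constructor <;> split_ifs <;> omega

theorem rowCoeff_pair_self (hu : u < 2) :
    rowCoeff r (2 * a + u) r (2 * a) = 1 - u ∧ rowCoeff r (2 * a + u) r (2 * a + 1) = 2 - u := by
  unfold rowCoeff
  constructor <;> split_ifs <;> omega

theorem colCoeff_pair_of_ne (hu : u < 2) (h : k ≠ a) :
    colCoeff M r (2 * a + u) r' (2 * k) = 1 + compareSign k a ∧
      colCoeff M r (2 * a + u) r' (2 * k + 1) = 1 + compareSign k a := by
  unfold colCoeff compareSign
  constructor <;> split_ifs <;> omega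

/-- The signed amount of the pair covered by `α` does not depend on which of its two columns carries
the crossing: for `u = 1` the first column is covered completely, and the second one up to the
crossing from the other side. -/
theorem colCoeff_pair_self (hu : u < 2) (ha : a ≤ M) :
    pairSign M a * (colCoeff M r (2 * a + u) r' (2 * a) -
      colCoeff M r (2 * a + u) r' (2 * a + 1)) = stepCoeff r r' - downShift M a := by
  unfold pairSign colCoeff stepCoeff downShift
  obtain rfl | rfl : u = 0 ∨ u = 1 := by omega
  · simp only [add_zero, isUp_even]
    by_cases h : a < M <;> simp only [h, true_and, and_true, if_true, if_false] <;>
      split_ifs <;> omega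
  · simp only [isUp_odd]
    by_cases h : a < M
    · have h' : a ≠ M := by omega
      simp only [h, h', true_and, and_true, if_true, if_false]
      split_ifs <;> omega
    · have h' : a = M := by omega
      simp only [h', lt_irrefl, false_or, true_and, and_true, if_true, if_false]
      split_ifs <;> omega

/-- The contribution of a pair of columns. -/
theorem pairSign_mul_rowCoeff_mul_colCoeff {q b v : ℕ} (hu : u < 2) (hv : v < 2) (hb : b ≤ M) :
    pairSign M k * (rowCoeff r (2 * a + u) r' (2 * k) * colCoeff M q (2 * b + v) r' (2 * k) -
        rowCoeff r (2 * a + u) r' (2 * k + 1) * colCoeff M q (2 * b + v) r' (2 * k + 1)) =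
      (if k = b then ((2 - stepCoeff r r') + (if r' = r then compareSign a b else 0)) *
          (stepCoeff q r' - downShift M b) else 0) -
        (if k = a then (if r' = r then
          pairSign M a * colCoeff M q (2 * b + v) r (2 * a + (1 - u)) else 0) else 0) := by
  -- Outside the pair `b` the column coefficients are constant on pairs and cancel.
  have hκ : pairSign M k * (colCoeff M q (2 * b + v) r' (2 * k) -
      colCoeff M q (2 * b + v) r' (2 * k + 1)) =
      if k = b then stepCoeff q r' - downShift M b else 0 := by
    by_cases h : k = b
    · subst h; rw [if_pos rfl, colCoeff_pair_self hv hb]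
    · obtain ⟨h1, h2⟩ := colCoeff_pair_of_ne (M := M) (r := q) (r' := r') hv h
      rw [h1, h2, if_neg h]; ring
  -- At the own pair the row coefficients differ from the constant `1` only in the other column `2 *
  -- a + (1 - u)`, by `1` or `-1`. Together with the sign of that column this is the correction term
  -- for both values of `u`.
  by_cases h : r' = r ∧ k = a
  · obtain ⟨rfl, rfl⟩ := h
    obtain ⟨h1, h2⟩ := rowCoeff_pair_self (r := r') (a := k) hu
    have h3 : stepCoeff r' r' = 1 := by simp [stepCoeff]
    have h4 : compareSign k k = 0 := by simp [compareSign]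
    rw [h1, h2, if_pos rfl, if_pos rfl, if_pos rfl, h3]
    have h5 : (if k = b then (2 - 1 + compareSign k b) * (stepCoeff q r' - downShift M b) else 0) =
        if k = b then stepCoeff q r' - downShift M b else 0 := by
      by_cases h : k = b
      · subst h; rw [if_pos rfl, if_pos rfl, h4]; ring
      · rw [if_neg h, if_neg h]
    rw [h5, ← hκ]
    obtain rfl | rfl : u = 0 ∨ u = 1 := by omega
    · push_cast; ring
    · push_cast; simp only [add_zero]; ring
  · obtain ⟨h1, h2⟩ := rowCoeff_pair_of_ne hu h
    have h3 : (if k = a then (if r' = r then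
          pairSign M a * colCoeff M q (2 * b + v) r (2 * a + (1 - u)) else 0) else 0) = 0 := by
      by_cases hk : k = a
      · rw [if_pos hk, if_neg fun h' => h ⟨h', hk⟩]
      · rw [if_neg hk]
    rw [h1, h2, h3, ← mul_sub, mul_left_comm, hκ, sub_zero]
    by_cases h : k = b
    · subst h; rw [if_pos rfl, if_pos rfl]
    · rw [if_neg h, if_neg h, mul_zero]

theorem gridSum_rowCoeff_colCoeff {A q b v : ℕ} (hr : r < A) (hu : u < 2)
    (hv : v < 2) (ha : a ≤ M) (hb : b ≤ M) :
    gridSum A M (rowCoeff r (2 * a + u)) (colCoeff M q (2 * b + v)) =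
      ∑ r' ∈ Finset.range A, (2 - stepCoeff r r') * (stepCoeff q r' - downShift M b) +
        compareSign a b * (stepCoeff q r - downShift M b) -
        pairSign M a * colCoeff M q (2 * b + v) r (2 * a + (1 - u)) := by
  rw [gridSum_eq]
  simp only [pairSign_mul_rowCoeff_mul_colCoeff hu hv hb, Finset.sum_sub_distrib,
    Finset.sum_ite_eq', Finset.mem_range]
  have ha' : a < M + 1 := by omega
  have hb' : b < M + 1 := by omega
  simp only [ha', hb', if_true, add_mul, Finset.sum_add_distrib, ite_mul, zero_mul,
    Finset.sum_ite_eq', Finset.mem_range, hr]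

/-- Against the constant coefficients of `γ` only the own pair in the own row survives, where the
two row coefficients differ by `1`. -/
theorem gridSum_rowCoeff_two {A : ℕ} (hr : r < A) (hu : u < 2) (ha : a ≤ M) :
    gridSum A M (rowCoeff r (2 * a + u)) (fun _ _ => 2) = -2 * pairSign M a := by
  rw [gridSum_eq]
  have h : ∀ r' k, pairSign M k * (rowCoeff r (2 * a + u) r' (2 * k) * 2 -
      rowCoeff r (2 * a + u) r' (2 * k + 1) * 2) =
      if k = a then (if r' = r then -2 * pairSign M a else 0) else 0 := by
    intro r' k
    by_cases h : r' = r ∧ k = a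
    · obtain ⟨rfl, rfl⟩ := h
      obtain ⟨h1, h2⟩ := rowCoeff_pair_self (r := r') (a := k) hu
      rw [h1, h2, if_pos rfl, if_pos rfl]; ring
    · obtain ⟨h1, h2⟩ := rowCoeff_pair_of_ne hu h
      rw [h1, h2]
      by_cases hk : k = a
      · rw [if_pos hk, sub_self, mul_zero, if_neg fun h' => h ⟨h', hk⟩]
      · rw [if_neg hk]; ring
  have ha' : a < M + 1 := by omega
  simp only [h, Finset.sum_ite_eq', Finset.mem_range, ha', if_true, hr]

theorem gridSum_two_colCoeff {A : ℕ} (hr : r < A) (hu : u < 2) (ha : a ≤ M) :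
    gridSum A M (fun _ _ => 2) (colCoeff M r (2 * a + u)) =
      2 * (2 * r + 1) - 2 * (A * downShift M a) := by
  rw [gridSum_eq]
  have h : ∀ r' k, pairSign M k * (2 * colCoeff M r (2 * a + u) r' (2 * k) -
      2 * colCoeff M r (2 * a + u) r' (2 * k + 1)) =
      if k = a then 2 * (stepCoeff r r' - downShift M a) else 0 := by
    intro r' k
    by_cases hk : k = a
    · subst hk; rw [if_pos rfl, ← colCoeff_pair_self hu ha]; ring
    · obtain ⟨h1, h2⟩ := colCoeff_pair_of_ne (M := M) (r := r) (r' := r') hu hk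
      rw [h1, h2, if_neg hk]; ring
  have ha' : a < M + 1 := by omega
  simp only [h, Finset.sum_ite_eq', Finset.mem_range, ha', if_true]
  rw [← Finset.mul_sum, Finset.sum_sub_distrib, sum_range_stepCoeff hr]
  simp [mul_sub]

end

/-- The intersection number `α · γ` of a crossing of a grid. -/
def gridExp (A M r c : ℕ) : ℤ := if c < 2 * M then -(r + 1) else A - r

theorem exists_pair_of_lt {M c : ℕ} (hc : c < 2 * M + 2) : ∃ a u, u < 2 ∧ a ≤ M ∧ c = 2 * a + u :=
  ⟨c / 2, c % 2, by omega, by omega, by omega⟩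

theorem gridSum_alpha_gamma {A M r c : ℕ} (hr : r < A) (hc : c < 2 * M + 2) :
    gridSum A M (rowCoeff r c) (fun _ _ => 2) - gridSum A M (fun _ _ => 2) (colCoeff M r c) =
      4 * gridExp A M r c := by
  obtain ⟨a, u, hu, ha, rfl⟩ := exists_pair_of_lt hc
  rw [gridSum_rowCoeff_two hr hu ha, gridSum_two_colCoeff hr hu ha, pairSign, downShift, gridExp]
  by_cases h : a < M
  · rw [if_pos h, if_pos h, if_pos (by omega)]; ring
  · rw [if_neg h, if_neg h, if_neg (by omega)]; ring

/-- This is the determinant formula required by `G_eq_mul`, with the first `2 * M` columns as the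
distinguished class. Antisymmetrizing kills the quadratic part of the row sums, and the corner
corrections absorb what depends on the relative position of the two pairs. -/
theorem gridSum_alpha_alpha {A M r c q d : ℕ} (hr : r < A) (hc : c < 2 * M + 2) (hq : q < A)
    (hd : d < 2 * M + 2) :
    gridSum A M (rowCoeff r c) (colCoeff M q d) - gridSum A M (rowCoeff q d) (colCoeff M r c) =
      4 * (gridExp A M r c * (if d < 2 * M then 1 else 0) -
        gridExp A M q d * (if c < 2 * M then 1 else 0)) := by
  obtain ⟨a, u, hu, ha, rfl⟩ := exists_pair_of_lt hc
  obtain ⟨b, v, hv, hb, rfl⟩ := exists_pair_of_lt hd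
  rw [gridSum_rowCoeff_colCoeff hr hu hv ha hb, gridSum_rowCoeff_colCoeff hq hv hu hb ha]
  -- The products of two step coefficients cancel, which leaves sums of single ones.
  have hsum : ∑ r' ∈ Finset.range A, (2 - stepCoeff r r') * (stepCoeff q r' - downShift M b) -
      ∑ r' ∈ Finset.range A, (2 - stepCoeff q r') * (stepCoeff r r' - downShift M a) =
      (2 - downShift M a) * (2 * q + 1) - (2 - downShift M b) * (2 * r + 1) -
        2 * A * (downShift M b - downShift M a) := by
    rw [← sum_range_stepCoeff hr, ← sum_range_stepCoeff hq, Finset.mul_sum, Finset.mul_sum,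
      ← Finset.sum_sub_distrib, ← Finset.sum_sub_distrib]
    have : 2 * A * (downShift M b - downShift M a) =
        ∑ r' ∈ Finset.range A, 2 * (downShift M b - downShift M a) := by
      simp; ring
    rw [this, ← Finset.sum_sub_distrib]
    exact Finset.sum_congr rfl fun r' _ => by ring
  have hstep : stepCoeff q r + stepCoeff r q = 2 := by
    unfold stepCoeff; split_ifs <;> omega
  -- For different pairs, one corner coefficient is `2` and the other `0`; the earlier pair is never
  -- the last, so its sign is `1`. For equal pairs the two coefficients agree.
  have hcorner : pairSign M a * colCoeff M q (2 * b + v) r (2 * a + (1 - u)) -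
      pairSign M b * colCoeff M r (2 * a + u) q (2 * b + (1 - v)) =
      2 * compareSign a b := by
    rcases lt_trichotomy a b with h | h | h
    · have h1 : colCoeff M q (2 * b + v) r (2 * a + (1 - u)) = 2 := if_pos (by omega)
      have h2 : colCoeff M r (2 * a + u) q (2 * b + (1 - v)) = 0 := by
        unfold colCoeff; rw [if_neg (by omega), if_neg (by omega)]
      rw [h1, h2]
      unfold pairSign compareSign
      split_ifs <;> omega
    · subst h
      have h1 : colCoeff M q (2 * a + v) r (2 * a + (1 - u)) =
          colCoeff M r (2 * a + u) q (2 * a + (1 - v)) := by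
        have hup : IsUp M (2 * a) ↔ ¬ IsUp M (2 * a + 1) := by
          rw [isUp_even, isUp_odd]; omega
        unfold colCoeff
        obtain rfl | rfl : u = 0 ∨ u = 1 := by omega
        · obtain rfl | rfl : v = 0 ∨ v = 1 := by omega
          · rw [if_neg (by omega), if_neg (by omega), if_neg (by omega), if_neg (by omega)]
          · by_cases h : IsUp M (2 * a + 1) <;>
              simp only [add_zero, Nat.sub_zero, Nat.sub_self, hup, h, not_true_eq_false,
                true_and, and_true, not_false_eq_true, if_true, if_false] <;> split_ifs <;> omega
        · obtain rfl | rfl : v = 0 ∨ v = 1 := by omega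
          · by_cases h : IsUp M (2 * a + 1) <;>
              simp only [add_zero, Nat.sub_zero, Nat.sub_self, hup, h, not_true_eq_false,
                true_and, and_true, not_false_eq_true, if_true, if_false] <;> split_ifs <;> omega
          · rw [if_pos (by omega), if_pos (by omega)]
      rw [h1]
      simp [compareSign]
    · have h1 : colCoeff M q (2 * b + v) r (2 * a + (1 - u)) = 0 := by
        unfold colCoeff; rw [if_neg (by omega), if_neg (by omega)]
      have h2 : colCoeff M r (2 * a + u) q (2 * b + (1 - v)) = 2 := if_pos (by omega)
      rw [h1, h2]
      unfold pairSign compareSign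
      split_ifs <;> omega
  have hcompare : compareSign b a = -compareSign a b := by
    unfold compareSign; split_ifs <;> omega
  -- Only the pair `M` is shifted, and no pair comes after it.
  have hshift : compareSign a b * (downShift M a + downShift M b) =
      downShift M b - downShift M a := by
    unfold compareSign downShift; split_ifs <;> omega
  rw [hcompare]
  -- Shift and exponent are affine in the indicator of the first `2 * M` columns, which reduces the
  -- claim to algebra.
  have hτ : ∀ k w, w < 2 → downShift M k = 2 - 2 * (if 2 * k + w < 2 * M then 1 else 0) ∧
      ∀ x : ℕ, gridExp A M x (2 * k + w) =
        (A : ℤ) - x - (A + 1) * (if 2 * k + w < 2 * M then 1 else 0) := by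
    intro k w hw
    unfold downShift gridExp
    refine ⟨by split_ifs <;> omega, fun x => ?_⟩
    split_ifs <;> ring
  rw [(hτ a u hu).2, (hτ b v hv).2]
  rw [(hτ a u hu).1, (hτ b v hv).1] at hsum hshift ⊢
  linear_combination hsum + compareSign a b * hstep - hcorner - hshift

namespace LongGaussDiagram

theorem grid_inter4_alpha_gamma {A M : ℕ} (i : (grid A M).Crossing) :
    (grid A M).inter4 ((grid A M).alpha i) (grid A M).gamma = 4 * gridExp A M i.1 i.2 := by
  rw [← gridSum_alpha_gamma i.1.2 i.2.2]
  exact grid_inter4 _ _ _ _ _ _ (grid_alpha_row i) (grid_alpha_col i) (fun _ => rfl)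
    (fun _ => rfl)

theorem grid_inter4_alpha_alpha {A M : ℕ} (i j : (grid A M).Crossing) :
    (grid A M).inter4 ((grid A M).alpha i) ((grid A M).alpha j) =
      4 * (gridExp A M i.1 i.2 * (if (j.2 : ℕ) < 2 * M then 1 else 0) -
        gridExp A M j.1 j.2 * (if (i.2 : ℕ) < 2 * M then 1 else 0)) := by
  rw [← gridSum_alpha_alpha i.1.2 i.2.2 j.1.2 j.2.2]
  exact grid_inter4 _ _ _ _ _ _ (grid_alpha_row i) (grid_alpha_col i) (grid_alpha_row j)
    (grid_alpha_col j)

theorem grid_inter {A M : ℕ} (i j : (grid A M).Crossing) :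
    (grid A M).inter ((grid A M).alpha i) ((grid A M).beta j) =
      gridExp A M i.1 i.2 - (gridExp A M i.1 i.2 * (if (j.2 : ℕ) < 2 * M then 1 else 0) -
        gridExp A M j.1 j.2 * (if (i.2 : ℕ) < 2 * M then 1 else 0)) := by
  have h := (grid A M).four_mul_inter_alpha_beta i j
  rw [inter4_alpha_beta, grid_inter4_alpha_gamma, grid_inter4_alpha_alpha] at h
  linarith

end LongGaussDiagram

/-! ### The faces of a grid on the torus -/

theorem numCycles_eq_card_finset {X L : Type} (π : Equiv.Perm X) (s : Finset L) (label : X → L)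
    (rep : L → X) (hmem : ∀ x, label x ∈ s) (hlabel : ∀ x, label (π x) = label x)
    (hrep : ∀ l ∈ s, label (rep l) = l) (hcycle : ∀ x, π.SameCycle x (rep (label x))) :
    numCycles π = s.card := by
  rw [numCycles_eq_card (L := s) π (fun x => ⟨label x, hmem x⟩) (fun l => rep l)
    (fun x => Subtype.ext (hlabel x)) (fun l => Subtype.ext (hrep l l.2)) hcycle]
  simp

namespace LongGaussDiagram

theorem IsTight.flip_some_true {D : LongGaussDiagram} (hD : D.IsTight) {p q : D.Passage}
    (h : D.time q = D.time p + 1) : hD.surface.flip (some p, true) = (some q, false) :=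
  congrArg (·, false) (hD.next_some_some p q h)

theorem IsTight.flip_some_false {D : LongGaussDiagram} (hD : D.IsTight) {p q : D.Passage}
    (h : D.time q = D.time p + 1) : hD.surface.flip (some q, false) = (some p, true) := by
  rw [← hD.flip_some_true h]
  exact hD.surface.flip_flip _

section

variable {A M : ℕ}

/-- The crossing of the row `r` and the column `c`. -/
def gridCrossing {r c : ℕ} (hr : r < A) (hc : c < 2 * M + 2) : (grid A M).Crossing :=
  (⟨r, hr⟩, ⟨c, hc⟩)

/-- The half-edge that leaves the crossing `(r, c)` to the right. -/
def gridEast {r c : ℕ} (hr : r < A) (hc : c < 2 * M + 2) : (grid A M).HalfEdge :=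
  (some (gridCrossing hr hc, true), true)

/-- The half-edge that leaves the crossing `(r, c)` to the left. -/
def gridWest {r c : ℕ} (hr : r < A) (hc : c < 2 * M + 2) : (grid A M).HalfEdge :=
  (some (gridCrossing hr hc, true), false)

/-- The half-edge that leaves the crossing `(r, c)` upwards. -/
def gridNorth {r c : ℕ} (hr : r < A) (hc : c < 2 * M + 2) : (grid A M).HalfEdge :=
  (some (gridCrossing hr hc, false), decide (IsUp M c))

/-- The half-edge that leaves the crossing `(r, c)` downwards. -/
def gridSouth {r c : ℕ} (hr : r < A) (hc : c < 2 * M + 2) : (grid A M).HalfEdge :=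
  (some (gridCrossing hr hc, false), !decide (IsUp M c))

theorem grid_halfEdge_cases {P : (grid A M).HalfEdge → Prop} (h1 : P (none, true))
    (h2 : P (none, false)) (h3 : ∀ r c hr hc, P (gridEast (r := r) (c := c) hr hc))
    (h4 : ∀ r c hr hc, P (gridNorth (r := r) (c := c) hr hc))
    (h5 : ∀ r c hr hc, P (gridWest (r := r) (c := c) hr hc))
    (h6 : ∀ r c hr hc, P (gridSouth (r := r) (c := c) hr hc)) (d) : P d := by
  rcases d with ⟨_ | ⟨⟨⟨r, hr⟩, ⟨c, hc⟩⟩, _ | _⟩, b⟩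
  · cases b <;> assumption
  · by_cases h : b = decide (IsUp M c)
    · rw [h]; exact h4 r c hr hc
    · rw [Bool.eq_not.2 h]; exact h6 r c hr hc
  · cases b
    · exact h5 r c hr hc
    · exact h3 r c hr hc

/-- The permutation of the half-edges of a grid whose cycles are the boundaries of the faces. -/
noncomputable def gridFacePerm (A M : ℕ) : Equiv.Perm (grid A M).HalfEdge :=
  (grid_isTight A M).surface.rot * (grid_isTight A M).surface.flip

theorem rotation_over (D : LongGaussDiagram) (c : D.Crossing) (b : Bool) :
    D.rotation (some (c, true), b) = (some (c, false), if D.sign c = 1 then b else !b) := rfl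

theorem rotation_under (D : LongGaussDiagram) (c : D.Crossing) (b : Bool) :
    D.rotation (some (c, false), b) = (some (c, true), if D.sign c = 1 then !b else b) := rfl

section rotation

variable {r c : ℕ} (hr : r < A) (hc : c < 2 * M + 2)

theorem grid_sign_eq_one_iff :
    (grid A M).sign (gridCrossing hr hc) = 1 ↔ IsUp M c := by
  change (if IsUp M c then (1 : ℤˣ) else -1) = 1 ↔ _
  by_cases h : IsUp M c <;> simp [h]

theorem rotation_gridEast : (grid A M).rotation (gridEast hr hc) = gridNorth hr hc := by
  unfold gridEast gridNorth
  simp only [rotation_over, grid_sign_eq_one_iff]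
  by_cases h : IsUp M c <;> simp [h]

theorem rotation_gridNorth : (grid A M).rotation (gridNorth hr hc) = gridWest hr hc := by
  unfold gridWest gridNorth
  simp only [rotation_under, grid_sign_eq_one_iff]
  by_cases h : IsUp M c <;> simp [h]

theorem rotation_gridWest : (grid A M).rotation (gridWest hr hc) = gridSouth hr hc := by
  unfold gridWest gridSouth
  simp only [rotation_over, grid_sign_eq_one_iff]
  by_cases h : IsUp M c <;> simp [h]

theorem rotation_gridSouth : (grid A M).rotation (gridSouth hr hc) = gridEast hr hc := by
  unfold gridEast gridSouth
  simp only [rotation_under, grid_sign_eq_one_iff]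
  by_cases h : IsUp M c <;> simp [h]

end rotation

/-- A face is traced by passing to the other end of an edge and turning counterclockwise; it stays
on the right of the half-edges. -/
theorem gridFacePerm_eq {d d' d'' : (grid A M).HalfEdge}
    (h : (grid_isTight A M).surface.flip d = d') (h' : (grid A M).rotation d' = d'') :
    gridFacePerm A M d = d'' := by
  rw [← h', ← h]; rfl

theorem grid_time_row_eq {r c : ℕ} (hr : r < A) (hc : c < 2 * M + 2) :
    (grid A M).time (gridCrossing hr hc, true) = rowTime M r c := rfl

theorem grid_time_col_eq {r c : ℕ} (hr : r < A) (hc : c < 2 * M + 2) :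
    (grid A M).time (gridCrossing hr hc, false) = colTime A M r c := rfl

theorem gridNorth_of_isUp {r c : ℕ} (hr : r < A) (hc : c < 2 * M + 2) (h : IsUp M c) :
    gridNorth hr hc = (some (gridCrossing hr hc, false), true) := by simp [gridNorth, h]

theorem gridNorth_of_not_isUp {r c : ℕ} (hr : r < A) (hc : c < 2 * M + 2) (h : ¬ IsUp M c) :
    gridNorth hr hc = (some (gridCrossing hr hc, false), false) := by simp [gridNorth, h]

theorem gridSouth_of_isUp {r c : ℕ} (hr : r < A) (hc : c < 2 * M + 2) (h : IsUp M c) :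
    gridSouth hr hc = (some (gridCrossing hr hc, false), false) := by simp [gridSouth, h]

theorem gridSouth_of_not_isUp {r c : ℕ} (hr : r < A) (hc : c < 2 * M + 2) (h : ¬ IsUp M c) :
    gridSouth hr hc = (some (gridCrossing hr hc, false), true) := by simp [gridSouth, h]

/-! #### The edges of the rows -/

theorem rowTime_succ_right (M r c : ℕ) : rowTime M r (c + 1) = rowTime M r c + 1 := rfl

/-- The spiral: the right end of a row is joined to the left end of the next row. -/
theorem rowTime_succ_left (M r : ℕ) : rowTime M (r + 1) 0 = rowTime M r (2 * M + 1) + 1 := by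
  unfold rowTime; rw [Nat.succ_mul]; omega

/-- After the last row the curve enters column `0` from below; `0 < M` ensures that this column runs
upwards. -/
theorem colTime_zero_zero (hA : 0 < A) (hM : 0 < M) :
    colTime A M 0 0 = rowTime M (A - 1) (2 * M + 1) + 1 := by
  obtain ⟨B, rfl⟩ := Nat.exists_eq_succ_of_ne_zero hA.ne'
  have h : IsUp M 0 := by unfold IsUp; omega
  unfold colTime rowTime
  rw [if_pos h, Nat.succ_mul, Nat.succ_sub_one]
  omega

theorem gridFacePerm_east {r c : ℕ} (hr : r < A) (hc : c + 1 < 2 * M + 2) :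
    gridFacePerm A M (gridEast hr (Nat.lt_of_succ_lt hc)) = gridSouth hr hc := by
  refine gridFacePerm_eq ((grid_isTight A M).flip_some_true ?_) (rotation_gridWest hr hc)
  rw [grid_time_row_eq, grid_time_row_eq, rowTime_succ_right]
  rfl

theorem gridFacePerm_west {r c : ℕ} (hr : r < A) (hc : c + 1 < 2 * M + 2) :
    gridFacePerm A M (gridWest hr hc) = gridNorth hr (Nat.lt_of_succ_lt hc) := by
  refine gridFacePerm_eq ((grid_isTight A M).flip_some_false ?_) (rotation_gridEast hr _)
  rw [grid_time_row_eq, grid_time_row_eq, rowTime_succ_right]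
  rfl

theorem gridFacePerm_east_last {r : ℕ} (hr : r + 1 < A) :
    gridFacePerm A M (gridEast (c := 2 * M + 1) (Nat.lt_of_succ_lt hr) (by omega)) =
      gridSouth (c := 0) hr (by omega) := by
  refine gridFacePerm_eq ((grid_isTight A M).flip_some_true ?_) (rotation_gridWest hr _)
  rw [grid_time_row_eq, grid_time_row_eq, rowTime_succ_left]
  rfl

theorem gridFacePerm_west_first {r : ℕ} (hr : r + 1 < A) :
    gridFacePerm A M (gridWest (c := 0) hr (by omega)) =
      gridNorth (c := 2 * M + 1) (Nat.lt_of_succ_lt hr) (by omega) := by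
  refine gridFacePerm_eq ((grid_isTight A M).flip_some_false ?_) (rotation_gridEast _ _)
  rw [grid_time_row_eq, grid_time_row_eq, rowTime_succ_left]
  rfl

theorem gridFacePerm_east_last_last (hA : 0 < A) (hM : 0 < M) :
    gridFacePerm A M (gridEast (r := A - 1) (c := 2 * M + 1) (by omega) (by omega)) =
      gridEast (r := 0) (c := 0) hA (by omega) := by
  have h : IsUp M 0 := by unfold IsUp; omega
  refine gridFacePerm_eq (d' := gridSouth (r := 0) (c := 0) hA (by omega)) ?_
    (rotation_gridSouth _ _)
  rw [gridSouth_of_isUp _ _ h]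
  refine (grid_isTight A M).flip_some_true ?_
  rw [grid_time_row_eq, grid_time_col_eq, colTime_zero_zero hA hM]
  rfl

theorem gridFacePerm_south_zero_zero (hA : 0 < A) (hM : 0 < M) :
    gridFacePerm A M (gridSouth (r := 0) (c := 0) hA (by omega)) =
      gridNorth (r := A - 1) (c := 2 * M + 1) (by omega) (by omega) := by
  have h : IsUp M 0 := by unfold IsUp; omega
  refine gridFacePerm_eq ?_ (rotation_gridEast _ _)
  rw [gridSouth_of_isUp _ _ h]
  refine (grid_isTight A M).flip_some_false ?_
  rw [grid_time_row_eq, grid_time_col_eq, colTime_zero_zero hA hM]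
  rfl

/-! #### The edges of the columns -/

theorem colTime_succ_of_isUp {r c : ℕ} (h : IsUp M c) :
    colTime A M (r + 1) c = colTime A M r c + 1 := by
  unfold colTime; rw [if_pos h, if_pos h]; omega

theorem colTime_of_not_isUp {r c : ℕ} (hr : r + 1 < A) (h : ¬ IsUp M c) :
    colTime A M r c = colTime A M (r + 1) c + 1 := by
  unfold colTime; rw [if_neg h, if_neg h]; omega

theorem colTime_top {c : ℕ} (hA : 0 < A) (h : IsUp M c) (h' : ¬ IsUp M (c + 1)) :
    colTime A M (A - 1) (c + 1) = colTime A M (A - 1) c + 1 := by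
  unfold colTime; rw [if_pos h, if_neg h', Nat.succ_mul c]; omega

theorem colTime_bottom {c : ℕ} (hA : 0 < A) (h : ¬ IsUp M c) (h' : IsUp M (c + 1)) :
    colTime A M 0 (c + 1) = colTime A M 0 c + 1 := by
  unfold colTime; rw [if_neg h, if_pos h', Nat.succ_mul c]; omega

/-- In a grid with `0 < M` two consecutive downward columns occur only at `2 * M - 1` and `2 * M`;
there the curve goes around the torus from the bottom to the top. -/
theorem colTime_bottom_top {c : ℕ} (hA : 0 < A) (h : ¬ IsUp M c) (h' : ¬ IsUp M (c + 1)) :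
    colTime A M (A - 1) (c + 1) = colTime A M 0 c + 1 := by
  unfold colTime; rw [if_neg h, if_neg h', Nat.succ_mul c]; omega

theorem gridFacePerm_north {r c : ℕ} (hr : r + 1 < A) (hc : c < 2 * M + 2) :
    gridFacePerm A M (gridNorth (Nat.lt_of_succ_lt hr) hc) = gridEast hr hc := by
  refine gridFacePerm_eq ?_ (rotation_gridSouth hr hc)
  by_cases h : IsUp M c
  · rw [gridNorth_of_isUp _ _ h, gridSouth_of_isUp _ _ h]
    refine (grid_isTight A M).flip_some_true ?_
    rw [grid_time_col_eq, grid_time_col_eq, colTime_succ_of_isUp h]; rfl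
  · rw [gridNorth_of_not_isUp _ _ h, gridSouth_of_not_isUp _ _ h]
    refine (grid_isTight A M).flip_some_false ?_
    rw [grid_time_col_eq, grid_time_col_eq, colTime_of_not_isUp hr h]; rfl

theorem gridFacePerm_south {r c : ℕ} (hr : r + 1 < A) (hc : c < 2 * M + 2) :
    gridFacePerm A M (gridSouth hr hc) = gridWest (Nat.lt_of_succ_lt hr) hc := by
  refine gridFacePerm_eq ?_ (rotation_gridNorth _ hc)
  by_cases h : IsUp M c
  · rw [gridNorth_of_isUp _ _ h, gridSouth_of_isUp _ _ h]
    refine (grid_isTight A M).flip_some_false ?_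
    rw [grid_time_col_eq, grid_time_col_eq, colTime_succ_of_isUp h]; rfl
  · rw [gridNorth_of_not_isUp _ _ h, gridSouth_of_not_isUp _ _ h]
    refine (grid_isTight A M).flip_some_true ?_
    rw [grid_time_col_eq, grid_time_col_eq, colTime_of_not_isUp hr h]; rfl

section turns

variable {c : ℕ} (hA : 0 < A) (hc : c + 1 < 2 * M + 2)

theorem gridFacePerm_north_top_left (h : IsUp M c) (h' : ¬ IsUp M (c + 1)) :
    gridFacePerm A M (gridNorth (r := A - 1) (c := c) (by omega) (by omega)) =
      gridWest (r := A - 1) (by omega) hc := by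
  refine gridFacePerm_eq ?_ (rotation_gridNorth _ hc)
  rw [gridNorth_of_isUp _ _ h, gridNorth_of_not_isUp _ _ h']
  refine (grid_isTight A M).flip_some_true ?_
  rw [grid_time_col_eq, grid_time_col_eq, colTime_top hA h h']; rfl

theorem gridFacePerm_north_top_right (h : IsUp M c) (h' : ¬ IsUp M (c + 1)) :
    gridFacePerm A M (gridNorth (r := A - 1) (by omega) hc) =
      gridWest (r := A - 1) (c := c) (by omega) (by omega) := by
  refine gridFacePerm_eq ?_ (rotation_gridNorth _ _)
  rw [gridNorth_of_isUp _ _ h, gridNorth_of_not_isUp _ _ h']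
  refine (grid_isTight A M).flip_some_false ?_
  rw [grid_time_col_eq, grid_time_col_eq, colTime_top hA h h']; rfl

theorem gridFacePerm_south_bottom_left (h : ¬ IsUp M c) (h' : IsUp M (c + 1)) :
    gridFacePerm A M (gridSouth (r := 0) (c := c) hA (by omega)) =
      gridEast (r := 0) hA hc := by
  refine gridFacePerm_eq ?_ (rotation_gridSouth _ hc)
  rw [gridSouth_of_not_isUp _ _ h, gridSouth_of_isUp _ _ h']
  refine (grid_isTight A M).flip_some_true ?_
  rw [grid_time_col_eq, grid_time_col_eq, colTime_bottom hA h h']; rfl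

theorem gridFacePerm_south_bottom_right (h : ¬ IsUp M c) (h' : IsUp M (c + 1)) :
    gridFacePerm A M (gridSouth (r := 0) hA hc) =
      gridEast (r := 0) (c := c) hA (by omega) := by
  refine gridFacePerm_eq ?_ (rotation_gridSouth _ _)
  rw [gridSouth_of_not_isUp _ _ h, gridSouth_of_isUp _ _ h']
  refine (grid_isTight A M).flip_some_false ?_
  rw [grid_time_col_eq, grid_time_col_eq, colTime_bottom hA h h']; rfl

theorem gridFacePerm_south_bottom_top (h : ¬ IsUp M c) (h' : ¬ IsUp M (c + 1)) :
    gridFacePerm A M (gridSouth (r := 0) (c := c) hA (by omega)) =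
      gridWest (r := A - 1) (by omega) hc := by
  refine gridFacePerm_eq ?_ (rotation_gridNorth _ hc)
  rw [gridSouth_of_not_isUp _ _ h, gridNorth_of_not_isUp _ _ h']
  refine (grid_isTight A M).flip_some_true ?_
  rw [grid_time_col_eq, grid_time_col_eq, colTime_bottom_top hA h h']; rfl

theorem gridFacePerm_north_bottom_top (h : ¬ IsUp M c) (h' : ¬ IsUp M (c + 1)) :
    gridFacePerm A M (gridNorth (r := A - 1) (by omega) hc) =
      gridEast (r := 0) (c := c) hA (by omega) := by
  refine gridFacePerm_eq ?_ (rotation_gridSouth _ _)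
  rw [gridSouth_of_not_isUp _ _ h, gridNorth_of_not_isUp _ _ h']
  refine (grid_isTight A M).flip_some_false ?_
  rw [grid_time_col_eq, grid_time_col_eq, colTime_bottom_top hA h h']; rfl

end turns

/-! #### The edges at the basepoint -/

theorem grid_flip_none_true (hA : 0 < A) :
    (grid_isTight A M).surface.flip (none, true) =
      gridWest (r := 0) (c := 0) hA (by omega) := by
  refine congrArg (·, false) ((grid_isTight A M).next_none_some (gridCrossing hA (by omega), true) ?_)
  rw [grid_time_row_eq, rowTime, zero_mul]
  rfl

theorem grid_flip_north_last (hA : 0 < A) :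
    (grid_isTight A M).surface.flip
      (gridNorth (r := A - 1) (c := 2 * M + 1) (by omega) (by omega)) = (none, false) := by
  have h : IsUp M (2 * M + 1) := Or.inr rfl
  rw [gridNorth_of_isUp _ _ h]
  refine congrArg (·, false) ((grid_isTight A M).next_some_none _ ?_)
  have hcard : Fintype.card (grid A M).Passage = A * (2 * M + 2) + A * (2 * M + 2) := by
    change Fintype.card ((Fin A × Fin (2 * M + 2)) × Bool) = _
    simp only [Fintype.card_prod, Fintype.card_fin, Fintype.card_bool]
    ring
  rw [grid_time_col_eq, hcard, colTime, if_pos h]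
  have : A * (2 * M + 2) = (2 * M + 1) * A + A := by ring
  omega

theorem gridFacePerm_none_true (hA : 0 < A) :
    gridFacePerm A M (none, true) = gridSouth (r := 0) (c := 0) hA (by omega) :=
  gridFacePerm_eq (grid_flip_none_true hA) (rotation_gridWest _ _)

theorem gridFacePerm_west_zero_zero (hA : 0 < A) :
    gridFacePerm A M (gridWest (r := 0) (c := 0) hA (by omega)) = (none, false) := by
  refine gridFacePerm_eq (d' := (none, true)) ?_ rfl
  rw [← grid_flip_none_true hA]
  exact (grid_isTight A M).surface.flip_flip _

theorem gridFacePerm_north_last (hA : 0 < A) :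
    gridFacePerm A M (gridNorth (r := A - 1) (c := 2 * M + 1) (by omega) (by omega)) =
      (none, true) :=
  gridFacePerm_eq (grid_flip_north_last hA) rfl

theorem gridFacePerm_none_false (hA : 0 < A) :
    gridFacePerm A M (none, false) =
      gridWest (r := A - 1) (c := 2 * M + 1) (by omega) (by omega) := by
  refine gridFacePerm_eq ?_ (rotation_gridNorth _ _)
  rw [← grid_flip_north_last hA]
  exact (grid_isTight A M).surface.flip_flip _

end

end LongGaussDiagram

namespace LongGaussDiagram

/-! #### The faces are labelled by the crossings -/

/-- The label of the face to the upper right of the crossing `(r, c)`. -/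
def labelNE (A M r c : ℕ) : ℕ × ℕ :=
  if r + 1 = A ∧ c % 2 = 1 ∧ c < 2 * M then (A - 2, 2 * M + 1) else (r, c)

/-- The label of the face to the upper left of the crossing `(r, c)`. -/
def labelNW (A M r c : ℕ) : ℕ × ℕ :=
  if c = 0 then
    if r = 0 then labelNE A M (A - 1) (2 * M) else labelNE A M (r - 1) (2 * M + 1)
  else labelNE A M r (c - 1)

/-- The label of the face to the lower right of the crossing `(0, c)`. -/
def labelBottom (A M c : ℕ) : ℕ × ℕ :=
  if c < 2 * M then
    if c % 2 = 0 then (A - 2, 2 * M + 1) else if c + 1 = 2 * M then (A - 1, 2 * M) else (A - 1, c)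
  else if c = 2 * M then (A - 1, 2 * M - 1) else (A - 1, 2 * M)

/-- The label of the face to the lower right of the crossing `(r, c)`. -/
def labelSE (A M r c : ℕ) : ℕ × ℕ :=
  if r = 0 then labelBottom A M c else labelNE A M (r - 1) c

/-- The label of the face to the lower left of the crossing `(r, c)`. -/
def labelSW (A M r c : ℕ) : ℕ × ℕ :=
  if r = 0 then if c = 0 then (A - 1, 2 * M + 1) else labelBottom A M (c - 1)
  else labelNW A M (r - 1) c

/-- The label of the face to the right of a half-edge. -/
def faceLabel (A M : ℕ) : (grid A M).HalfEdge → ℕ × ℕ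
  | (none, true) => (A - 1, 2 * M + 1)
  | (none, false) => (A - 1, 2 * M)
  | (some (k, true), true) => labelSE A M k.1 k.2
  | (some (k, true), false) => labelNW A M k.1 k.2
  | (some (k, false), b) =>
    if b = decide (IsUp M k.2) then labelNE A M k.1 k.2 else labelSW A M k.1 k.2

section

variable {A M r c : ℕ}

section

variable (hr : r < A) (hc : c < 2 * M + 2)

theorem faceLabel_east : faceLabel A M (gridEast hr hc) = labelSE A M r c := rfl

theorem faceLabel_west : faceLabel A M (gridWest hr hc) = labelNW A M r c := rfl

theorem faceLabel_north : faceLabel A M (gridNorth hr hc) = labelNE A M r c := if_pos rfl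

theorem faceLabel_south : faceLabel A M (gridSouth hr hc) = labelSW A M r c :=
  if_neg (show ¬ (!decide (IsUp M c)) = decide (IsUp M c) by
    cases decide (IsUp M c) <;> decide)

end

/-- A face is named after the crossing at its lower left corner, with one kind of exception. The
corners to the upper right of `(A - 1, c)` with odd `c < 2 * M`, and to the lower right of `(0, c)`
with even `c < 2 * M`, all lie on one long face labelled `(A - 2, 2 * M + 1)`. The labels thereby
freed in the top row go to faces below the bottom row: `(A - 1, c)` with odd `c < 2 * M - 1` to the
face at the lower right of `(0, c)`, and `(A - 1, 2 * M - 1)` to the one at the lower right of `(0,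
2 * M)`. -/
theorem faceLabel_gridFacePerm_south (hA : 2 ≤ A) (hM : 0 < M) (hr : r < A)
    (hc : c < 2 * M + 2) :
    faceLabel A M (gridFacePerm A M (gridSouth hr hc)) = faceLabel A M (gridSouth hr hc) := by
  have hA' : 0 < A := by omega
  rw [faceLabel_south]
  rcases Nat.eq_zero_or_pos r with rfl | h
  · rcases Nat.eq_zero_or_pos c with rfl | h
    · rw [gridFacePerm_south_zero_zero hA' hM, faceLabel_north]
      unfold labelNE labelSW
      rw [if_neg (by omega), if_pos rfl, if_pos rfl]
    -- At its bottom end, a column other than the first goes around the torus, or turns into the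
    -- column to its right, or comes from the column to its left.
    · by_cases h1 : c + 1 = 2 * M
      · rw [gridFacePerm_south_bottom_top hA' (by omega)
          (by unfold IsUp; omega) (by unfold IsUp; omega), faceLabel_west]
        unfold labelNW labelSW labelBottom labelNE
        split_ifs <;> first | rfl | omega
      · by_cases h2 : c < 2 * M ∧ c % 2 = 1 ∨ c = 2 * M
        · rw [gridFacePerm_south_bottom_left hA' (by omega)
            (by unfold IsUp; omega) (by unfold IsUp; omega), faceLabel_east]
          unfold labelSE labelSW labelBottom
          split_ifs <;> first | rfl | omega
        · obtain ⟨c, rfl⟩ := Nat.exists_eq_succ_of_ne_zero h.ne'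
          rw [gridFacePerm_south_bottom_right hA' hc
            (by unfold IsUp; omega) (by unfold IsUp; omega), faceLabel_east]
          unfold labelSE labelSW
          rw [if_pos rfl, if_pos rfl, if_neg (Nat.succ_ne_zero c)]
          rfl
  · obtain ⟨r, rfl⟩ := Nat.exists_eq_succ_of_ne_zero h.ne'
    rw [gridFacePerm_south hr hc, faceLabel_west]
    simp [labelSW]

theorem faceLabel_gridFacePerm (hA : 2 ≤ A) (hM : 0 < M) (d : (grid A M).HalfEdge) :
    faceLabel A M (gridFacePerm A M d) = faceLabel A M d := by
  have hA' : 0 < A := by omega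
  induction d using grid_halfEdge_cases with
  | h1 =>
    rw [gridFacePerm_none_true hA', faceLabel_south]
    simp [labelSW, faceLabel]
  | h2 =>
    rw [gridFacePerm_none_false hA', faceLabel_west]
    simp [labelNW, labelNE, faceLabel]
  | h3 r c hr hc =>
    rw [faceLabel_east]
    by_cases h : c = 2 * M + 1
    · subst h
      by_cases h : r = A - 1
      · subst h
        rw [gridFacePerm_east_last_last hA' hM, faceLabel_east]
        unfold labelSE labelBottom labelNE
        split_ifs <;> first | rfl | omega
      · rw [gridFacePerm_east_last (show r + 1 < A by omega), faceLabel_south]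
        rcases Nat.eq_zero_or_pos r with rfl | h
        · simp [labelSE, labelSW, labelNW, labelBottom, labelNE]
        · simp [labelSE, labelSW, labelNW, h.ne']
    · rw [gridFacePerm_east hr (show c + 1 < 2 * M + 2 by omega), faceLabel_south]
      unfold labelSE labelSW labelNW
      simp
  | h4 r c hr hc =>
    rw [faceLabel_north]
    by_cases h : r = A - 1
    · subst h
      by_cases h1 : c = 2 * M + 1
      · subst h1
        rw [gridFacePerm_north_last hA']
        unfold labelNE faceLabel
        rw [if_neg (by omega)]
      · by_cases h2 : c = 2 * M
        · subst h2
          obtain ⟨N, rfl⟩ := Nat.exists_eq_succ_of_ne_zero hM.ne'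
          rw [gridFacePerm_north_bottom_top hA' (c := 2 * N + 1) (by omega)
            (by unfold IsUp; omega) (by unfold IsUp; omega), faceLabel_east]
          unfold labelSE labelBottom labelNE
          split_ifs <;> first | rfl | omega
        · by_cases h3 : c % 2 = 0
          · rw [gridFacePerm_north_top_left hA' (show c + 1 < 2 * M + 2 by omega)
              (by unfold IsUp; omega) (by unfold IsUp; omega), faceLabel_west]
            simp [labelNW]
          · obtain ⟨c, rfl⟩ := Nat.exists_eq_succ_of_ne_zero (show c ≠ 0 by rintro rfl; omega)
            rw [gridFacePerm_north_top_right hA' hc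
              (by unfold IsUp; omega) (by unfold IsUp; omega), faceLabel_west]
            unfold labelNW labelNE
            split_ifs <;> first | rfl | omega
    · rw [gridFacePerm_north (show r + 1 < A by omega) hc, faceLabel_east]
      simp [labelSE]
  | h5 r c hr hc =>
    rw [faceLabel_west]
    rcases Nat.eq_zero_or_pos c with rfl | h
    · rcases Nat.eq_zero_or_pos r with rfl | h
      · rw [gridFacePerm_west_zero_zero hA']
        simp [labelNW, labelNE, faceLabel]
      · obtain ⟨r, rfl⟩ := Nat.exists_eq_succ_of_ne_zero h.ne'
        rw [gridFacePerm_west_first hr, faceLabel_north]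
        simp [labelNW]
    · obtain ⟨c, rfl⟩ := Nat.exists_eq_succ_of_ne_zero h.ne'
      rw [gridFacePerm_west hr hc, faceLabel_north]
      simp [labelNW]
  | h6 r c hr hc => exact faceLabel_gridFacePerm_south hA hM hr hc

/-- A half-edge on the boundary of the face with a given label. -/
def faceRep (A M : ℕ) (l : ℕ × ℕ) : (grid A M).HalfEdge :=
  if h : l.1 < A ∧ l.2 < 2 * M + 2 then
    if l.1 + 1 = A ∧ l.2 % 2 = 1 ∧ l.2 < 2 * M then
      if l.2 + 1 = 2 * M then gridEast (r := 0) (c := 2 * M) (by omega) (by omega)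
      else gridEast (r := 0) (by omega) h.2
    else gridNorth h.1 h.2
  else (none, true)

/-- The freed labels of the top row are not seen at an upper right corner; they are represented by
half-edges of the bottom row instead. -/
theorem faceLabel_faceRep (hA : 2 ≤ A) (l : ℕ × ℕ) (hl : l.1 < A ∧ l.2 < 2 * M + 2) :
    faceLabel A M (faceRep A M l) = l := by
  obtain ⟨r, c⟩ := l
  unfold faceRep
  rw [dif_pos hl]
  simp only at hl ⊢
  split_ifs with h1 h2
  · rw [faceLabel_east]
    unfold labelSE labelBottom
    split_ifs <;> first | omega | (ext <;> simp <;> omega)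
  · rw [faceLabel_east]
    unfold labelSE labelBottom
    split_ifs <;> first | omega | (ext <;> simp <;> omega)
  · rw [faceLabel_north, labelNE, if_neg h1]

theorem faceLabel_mem (hA : 2 ≤ A) (hM : 0 < M) (d : (grid A M).HalfEdge) :
    (faceLabel A M d).1 < A ∧ (faceLabel A M d).2 < 2 * M + 2 := by
  have hNE : ∀ r < A, ∀ c < 2 * M + 2,
      (labelNE A M r c).1 < A ∧ (labelNE A M r c).2 < 2 * M + 2 := by
    intro r hr c hc
    unfold labelNE; split_ifs <;> constructor <;> simp only <;> omega
  have hNW : ∀ r < A, ∀ c < 2 * M + 2,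
      (labelNW A M r c).1 < A ∧ (labelNW A M r c).2 < 2 * M + 2 := by
    intro r hr c hc
    unfold labelNW; split_ifs <;> exact hNE _ (by omega) _ (by omega)
  have hB : ∀ c < 2 * M + 2, (labelBottom A M c).1 < A ∧ (labelBottom A M c).2 < 2 * M + 2 := by
    intro c hc
    unfold labelBottom; split_ifs <;> constructor <;> simp only <;> omega
  induction d using grid_halfEdge_cases with
  | h1 => constructor <;> simp only [faceLabel] <;> omega
  | h2 => constructor <;> simp only [faceLabel] <;> omega
  | h3 r c hr hc =>
    rw [faceLabel_east]; unfold labelSE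
    split_ifs
    · exact hB c hc
    · exact hNE _ (by omega) _ hc
  | h4 r c hr hc => exact (faceLabel_north hr hc).symm ▸ hNE r hr c hc
  | h5 r c hr hc => exact hNW r hr c hc
  | h6 r c hr hc =>
    rw [faceLabel_south]; unfold labelSW
    split_ifs
    · constructor <;> simp only <;> omega
    · exact hB _ (by omega)
    · exact hNW _ (by omega) _ hc

theorem sameCycle_of_eq {X : Type} {π : Equiv.Perm X} {x y : X} (h : π x = y) :
    π.SameCycle x y := ⟨1, by rw [zpow_one, h]⟩

theorem faceRep_of_not {l : ℕ × ℕ} (h1 : l.1 < A) (h2 : l.2 < 2 * M + 2)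
    (h : ¬ (l.1 + 1 = A ∧ l.2 % 2 = 1 ∧ l.2 < 2 * M)) : faceRep A M l = gridNorth h1 h2 := by
  unfold faceRep; rw [dif_pos ⟨h1, h2⟩, if_neg h]

/-- Walking to the left along the top, the long face passes around the caps that join the columns `2
* k` and `2 * k + 1`, until the spiral leads to the end of the row `A - 2`. -/
theorem sameCycle_gridWest_top (hA : 2 ≤ A) (k : ℕ) (hk : k ≤ M) :
    (gridFacePerm A M).SameCycle (gridWest (r := A - 1) (c := 2 * k) (by omega) (by omega))
      (gridNorth (r := A - 2) (c := 2 * M + 1) (by omega) (by omega)) := by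
  induction k with
  | zero =>
    obtain ⟨B, rfl⟩ : ∃ B, A = B + 2 := ⟨A - 2, by omega⟩
    exact sameCycle_of_eq (gridFacePerm_west_first (A := B + 2) (r := B) (by omega))
  | succ k ih =>
    refine (sameCycle_of_eq (gridFacePerm_west (c := 2 * k + 1) (by omega) (by omega))).trans
      (.trans (sameCycle_of_eq ?_) (ih (by omega)))
    exact gridFacePerm_north_top_right (c := 2 * k) (by omega) (by omega)
      (by unfold IsUp; omega) (by unfold IsUp; omega)

/-- Walking to the right along the bottom, the long face passes around the turns up to column `2 * M
- 1`; from there it follows the curve around the torus to the top. -/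
theorem sameCycle_gridEast_bottom (hA : 2 ≤ A) (j k : ℕ) (hk : k + j + 1 = M) :
    (gridFacePerm A M).SameCycle (gridEast (r := 0) (c := 2 * k) (by omega) (by omega))
      (gridNorth (r := A - 2) (c := 2 * M + 1) (by omega) (by omega)) := by
  induction j generalizing k with
  | zero =>
    subst hk
    refine (sameCycle_of_eq (gridFacePerm_east (by omega) (by omega))).trans
      (.trans (sameCycle_of_eq ?_) (sameCycle_gridWest_top hA (k + 1) (by omega)))
    exact gridFacePerm_south_bottom_top (c := 2 * k + 1) (by omega) (by omega)
      (by unfold IsUp; omega) (by unfold IsUp; omega)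
  | succ j ih =>
    refine (sameCycle_of_eq (gridFacePerm_east (by omega) (by omega))).trans
      (.trans (sameCycle_of_eq ?_) (ih (k + 1) (by omega)))
    exact gridFacePerm_south_bottom_left (c := 2 * k + 1) (by omega) (by omega)
      (by unfold IsUp; omega) (by unfold IsUp; omega)

theorem sameCycle_gridNorth (hA : 2 ≤ A) (hr : r < A) (hc : c < 2 * M + 2) :
    (gridFacePerm A M).SameCycle (gridNorth hr hc) (faceRep A M (labelNE A M r c)) := by
  unfold labelNE
  split_ifs with h
  · obtain ⟨k, rfl⟩ : ∃ k, c = 2 * k + 1 := ⟨c / 2, by omega⟩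
    obtain rfl : r = A - 1 := by omega
    rw [faceRep_of_not (l := (A - 2, 2 * M + 1)) (by simp only; omega) (by simp only; omega)
      (by simp only; omega)]
    refine .trans (sameCycle_of_eq ?_) (sameCycle_gridWest_top hA k (by omega))
    exact gridFacePerm_north_top_right (c := 2 * k) (by omega) (by omega)
      (by unfold IsUp; omega) (by unfold IsUp; omega)
  · rw [faceRep_of_not hr hc h]

theorem sameCycle_gridWest (hA : 2 ≤ A) (hr : r < A) (hc : c < 2 * M + 2) :
    (gridFacePerm A M).SameCycle (gridWest hr hc) (faceRep A M (labelNW A M r c)) := by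
  unfold labelNW
  rcases Nat.eq_zero_or_pos c with rfl | h
  · rw [if_pos rfl]
    rcases Nat.eq_zero_or_pos r with rfl | h
    · rw [if_pos rfl]
      refine (sameCycle_of_eq (gridFacePerm_west_zero_zero (by omega))).trans ?_
      refine (sameCycle_of_eq (gridFacePerm_none_false (by omega))).trans ?_
      exact (sameCycle_of_eq (gridFacePerm_west (by omega) (by omega))).trans
        (sameCycle_gridNorth hA _ _)
    · obtain ⟨r, rfl⟩ := Nat.exists_eq_succ_of_ne_zero h.ne'
      rw [if_neg (by omega)]
      exact (sameCycle_of_eq (gridFacePerm_west_first hr)).trans (sameCycle_gridNorth hA _ _)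
  · obtain ⟨c, rfl⟩ := Nat.exists_eq_succ_of_ne_zero h.ne'
    rw [if_neg (by omega)]
    exact (sameCycle_of_eq (gridFacePerm_west hr hc)).trans (sameCycle_gridNorth hA _ _)

theorem sameCycle_gridEast_zero (hA : 2 ≤ A) (hM : 0 < M) (hc : c < 2 * M + 2) :
    (gridFacePerm A M).SameCycle (gridEast (r := 0) (by omega) hc)
      (faceRep A M (labelBottom A M c)) := by
  -- This face is entered from the top of column `2 * M`, by following the strand around the torus.
  have hlast : (gridFacePerm A M).SameCycle
      (gridEast (r := 0) (c := 2 * M - 1) (by omega) (by omega))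
      (faceRep A M (A - 1, 2 * M)) := by
    rw [faceRep_of_not (l := (A - 1, 2 * M)) (by simp only; omega) (by simp only; omega)
      (by simp only; omega)]
    refine (sameCycle_of_eq ?_).symm
    obtain ⟨N, rfl⟩ := Nat.exists_eq_succ_of_ne_zero hM.ne'
    exact gridFacePerm_north_bottom_top (c := 2 * N + 1) (by omega) (by omega)
      (by unfold IsUp; omega) (by unfold IsUp; omega)
  unfold labelBottom
  split_ifs with h1 h2 h3 h4
  · obtain ⟨k, rfl⟩ : ∃ k, c = 2 * k := ⟨c / 2, by omega⟩
    rw [faceRep_of_not (l := (A - 2, 2 * M + 1)) (by simp only; omega) (by simp only; omega)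
      (by simp only; omega)]
    exact sameCycle_gridEast_bottom hA (M - k - 1) k (by omega)
  · obtain rfl : c = 2 * M - 1 := by omega
    exact hlast
  · unfold faceRep
    rw [dif_pos (by simp only; omega), if_pos (by simp only; omega), if_neg (by simpa using h3)]
  · subst h4
    unfold faceRep
    rw [dif_pos (by simp only; omega), if_pos (by simp only; omega), if_pos (by simp only; omega)]
  · obtain rfl : c = 2 * M + 1 := by omega
    -- The boundary runs from below `(0, 2 * M - 1)` around the turn joining the last two columns;
    -- it is used in reverse.
    refine .trans (.symm (.trans ?_ (sameCycle_of_eq (gridFacePerm_south_bottom_left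
      (c := 2 * M) (by omega) (by omega) (by unfold IsUp; omega) (by unfold IsUp; omega))))) hlast
    obtain ⟨N, rfl⟩ := Nat.exists_eq_succ_of_ne_zero hM.ne'
    exact sameCycle_of_eq (gridFacePerm_east (c := 2 * N + 1) (by omega) (by omega))

theorem sameCycle_faceRep (hA : 2 ≤ A) (hM : 0 < M) (d : (grid A M).HalfEdge) :
    (gridFacePerm A M).SameCycle d (faceRep A M (faceLabel A M d)) := by
  have hA' : 0 < A := by omega
  have hlast : (gridFacePerm A M).SameCycle
      (gridNorth (r := A - 1) (c := 2 * M + 1) (by omega) (by omega))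
      (faceRep A M (A - 1, 2 * M + 1)) := by
    rw [faceRep_of_not (l := (A - 1, 2 * M + 1)) (by simp only; omega) (by simp only; omega)
      (by simp only; omega)]
  induction d using grid_halfEdge_cases with
  | h1 => exact (sameCycle_of_eq (gridFacePerm_north_last hA')).symm.trans hlast
  | h2 =>
    refine (sameCycle_of_eq (gridFacePerm_none_false hA')).trans ?_
    have h := sameCycle_gridWest (M := M) hA (r := A - 1) (c := 2 * M + 1) (by omega) (by omega)
    have h' : labelNW A M (A - 1) (2 * M + 1) = (A - 1, 2 * M) := by simp [labelNW, labelNE]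
    rwa [h'] at h
  | h3 r c hr hc =>
    rw [faceLabel_east]
    unfold labelSE
    rcases Nat.eq_zero_or_pos r with rfl | h
    · rw [if_pos rfl]; exact sameCycle_gridEast_zero hA hM hc
    · obtain ⟨r, rfl⟩ := Nat.exists_eq_succ_of_ne_zero h.ne'
      rw [if_neg (by omega)]
      exact (sameCycle_of_eq (gridFacePerm_north hr hc)).symm.trans (sameCycle_gridNorth hA _ _)
  | h4 r c hr hc => rw [faceLabel_north]; exact sameCycle_gridNorth hA hr hc
  | h5 r c hr hc => exact sameCycle_gridWest hA hr hc
  | h6 r c hr hc =>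
    rw [faceLabel_south]
    unfold labelSW
    rcases Nat.eq_zero_or_pos r with rfl | h
    · rw [if_pos rfl]
      rcases Nat.eq_zero_or_pos c with rfl | h
      · rw [if_pos rfl]
        exact (sameCycle_of_eq (gridFacePerm_south_zero_zero hA' hM)).trans hlast
      · obtain ⟨c, rfl⟩ := Nat.exists_eq_succ_of_ne_zero h.ne'
        rw [if_neg (by omega)]
        exact (sameCycle_of_eq (gridFacePerm_east hr hc)).symm.trans
          (sameCycle_gridEast_zero hA hM _)
    · obtain ⟨r, rfl⟩ := Nat.exists_eq_succ_of_ne_zero h.ne'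
      rw [if_neg (by omega)]
      exact (sameCycle_of_eq (gridFacePerm_south hr hc)).trans (sameCycle_gridWest hA _ _)

/-- The labels range over the full rectangle of crossings. This is the count that makes the surface
a torus. -/
theorem numCycles_gridFacePerm (hA : 2 ≤ A) (hM : 0 < M) :
    numCycles (gridFacePerm A M) = Fintype.card (grid A M).Crossing := by
  rw [numCycles_eq_card_finset (gridFacePerm A M) (Finset.range A ×ˢ Finset.range (2 * M + 2))
    (faceLabel A M) (faceRep A M)]
  · change _ = Fintype.card (Fin A × Fin (2 * M + 2))
    simp
  · intro d
    simpa using faceLabel_mem hA hM d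
  · exact faceLabel_gridFacePerm hA hM
  · intro l hl
    exact faceLabel_faceRep hA l (by simpa using hl)
  · exact sameCycle_faceRep hA hM

end

end LongGaussDiagram

/-! ### Prescribing the two factors by a selection of crossings. -/

theorem sum_range_two_mul {R : Type*} [AddCommMonoid R] (F : ℕ → R) (n : ℕ) :
    ∑ c ∈ Finset.range (2 * n), F c = ∑ k ∈ Finset.range n, (F (2 * k) + F (2 * k + 1)) := by
  induction n with
  | zero => simp
  | succ n ih =>
    rw [mul_add, mul_one, Finset.sum_range_succ, Finset.sum_range_succ, Finset.sum_range_succ, ih,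
      add_assoc]

namespace LongGaussDiagram

theorem sum_grid {A M : ℕ} {R : Type*} [AddCommMonoid R] (F : ℕ → ℕ → R) :
    ∑ i : (grid A M).Crossing, F i.1 i.2 =
      ∑ r ∈ Finset.range A, ∑ c ∈ Finset.range (2 * M + 2), F r c := by
  refine (Fintype.sum_prod_type (α₁ := Fin A) (α₂ := Fin (2 * M + 2)) _).trans ?_
  rw [Finset.sum_range]
  exact Finset.sum_congr rfl fun r _ => (Finset.sum_range (F r)).symm

/-- The sum of the terms `ε (t ^ (α · γ) - 1)` over the selected crossings on the first columns. -/
noncomputable def gridLeft (A M : ℕ) (p : ℕ → ℕ → Prop) [∀ r c, Decidable (p r c)] : ℤ[T;T⁻¹] :=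
  ∑ r ∈ Finset.range A, ∑ c ∈ Finset.range (2 * M),
    C (if p r c then colSign M c else 0) * (T (-(r + 1)) - 1)

/-- The sum of the terms `ε (t ^ (α · γ) - 1)` over the selected crossings on the last two
columns. -/
noncomputable def gridRight (A M : ℕ) (p : ℕ → ℕ → Prop) [∀ r c, Decidable (p r c)] : ℤ[T;T⁻¹] :=
  ∑ r ∈ Finset.range A, (C (if p r (2 * M) then -1 else 0) * (T (A - r) - 1) +
    C (if p r (2 * M + 1) then 1 else 0) * (T (A - r) - 1))

theorem sum_grid_left {A M : ℕ} (p : ℕ → ℕ → Prop) [∀ r c, Decidable (p r c)] :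
    ∑ i : (grid A M).Crossing, (if (i.2 : ℕ) < 2 * M then
      C (if p i.1 i.2 then colSign M i.2 else 0) * (T (gridExp A M i.1 i.2) - 1) else 0) =
      gridLeft A M p := by
  rw [sum_grid fun r c => if c < 2 * M then
      C (if p r c then colSign M c else 0) * (T (gridExp A M r c) - 1) else 0]
  refine Finset.sum_congr rfl fun r _ => ?_
  rw [Finset.sum_range_succ, Finset.sum_range_succ, if_neg (by omega), if_neg (by omega), add_zero,
    add_zero]
  refine Finset.sum_congr rfl fun c hc => ?_
  have hc := Finset.mem_range.1 hc
  rw [if_pos hc, gridExp, if_pos hc]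

theorem sum_grid_right {A M : ℕ} (p : ℕ → ℕ → Prop) [∀ r c, Decidable (p r c)] :
    ∑ i : (grid A M).Crossing, (if (i.2 : ℕ) < 2 * M then 0 else
      C (if p i.1 i.2 then colSign M i.2 else 0) * (T (gridExp A M i.1 i.2) - 1)) =
      gridRight A M p := by
  rw [sum_grid fun r c => if c < 2 * M then 0 else
      C (if p r c then colSign M c else 0) * (T (gridExp A M r c) - 1)]
  refine Finset.sum_congr rfl fun r _ => ?_
  have h1 : ¬ IsUp M (2 * M) := by unfold IsUp; omega
  have h2 : IsUp M (2 * M + 1) := Or.inr rfl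
  have h3 : ¬ 2 * M + 1 < 2 * M := by omega
  rw [Finset.sum_range_succ, Finset.sum_range_succ, Finset.sum_eq_zero fun c hc =>
    if_pos (Finset.mem_range.1 hc), zero_add]
  simp only [gridExp, colSign, h1, h2, h3, lt_irrefl, if_true, if_false]

/-- The selected crossings are made the only ones of type `a` by crossing changes; the product
formula then applies with the intersection numbers of the unchanged grid. -/
theorem exists_knot_G_eq {A M : ℕ} (hA : 2 ≤ A) (hM : 0 < M) (p : ℕ → ℕ → Prop)
    [∀ r c, Decidable (p r c)] (a : Fin 2) :
    ∃ K : LongVirtualKnot, K.G a a = gridLeft A M p * gridRight A M p ∧ K.sg₁ ≤ 1 := by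
  set Y : Finset (grid A M).Crossing := Finset.univ.filter fun i => p i.1 i.2 with hY
  have hsg : ∀ X : Finset (grid A M).Crossing, ((grid A M).change X).knot.sg₁ ≤ 1 :=
    (grid_isTight A M).sg₁_knot_change_le_one (numCycles_gridFacePerm hA hM)
  have hG : ∀ (X : Finset (grid A M).Crossing) (a : Fin 2), ((grid A M).change X).G a a =
      (∑ i : (grid A M).Crossing, if (i.2 : ℕ) < 2 * M then
        ((grid A M).change X).weight a i * (T (gridExp A M i.1 i.2) - 1) else 0) *
      (∑ i : (grid A M).Crossing, if (i.2 : ℕ) < 2 * M then 0 else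
        ((grid A M).change X).weight a i * (T (gridExp A M i.1 i.2) - 1)) := fun X a =>
    G_eq_mul ((grid A M).change X) a (fun i : (grid A M).Crossing => (i.2 : ℕ) < 2 * M)
      (fun i : (grid A M).Crossing => gridExp A M i.1 i.2)
      (fun i j => (inter_change (grid A M) X i j).trans (grid_inter i j))
  rw [← sum_grid_left, ← sum_grid_right]
  have ha : a = 0 ∨ a = 1 := by fin_cases a <;> simp
  rcases ha with rfl | rfl
  -- Changing the complement leaves exactly the selected crossings at type `0`, with their signs.
  · refine ⟨((grid A M).change Yᶜ).knot, ?_, hsg _⟩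
    refine (hG Yᶜ 0).trans ?_
    have hw : ∀ i : (grid A M).Crossing, ((grid A M).change Yᶜ).weight 0 i =
        C (if p i.1 i.2 then colSign M i.2 else 0) := by
      intro i
      rw [weight_change_zero _ _ grid_type, grid_sign]
      by_cases h : p i.1 i.2 <;> simp [hY, h]
    simp only [hw]
  -- Here the selected crossings receive type `1` and reversed signs; the two minus signs cancel in
  -- the product.
  · refine ⟨((grid A M).change Y).knot, ?_, hsg _⟩
    refine (hG Y 1).trans ?_
    have hw : ∀ i : (grid A M).Crossing, ((grid A M).change Y).weight 1 i =
        -C (if p i.1 i.2 then colSign M i.2 else 0) := by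
      intro i
      rw [weight_change_one _ _ grid_type, grid_sign]
      by_cases h : p i.1 i.2 <;> simp [hY, h]
    rw [← neg_mul_neg, ← Finset.sum_neg_distrib, ← Finset.sum_neg_distrib]
    congr 1 <;> refine Finset.sum_congr rfl fun i _ => ?_ <;> rw [hw] <;> split_ifs <;> ring

/-- The crossings selected to realize given coefficients `x` on the first columns, and
`t ^ (n + 1) - t ^ n` on the last two columns. -/
def gridSelect (A M n : ℕ) (x : ℕ → ℤ) (r c : ℕ) : Prop :=
  if c < 2 * M then
    if c % 2 = 0 then c / 2 < (x r).toNat else c / 2 < (-x r).toNat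
  else if c = 2 * M then r + n = A else r + n + 1 = A

instance (A M n : ℕ) (x : ℕ → ℤ) (r c : ℕ) : Decidable (gridSelect A M n x r c) := by
  unfold gridSelect; infer_instance

theorem sum_range_ite_lt {m M : ℕ} (h : m ≤ M) (z : ℤ) :
    ∑ k ∈ Finset.range M, (if k < m then z else 0) = m * z := by
  rw [← Finset.sum_filter]
  have : (Finset.range M).filter (· < m) = Finset.range m := by
    ext k; simp; omega
  rw [this]; simp

/-- In each row the even columns supply `M` positive crossings and the odd ones `M` negative
crossings, all with the same exponent. The positive or the negative part of `x r` is selected from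
them. -/
theorem gridLeft_gridSelect {A M n : ℕ} {x : ℕ → ℤ} (hx : ∀ r < A, (x r).natAbs ≤ M) :
    gridLeft A M (gridSelect A M n x) =
      ∑ r ∈ Finset.range A, C (x r) * (T (-(r + 1)) - 1) := by
  refine Finset.sum_congr rfl fun r hr => ?_
  have hr := hx r (Finset.mem_range.1 hr)
  rw [← Finset.sum_mul, ← map_sum]
  congr 2
  rw [sum_range_two_mul]
  have h : ∀ k ∈ Finset.range M,
      ((if gridSelect A M n x r (2 * k) then colSign M (2 * k) else 0) +
        if gridSelect A M n x r (2 * k + 1) then colSign M (2 * k + 1) else 0) =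
      (if k < (x r).toNat then 1 else 0) + if k < (-x r).toNat then -1 else 0 := by
    intro k hk
    have hk := Finset.mem_range.1 hk
    have h1 : IsUp M (2 * k) := by unfold IsUp; omega
    have h2 : ¬ IsUp M (2 * k + 1) := by unfold IsUp; omega
    have h3 : gridSelect A M n x r (2 * k) ↔ k < (x r).toNat := by
      unfold gridSelect
      rw [if_pos (by omega), if_pos (by omega)]; omega
    have h4 : gridSelect A M n x r (2 * k + 1) ↔ k < (-x r).toNat := by
      unfold gridSelect
      rw [if_pos (by omega), if_neg (by omega)]; omega
    simp only [h3, h4, colSign, h1, h2, if_true, if_false]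
  rw [Finset.sum_congr rfl h, Finset.sum_add_distrib, sum_range_ite_lt (by omega),
    sum_range_ite_lt (by omega)]
  omega

/-- One negative crossing with exponent `n` and one positive crossing with exponent `n + 1` are
selected; their constant terms cancel. -/
theorem gridRight_gridSelect {A M n : ℕ} {x : ℕ → ℤ} (hn : 0 < n) (hA : n < A) :
    gridRight A M (gridSelect A M n x) = T (n + 1) - T n := by
  have h1 : ∀ r, gridSelect A M n x r (2 * M) ↔ r = A - n := by
    intro r
    unfold gridSelect
    rw [if_neg (by omega), if_pos rfl]; omega
  have h2 : ∀ r, gridSelect A M n x r (2 * M + 1) ↔ r = A - n - 1 := by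
    intro r
    unfold gridSelect
    rw [if_neg (by omega), if_neg (by omega)]; omega
  have h3 : A - n < A := by omega
  have h4 : A - n - 1 < A := by omega
  unfold gridRight
  simp only [h1, h2, Finset.sum_add_distrib, apply_ite C, map_zero, ite_mul, zero_mul,
    Finset.sum_ite_eq', Finset.mem_range, h3, h4, if_true]
  have h5 : (A : ℤ) - (A - n : ℕ) = n := by omega
  have h6 : (A : ℤ) - (A - n - 1 : ℕ) = n + 1 := by omega
  rw [h5, h6, map_neg, map_one]
  ring

end LongGaussDiagram

/-! ### Realization of a given polynomial, and the equivalence. -/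

theorem toLaurent_eq_sum_range {p : Polynomial ℤ} {N : ℕ} (h : p.natDegree < N) :
    Polynomial.toLaurent p = ∑ k ∈ Finset.range N, C (p.coeff k) * T k := by
  conv_lhs => rw [p.as_sum_range' N h, map_sum]
  exact Finset.sum_congr rfl fun k _ => Polynomial.toLaurent_C_mul_T k _

/-- Every Laurent polynomial `f` with `f(1) = f'(1) = 0` is the intersection polynomial of a long
virtual knot that is realized on the torus. -/
theorem exists_knot_sg₁_le_one (f : ℤ[T;T⁻¹]) (h0 : laurentEvalOne f = 0)
    (h1 : laurentEvalOne (laurentDeriv f) = 0) (a : Fin 2) :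
    ∃ K : LongVirtualKnot, K.G a a = f ∧ K.sg₁ ≤ 1 := by
  obtain ⟨m, q, rfl⟩ := exists_eq_mul_of_laurentDerivOne_eq_zero f h0 h1
  set u : Polynomial ℤ := (Polynomial.X - 1) * q with hu
  set n := u.natDegree + 1 with hn
  -- Row `r` carries the exponent `-(r + 1) = -(m + n) + k` with `k = m + n - 1 - r`, so the
  -- coefficients of `u` appear in reverse order.
  set x : ℕ → ℤ := fun r => if r < m + n then u.coeff (m + n - 1 - r) else 0 with hx
  -- Any positive bound for all `|x r|` would do.
  set M := 1 + ∑ r ∈ Finset.range (m + n + 1), (x r).natAbs with hM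
  have hxM : ∀ r < m + n + 1, (x r).natAbs ≤ M := by
    intro r hr
    have := Finset.single_le_sum (f := fun r => (x r).natAbs) (fun _ _ => Nat.zero_le _)
      (Finset.mem_range.2 hr)
    omega
  -- The first factor needs only `m + n` rows; the additional one makes the exponent `n + 1`
  -- available on the last columns even for `m = 0`.
  obtain ⟨K, hK, hsg⟩ := LongGaussDiagram.exists_knot_G_eq (A := m + n + 1) (M := M) (by omega)
    (by omega) (LongGaussDiagram.gridSelect (m + n + 1) M n x) a
  refine ⟨K, hK.trans ?_, hsg⟩
  rw [LongGaussDiagram.gridLeft_gridSelect hxM,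
    LongGaussDiagram.gridRight_gridSelect (by omega) (by omega)]
  -- This is `u(1) = 0`, which cancels the constants of the terms `T (-(r + 1)) - 1`.
  have hsum : ∑ k ∈ Finset.range (m + n), u.coeff k = 0 := by
    have h := Polynomial.eval_eq_sum_range' (by omega : u.natDegree < m + n) 1
    rw [hu, Polynomial.eval_mul, ← hu] at h
    simpa using h.symm
  have hleft : ∑ r ∈ Finset.range (m + n + 1), C (x r) * (T (-((r : ℤ) + 1)) - 1) =
      T (-m - n) * Polynomial.toLaurent u := by
    rw [Finset.sum_range_succ, ← Finset.sum_range_reflect,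
      toLaurent_eq_sum_range (by omega : u.natDegree < m + n), Finset.mul_sum]
    have hlast : x (m + n) = 0 := if_neg (lt_irrefl _)
    rw [hlast, map_zero, zero_mul, add_zero]
    have hterm : ∀ k ∈ Finset.range (m + n),
        C (x (m + n - 1 - k)) * (T (-(((m + n - 1 - k : ℕ) : ℤ) + 1)) - 1) =
        T (-m - n) * (C (u.coeff k) * T k) - C (u.coeff k) := by
      intro k hk
      have hk := Finset.mem_range.1 hk
      have e1 : x (m + n - 1 - k) = u.coeff k := by
        simp only [hx]
        rw [if_pos (by omega)]
        congr 1
        omega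
      have e2 : -(((m + n - 1 - k : ℕ) : ℤ) + 1) = (-m - n) + k := by omega
      rw [e1, e2, T_add]
      ring
    rw [Finset.sum_congr rfl hterm, Finset.sum_sub_distrib, ← map_sum, hsum, map_zero, sub_zero]
  rw [hleft]
  have e3 : (T (n + 1) - T n : ℤ[T;T⁻¹]) = T n * (T 1 - 1) := by rw [T_add]; ring
  have e4 : (T (-m : ℤ) : ℤ[T;T⁻¹]) = T (-m - n) * T n := by rw [← T_add]; congr 1; ring
  rw [e3, e4]
  ring

theorem theorem7p2 (f : ℤ[T;T⁻¹]) :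
    List.TFAE
      [∃ K : LongVirtualKnot, K.G 0 0 = f,
        ∃ K' : LongVirtualKnot, K'.G 0 0 = f ∧ K'.sg₁ ≤ 1,
        laurentEvalOne f = 0 ∧ laurentEvalOne (laurentDeriv f) = 0] ∧
    List.TFAE
      [∃ K : LongVirtualKnot, K.G 1 1 = f,
        ∃ K' : LongVirtualKnot, K'.G 1 1 = f ∧ K'.sg₁ ≤ 1,
        laurentEvalOne f = 0 ∧ laurentEvalOne (laurentDeriv f) = 0] := by
  have key : ∀ a : Fin 2, List.TFAE
      [∃ K : LongVirtualKnot, K.G a a = f,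
        ∃ K' : LongVirtualKnot, K'.G a a = f ∧ K'.sg₁ ≤ 1,
        laurentEvalOne f = 0 ∧ laurentEvalOne (laurentDeriv f) = 0] := by
    intro a
    tfae_have 1 → 3
    | ⟨K, hK⟩ => by
      induction K using Quot.ind with
      | mk D =>
        rw [← hK]
        exact ⟨D.laurentEvalOne_G a a, D.laurentDerivOne_G a⟩
    tfae_have 3 → 2 := fun h => exists_knot_sg₁_le_one f h.1 h.2 a
    tfae_have 2 → 1 := fun ⟨K, hK, _⟩ => ⟨K, hK⟩
    tfae_finish
  exact ⟨key 0, key 1⟩
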